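/- Throughout, $(V,Y,\mathbf 1,\omega)$ is a vertex operator algebra over $\mathbb C$ (graded by $V=\bigoplus_{n\in\mathbb Z}V_n$, the eigenspaces of $L(0)$, with $\dim V_n<\infty$ and $V_n=0$ for $n\ll0$; $\operatorname{wt}v=n$ for $v\in V_n$), and $g$ is an automorphism of $V$ of finite order $T$. Put $V^r=\{v\in V: gv=e^{2\pi i r/T}v\}$, $0\le r<T$, so that $V=\bigoplus_r V^r$. **The algebra $A_g(V)$.** Let $\delta_0=1$ and $\delta_r=0$ for $0<r<T$. For homogeneous $u\in V^r$ and $v\in V$ let $$u\circ_g v=\operatorname{Res}_z\frac{(1+z)^{\operatorname{wt}u-1+\delta_r+r/T}}{z^{1+\delta_r}}Y(u,z)v,\qquad u*_gv=\begin{cases}\operatorname{Res}_z\frac{(1+z)^{\operatorname{wt}u}}{z}Y(u,z)v,& r=0,\\ 0,& r>0,\end{cases}$$ extended bilinearly. Let $O_g(V)$ be the span of all $u\circ_gv$. Then $A_g(V)=V/O_g(V)$ is an associative algebra under $*_g$, with unit $\mathbf 1+O_g(V)$. **Twisted modules.** A weak $g$-twisted $V$-module is a complex vector space $M$ with a linear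 map $v\mapsto Y_M(v,z)=\sum_{n\in\mathbb Q}v_nz^{-n-1}$, $v_n\in\operatorname{End}M$, such that $v_n=0$ for $v\in V^r$ and $n\notin r/T+\mathbb Z$; $v_nw=0$ for $n\gg0$ ($v\in V$, $w\in M$); $Y_M(\mathbf 1,z)=\mathrm{id}$; and for $u\in V^r$, $v\in V$ the twisted Jacobi identity $$z_0^{-1}\delta\!\left(\tfrac{z_1-z_2}{z_0}\right)Y_M(u,z_1)Y_M(v,z_2)-z_0^{-1}\delta\!\left(\tfrac{z_2-z_1}{-z_0}\right)Y_M(v,z_2)Y_M(u,z_1)=z_2^{-1}\left(\tfrac{z_1-z_0}{z_2}\right)^{-r/T}\delta\!\left(\tfrac{z_1-z_0}{z_2}\right)Y_M(Y(u,z_0)v,z_2)$$ holds. It is admissible if it carries a grading $M=\bigoplus_{n\in\frac1T\mathbb Z_{\ge0}}M(n)$ with $v_mM(n)\subseteq M(n+\operatorname{wt}v-m-1)$ for homogeneous $v$. Morphisms of admissible modules are the grade-preserving linear maps that commute with all $v_n$; submodules of admissible modules are the graded ones. A nonzero admissible module is simple if its only submodules are $0$ and itself, and gradings of simple admissible modules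 are normalized (by a shift) so that $M(0)\neq0$. An admissible module is completely reducible if it is a direct sum of simple submodules, each normalized in this way. An $A_g(V)$-module is completely reducible if it is a direct sum of simple modules. **The functor $\Omega$.** For an admissible $g$-twisted module $M$ let $\Omega(M)=\{w\in M: v_mw=0\text{ for all homogeneous }v\text{ and all }m\text{ with }\operatorname{wt}v-m-1<0\}$. It is an $A_g(V)$-module on which $a+O_g(V)$ acts as $o(a)$, where $o(a)=a_{\operatorname{wt}a-1}$ for homogeneous $a$; on morphisms $\Omega$ is restriction. **The functor $L$.** Let $V[g]$ be the Lie algebra $\mathcal L/D\mathcal L$, where $\mathcal L=\bigoplus_r t^{r/T}\mathbb C[t,t^{-1}]\otimes V^r$, $D=\frac d{dt}\otimes1+1\otimes L(-1)$, and, with $a(q)$ the image of $t^q\otimes a$, $[a(m),b(n)]=\sum_{i\ge0}\binom mi(a_ib)(m+n-i)$. It is graded by $\deg a(q)=\operatorname{wt}a-q-1$. An $A_g(V)$-module $U$ is a module for $V[g]_-\oplus V[g]_0$ (the parts of negative and zero degree): $V[g]_-$ acts by $0$, and $a(\operatorname{wt}a-1)$, $a\in V^0$ homogeneous, acts as $a+O_g(V)$.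 Let $M(U)=U(V[g])\otimes_{U(V[g]_-\oplus V[g]_0)}U$ be the induced $V[g]$-module, with the grading in which $U$ has degree $0$, let $J$ be its largest graded $V[g]$-submodule with $J\cap U=0$, and let $L(U)=M(U)/J$, where $v_q$ acts as $v(q)$ for $v\in V^r$, $q\in r/T+\mathbb Z$. A homomorphism $U\to U'$ induces $M(U)\to M(U')$ and hence $L(U)\to L(U')$. **Theorem.** $L$ is a well-defined functor from $A_g(V)$-modules to admissible $g$-twisted $V$-modules (that is, each $L(U)$ is an admissible $g$-twisted $V$-module and $M(U)\to M(U')$ carries $J$ into $J$). The functors $L$ and $\Omega$ send completely reducible modules to completely reducible modules, and their restrictions to the full subcategories of completely reducible $A_g(V)$-modules and completely reducible admissible $g$-twisted $V$-modules are equivalences of categories that are quasi-inverse to each other. In particular, $L$ and $\Omega$ send simple modules to simple modules and induce mutually inverse bijections between the isomorphism classes of simple $A_g(V)$-modules and the isomorphism classes of simple admissible $g$-twisted $V$-modules. -/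

import Mathlib

open CategoryTheory

universe u

noncomputable section

set_option linter.unusedSectionVars false

namespace TwistedVOA

/-! ### Finite sums over `ℕ` (auxiliary) -/

section Sums

variable {X : Type*} [AddCommGroup X] [Module ℂ X]

lemma fs_range {f : ℕ → X} {N : ℕ} (h : ∀ i, N ≤ i → f i = 0) :
    ∑ᶠ i, f i = ∑ i ∈ Finset.range N, f i := by
  apply finsum_eq_sum_of_support_subset
  intro i hi
  simp only [Finset.coe_range, Set.mem_Iio]
  by_contra hc
  exact hi (h i (not_lt.1 hc))

lemma fs_range₂ {f : ℕ → ℕ → X} {N : ℕ} (h : ∀ i j, N ≤ i ∨ N ≤ j → f i j = 0) :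
    ∑ᶠ i, ∑ᶠ j, f i j = ∑ i ∈ Finset.range N, ∑ j ∈ Finset.range N, f i j := by
  have h1 : ∀ i, ∑ᶠ j, f i j = ∑ j ∈ Finset.range N, f i j := fun i =>
    fs_range fun j hj => h i j (Or.inr hj)
  simp only [h1]
  exact fs_range fun i hi => Finset.sum_eq_zero fun j _ => h i j (Or.inl hi)

lemma fs_comm {f : ℕ → ℕ → X} {N : ℕ} (h : ∀ i j, N ≤ i ∨ N ≤ j → f i j = 0) :
    ∑ᶠ i, ∑ᶠ j, f i j = ∑ᶠ j, ∑ᶠ i, f i j := by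
  rw [fs_range₂ h, fs_range₂ (f := fun j i => f i j) (fun i j hij => h j i hij.symm),
    Finset.sum_comm]

lemma fs_anti {f : ℕ → ℕ → X} {N : ℕ} (h : ∀ i j, N ≤ i ∨ N ≤ j → f i j = 0) :
    ∑ᶠ i, ∑ᶠ j, f i j = ∑ᶠ p, ∑ x ∈ Finset.HasAntidiagonal.antidiagonal p, f x.1 x.2 := by
  rw [fs_range₂ h, fs_range (N := 2 * N)]
  · rw [← Finset.sum_product', Finset.sum_sigma']
    symm
    apply Finset.sum_bij_ne_zero (fun x _ _ => x.2)
    · rintro ⟨p, a, b⟩ h1 h2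
      simp only [Finset.mem_product, Finset.mem_range]
      constructor
      · by_contra hc; exact h2 (h _ _ (Or.inl (not_lt.1 hc)))
      · by_contra hc; exact h2 (h _ _ (Or.inr (not_lt.1 hc)))
    · rintro ⟨p, a, b⟩ h1 _ ⟨p', a', b'⟩ h2 _ hh
      simp only [Finset.mem_sigma, Finset.HasAntidiagonal.mem_antidiagonal] at h1 h2
      simp only [Prod.mk.injEq] at hh
      obtain ⟨rfl, rfl⟩ := hh
      obtain ⟨_, rfl⟩ := h1
      obtain ⟨_, rfl⟩ := h2
      rfl
    · rintro ⟨a, b⟩ h1 h2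
      simp only [Finset.mem_product, Finset.mem_range] at h1
      exact ⟨⟨a + b, a, b⟩, by simp; omega, h2, rfl⟩
    · intros; rfl
  · intro p hp
    apply Finset.sum_eq_zero
    rintro ⟨a, b⟩ hab
    simp only [Finset.HasAntidiagonal.mem_antidiagonal] at hab
    apply h
    simp only
    omega

lemma choose_mul (α : ℂ) (x t : ℕ) :
    Ring.choose α (x + t) * ((x + t).choose x : ℂ) = Ring.choose α x * Ring.choose (α - x) t := by
  have := Ring.choose_smul_choose α (n := x + t) (k := x) (by omega)
  simp only [Nat.add_sub_cancel_left, nsmul_eq_mul] at this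
  rw [← this, mul_comm]

/-- Vandermonde, summed against a finitely supported sequence. -/
lemma fs_vandermonde (α β : ℂ) {f : ℕ → X} {N : ℕ} (h : ∀ i, N ≤ i → f i = 0) :
    ∑ᶠ k, Ring.choose (α + β) k • f k =
      ∑ᶠ t, ∑ᶠ q, (Ring.choose α t * Ring.choose β q) • f (t + q) := by
  rw [fs_anti (N := N)]
  · apply finsum_congr
    intro p
    rw [Ring.add_choose_eq p (Commute.all α β), Finset.sum_smul]
    apply Finset.sum_congr rfl
    rintro ⟨a, b⟩ hab
    simp only [Finset.HasAntidiagonal.mem_antidiagonal] at hab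
    simp [hab]
  · rintro i j hij
    rw [h _ (by omega), smul_zero]

lemma fs_trinomial (α : ℂ) {G : ℕ → ℕ → X} {N : ℕ} (h : ∀ i j, N ≤ i ∨ N ≤ j → G i j = 0) :
    ∑ᶠ p, Ring.choose α p • (∑ x ∈ Finset.HasAntidiagonal.antidiagonal p, ((p.choose x.1 : ℕ) : ℂ) • G x.1 x.2) =
      ∑ᶠ x, ∑ᶠ t, (Ring.choose α x * Ring.choose (α - x) t) • G x t := by
  rw [fs_anti (N := N)]
  · apply finsum_congr
    intro p
    rw [Finset.smul_sum]
    apply Finset.sum_congr rfl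
    rintro ⟨a, b⟩ hab
    simp only [Finset.HasAntidiagonal.mem_antidiagonal] at hab
    subst hab
    rw [smul_smul, choose_mul]
  · intro i j hij
    rw [h _ _ hij, smul_zero]

/-- The family `f i j` vanishes for `i` or `j` large, uniformly once `j` is bounded below. -/
def Trunc (f : ℤ → ℤ → X) : Prop :=
  ∀ j₀ : ℤ, ∃ N : ℤ, ∀ i j, j₀ ≤ j → (N ≤ i ∨ N ≤ j) → f i j = 0

lemma trunc_of {f : ℤ → ℤ → X} (h1 : ∃ N : ℤ, ∀ i j, N ≤ j → f i j = 0)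
    (h2 : ∀ j, ∃ N : ℤ, ∀ i, N ≤ i → f i j = 0) : Trunc f := by
  intro j₀
  obtain ⟨N1, hN1⟩ := h1
  choose M hM using h2
  obtain ⟨B, hB⟩ := ((Set.finite_Icc j₀ N1).image M).bddAbove
  refine ⟨max N1 B, fun i j hj hij => ?_⟩
  by_cases hj1 : N1 ≤ j
  · exact hN1 i j hj1
  · rcases hij with hi | hi
    · exact hM j i (le_trans (hB ⟨j, ⟨hj, by omega⟩, rfl⟩) (le_trans (le_max_right _ _) hi))
    · exact hN1 i j (le_trans (le_max_left _ _) hi)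

/-- The coefficientwise Jacobi (Borcherds) identity, for the three families of products
`A i j = a_i b_j w`, `B j i = b_j a_i w`, `C k s = (a_s b)_k w`. -/
def Borcherds (A B C : ℤ → ℤ → X) : Prop :=
  ∀ l m n : ℤ, ∑ᶠ s : ℕ, Ring.choose (m : ℂ) s • C (m + n - s) (l + s) =
    ∑ᶠ i : ℕ, ((-1 : ℂ) ^ i * Ring.choose (l : ℂ) i) •
      (A (l + m - i) (n + i) - (-1 : ℂ) ^ l • B (l + n - i) (m + i))

lemma borcherds_rhs {A B C : ℤ → ℤ → X} (hA : Trunc A) (hB : Trunc B) (hC : Trunc C)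
    (h : Borcherds A B C) (α β : ℂ) (l m n : ℤ) :
    ∑ᶠ i : ℕ, ((-1 : ℂ) ^ i * Ring.choose (l : ℂ) i) •
      ((∑ᶠ p : ℕ, Ring.choose α p • ∑ᶠ q : ℕ, Ring.choose β q • A (l + m - i + p) (n + i + q)) -
      (-1 : ℂ) ^ l • (∑ᶠ q : ℕ, Ring.choose β q • ∑ᶠ p : ℕ, Ring.choose α p •
        B (l + n - i + q) (m + i + p))) =
    ∑ᶠ q : ℕ, Ring.choose β q • ∑ᶠ p : ℕ, Ring.choose α p •
      ∑ᶠ s : ℕ, Ring.choose ((m + p : ℤ) : ℂ) s • C (m + n + p + q - s) (l + s) := by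
  obtain ⟨N1, hN1⟩ := hA n
  obtain ⟨N2, hN2⟩ := hB m
  obtain ⟨N3, hN3⟩ := hC l
  obtain ⟨N, hN⟩ : ∃ N : ℕ, N = (N1.natAbs + N2.natAbs + N3.natAbs + l.natAbs + m.natAbs + n.natAbs) * 3 := ⟨_, rfl⟩
  have ha : ∀ p q i : ℕ, N ≤ p ∨ N ≤ q ∨ N ≤ i → A (l + m - i + p) (n + i + q) = 0 := by
    intro p q i hh
    apply hN1 _ _ (by omega)
    by_contra hc
    push Not at hc
    omega
  have hb : ∀ p q i : ℕ, N ≤ p ∨ N ≤ q ∨ N ≤ i → B (l + n - i + q) (m + i + p) = 0 := by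
    intro p q i hh
    apply hN2 _ _ (by omega)
    by_contra hc
    push Not at hc
    omega
  have hc : ∀ p q s : ℕ, N ≤ p ∨ N ≤ q ∨ N ≤ s → C (m + n + p + q - s) (l + s) = 0 := by
    intro p q s hh
    apply hN3 _ _ (by omega)
    by_contra hc
    push Not at hc
    omega
  have e1 : ∀ i : ℕ, ∑ᶠ p : ℕ, Ring.choose α p • ∑ᶠ q : ℕ, Ring.choose β q •
        A (l + m - i + p) (n + i + q) = ∑ q ∈ Finset.range N, Ring.choose β q •
          ∑ p ∈ Finset.range N, Ring.choose α p • A (l + m - i + p) (n + i + q) := by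
    intro i
    have : ∀ p : ℕ, ∑ᶠ q : ℕ, Ring.choose β q • A (l + m - i + p) (n + i + q) =
        ∑ q ∈ Finset.range N, Ring.choose β q • A (l + m - i + p) (n + i + q) := fun p =>
      fs_range fun q hq => by rw [ha p q i (by tauto), smul_zero]
    simp only [this]
    rw [fs_range (N := N)]
    · simp only [Finset.smul_sum]
      rw [Finset.sum_comm]
      simp only [smul_smul, mul_comm]
    · intro p hp
      rw [Finset.sum_eq_zero, smul_zero]
      intro q _
      rw [ha p q i (by tauto), smul_zero]
  have e2 : ∀ i : ℕ, ∑ᶠ q : ℕ, Ring.choose β q • ∑ᶠ p : ℕ, Ring.choose α p •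
        B (l + n - i + q) (m + i + p) = ∑ q ∈ Finset.range N, Ring.choose β q •
          ∑ p ∈ Finset.range N, Ring.choose α p • B (l + n - i + q) (m + i + p) := by
    intro i
    have : ∀ q : ℕ, ∑ᶠ p : ℕ, Ring.choose α p • B (l + n - i + q) (m + i + p) =
        ∑ p ∈ Finset.range N, Ring.choose α p • B (l + n - i + q) (m + i + p) := fun q =>
      fs_range fun p hp => by rw [hb p q i (by tauto), smul_zero]
    simp only [this]
    rw [fs_range (N := N)]
    intro q hq
    rw [Finset.sum_eq_zero, smul_zero]
    intro p _
    rw [hb p q i (by tauto), smul_zero]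
  simp only [e1, e2]
  rw [fs_range (N := N)]
  swap
  · intro i hi
    rw [Finset.sum_eq_zero, Finset.sum_eq_zero, smul_zero, sub_zero, smul_zero]
    · intro q _
      rw [Finset.sum_eq_zero, smul_zero]
      intro p _
      rw [hb p q i (by tauto), smul_zero]
    · intro q _
      rw [Finset.sum_eq_zero, smul_zero]
      intro p _
      rw [ha p q i (by tauto), smul_zero]
  have e3 : ∀ p q : ℕ, ∑ᶠ s : ℕ, Ring.choose ((m + p : ℤ) : ℂ) s • C (m + n + p + q - s) (l + s) =
      ∑ i ∈ Finset.range N, ((-1 : ℂ) ^ i * Ring.choose (l : ℂ) i) •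
      (A (l + m - i + p) (n + i + q) - (-1 : ℂ) ^ l • B (l + n - i + q) (m + i + p)) := by
    intro p q
    have := h l (m + p) (n + q)
    rw [← fs_range (N := N) (f := fun i : ℕ => ((-1 : ℂ) ^ i * Ring.choose (l : ℂ) i) •
      (A (l + m - i + p) (n + i + q) - (-1 : ℂ) ^ l • B (l + n - i + q) (m + i + p)))]
    · have r1 : ∀ s : ℕ, (m + n + p + q - s : ℤ) = m + p + (n + q) - s := fun s => by ring
      have r2 : ∀ i : ℕ, (l + m - i + p : ℤ) = l + (m + p) - i := fun s => by ring
      have r3 : ∀ i : ℕ, (n + i + q : ℤ) = n + q + i := fun s => by ring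
      have r4 : ∀ i : ℕ, (l + n - i + q : ℤ) = l + (n + q) - i := fun s => by ring
      have r5 : ∀ i : ℕ, (m + i + p : ℤ) = m + p + i := fun s => by ring
      simp only [r1, r2, r3, r4, r5]
      exact this
    · intro i hi
      rw [ha p q i (by tauto), hb p q i (by tauto), smul_zero, sub_zero, smul_zero]
  have e4 : ∀ p q : ℕ, N ≤ p ∨ N ≤ q →
      ∑ᶠ s : ℕ, Ring.choose ((m + p : ℤ) : ℂ) s • C (m + n + p + q - s) (l + s) = 0 := by
    intro p q hpq
    rw [finsum_eq_zero_of_forall_eq_zero]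
    intro s
    rw [hc p q s (by tauto), smul_zero]
  have e5 : ∀ q : ℕ, ∑ᶠ p : ℕ, Ring.choose α p •
      ∑ᶠ s : ℕ, Ring.choose ((m + p : ℤ) : ℂ) s • C (m + n + p + q - s) (l + s) =
      ∑ p ∈ Finset.range N, Ring.choose α p •
      ∑ᶠ s : ℕ, Ring.choose ((m + p : ℤ) : ℂ) s • C (m + n + p + q - s) (l + s) := fun q =>
    fs_range fun p hp => by rw [e4 p q (by tauto), smul_zero]
  simp only [e5]
  rw [fs_range (N := N)]
  swap
  · intro q hq
    rw [Finset.sum_eq_zero, smul_zero]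
    intro p _
    rw [e4 p q (by tauto), smul_zero]
  simp only [e3, Finset.smul_sum, ← Finset.sum_sub_distrib, smul_sub]
  rw [Finset.sum_comm]
  apply Finset.sum_congr rfl
  intro q _
  rw [Finset.sum_comm]
  apply Finset.sum_congr rfl
  intro p _
  apply Finset.sum_congr rfl
  intro i _
  simp only [smul_smul]
  congr 2 <;> ring

/-- The Borcherds identity multiplied by `(1 + z₁)^α (1 + z₂)^β` and summed. -/
lemma borcherds_res {A B C : ℤ → ℤ → X} (hA : Trunc A) (hB : Trunc B) (hC : Trunc C)
    (h : Borcherds A B C) (α β : ℂ) (l m n : ℤ) :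
    ∑ᶠ j : ℕ, Ring.choose (m : ℂ) j • ∑ᶠ s : ℕ, Ring.choose α s •
      ∑ᶠ k : ℕ, Ring.choose (α + β - s) k • C (m + n - j + k) (l + s + j) =
    ∑ᶠ i : ℕ, ((-1 : ℂ) ^ i * Ring.choose (l : ℂ) i) •
      ((∑ᶠ p : ℕ, Ring.choose α p • ∑ᶠ q : ℕ, Ring.choose β q • A (l + m - i + p) (n + i + q)) -
      (-1 : ℂ) ^ l • (∑ᶠ q : ℕ, Ring.choose β q • ∑ᶠ p : ℕ, Ring.choose α p •
        B (l + n - i + q) (m + i + p))) := by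
  rw [borcherds_rhs hA hB hC h]
  obtain ⟨N3, hN3⟩ := hC l
  obtain ⟨N, hN⟩ : ∃ N : ℕ, N = (N3.natAbs + l.natAbs + m.natAbs + n.natAbs) * 3 := ⟨_, rfl⟩
  have hc : ∀ j s t q : ℕ, N ≤ j ∨ N ≤ s ∨ N ≤ t ∨ N ≤ q →
      C (m + n - j + (t + q : ℕ)) (l + s + j) = 0 := by
    intro j s t q hh
    apply hN3 _ _ (by omega)
    by_contra hc
    push Not at hc
    omega
  -- the left-hand side
  have e1 : ∀ j s : ℕ, ∑ᶠ k : ℕ, Ring.choose (α + β - s) k • C (m + n - j + k) (l + s + j) =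
      ∑ᶠ t : ℕ, ∑ᶠ q : ℕ, (Ring.choose (α - s) t * Ring.choose β q) •
        C (m + n - j + (t + q : ℕ)) (l + s + j) := by
    intro j s
    have := fs_vandermonde (α - s) β (f := fun k : ℕ => C (m + n - j + k) (l + s + j)) (N := N)
      (fun k hk => by simpa using hc j s k 0 (by tauto))
    rw [← this]
    simp only [sub_add_eq_add_sub]
  have e2 : ∀ j s : ℕ, ∑ᶠ t : ℕ, ∑ᶠ q : ℕ, (Ring.choose (α - s) t * Ring.choose β q) •
        C (m + n - j + (t + q : ℕ)) (l + s + j) =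
      ∑ t ∈ Finset.range N, ∑ q ∈ Finset.range N, (Ring.choose (α - s) t * Ring.choose β q) •
        C (m + n - j + (t + q : ℕ)) (l + s + j) := by
    intro j s
    apply fs_range₂
    intro t q htq
    rw [hc j s t q (by tauto), smul_zero]
  have e3 : ∀ j : ℕ, ∑ᶠ s : ℕ, Ring.choose α s •
      ∑ t ∈ Finset.range N, ∑ q ∈ Finset.range N, (Ring.choose (α - s) t * Ring.choose β q) •
        C (m + n - j + (t + q : ℕ)) (l + s + j) = ∑ s ∈ Finset.range N, Ring.choose α s •
      ∑ t ∈ Finset.range N, ∑ q ∈ Finset.range N, (Ring.choose (α - s) t * Ring.choose β q) •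
        C (m + n - j + (t + q : ℕ)) (l + s + j) := by
    intro j
    apply fs_range
    intro s hs
    rw [Finset.sum_eq_zero, smul_zero]
    intro t _
    apply Finset.sum_eq_zero
    intro q _
    rw [hc j s t q (by tauto), smul_zero]
  simp only [e1, e2, e3]
  rw [fs_range (N := N)]
  swap
  · intro j hj
    rw [Finset.sum_eq_zero, smul_zero]
    intro s _
    rw [Finset.sum_eq_zero, smul_zero]
    intro t _
    apply Finset.sum_eq_zero
    intro q _
    rw [hc j s t q (by tauto), smul_zero]
  -- the right-hand side
  have d1 : ∀ p q : ℕ, ∑ᶠ s : ℕ, Ring.choose ((m + p : ℤ) : ℂ) s • C (m + n + p + q - s) (l + s) =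
      ∑ j ∈ Finset.range N, Ring.choose (m : ℂ) j •
        ∑ x ∈ Finset.HasAntidiagonal.antidiagonal p, ((p.choose x.1 : ℕ) : ℂ) •
          C (m + n - j + (x.2 + q : ℕ)) (l + x.1 + j) := by
    intro p q
    obtain ⟨N', hN'⟩ : ∃ N' : ℕ, N' = N + p + q + 1 := ⟨_, rfl⟩
    have hz : ∀ s : ℕ, N' ≤ s → C (m + n + p + q - s) (l + s) = 0 := by
      intro s hs
      apply hN3 _ _ (by omega)
      by_contra hc
      push Not at hc
      omega
    have := fs_vandermonde (m : ℂ) (p : ℂ) (f := fun s : ℕ => C (m + n + p + q - s) (l + s))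
      (N := N') hz
    push_cast
    rw [this, fs_range₂ (N := N')]
    swap
    · intro j x hjx
      rw [hz _ (by omega), smul_zero]
    rw [← Finset.sum_subset (s₁ := Finset.range N) (s₂ := Finset.range N')]
    · apply Finset.sum_congr rfl
      intro j _
      rw [Finset.Nat.sum_antidiagonal_eq_sum_range_succ_mk]
      rw [Finset.smul_sum]
      rw [← Finset.sum_subset (s₁ := Finset.range p.succ) (s₂ := Finset.range N')]
      · apply Finset.sum_congr rfl
        intro x hx
        rw [smul_smul, Ring.choose_natCast]
        congr 2
        · have : x ≤ p := by simpa [Nat.lt_succ_iff] using hx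
          push_cast [this]
          ring
        · push_cast; ring
      · intro x; simp only [Finset.mem_range]; omega
      · intro x _ hx
        rw [Ring.choose_natCast, Nat.choose_eq_zero_of_lt (by simpa using hx)]
        simp
    · intro x; simp only [Finset.mem_range]; omega
    · intro j _ hj
      apply Finset.sum_eq_zero
      intro x _
      by_cases hx : x ≤ p
      · have := hc j x (p - x) q (by simp at hj; tauto)
        have r : (m + n + p + q - (j + x : ℕ) : ℤ) = m + n - j + (p - x + q : ℕ) := by
          push_cast [hx]; ring
        have r' : (l + (j + x : ℕ) : ℤ) = l + x + j := by push_cast; ring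
        rw [r, r', this, smul_zero]
      · rw [Ring.choose_natCast, Nat.choose_eq_zero_of_lt (by omega)]
        simp
  simp only [d1]
  have d2 : ∀ q : ℕ, ∑ᶠ p : ℕ, Ring.choose α p • ∑ j ∈ Finset.range N, Ring.choose (m : ℂ) j •
        ∑ x ∈ Finset.HasAntidiagonal.antidiagonal p, ((p.choose x.1 : ℕ) : ℂ) •
          C (m + n - j + (x.2 + q : ℕ)) (l + x.1 + j) =
      ∑ j ∈ Finset.range N, Ring.choose (m : ℂ) j • ∑ s ∈ Finset.range N, ∑ t ∈ Finset.range N,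
        (Ring.choose α s * Ring.choose (α - s) t) •
          C (m + n - j + (t + q : ℕ)) (l + s + j) := by
    intro q
    have hz : ∀ j p : ℕ, 2 * N ≤ p → ∑ x ∈ Finset.HasAntidiagonal.antidiagonal p, ((p.choose x.1 : ℕ) : ℂ) •
          C (m + n - j + (x.2 + q : ℕ)) (l + x.1 + j) = 0 := by
      intro j p hp
      apply Finset.sum_eq_zero
      rintro ⟨s, t⟩ hst
      simp only [Finset.HasAntidiagonal.mem_antidiagonal] at hst
      rw [hc j s t q (by omega), smul_zero]
    rw [fs_range (N := 2 * N)]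
    swap
    · intro p hp
      rw [Finset.sum_eq_zero, smul_zero]
      intro j _
      rw [hz j p hp, smul_zero]
    simp only [Finset.smul_sum (s := Finset.range N)]
    rw [Finset.sum_comm]
    apply Finset.sum_congr rfl
    intro j _
    simp only [smul_comm (Ring.choose α _) (Ring.choose (m : ℂ) j), ← Finset.smul_sum]
    congr 1
    have := fs_trinomial α (G := fun s t => C (m + n - j + (t + q : ℕ)) (l + s + j)) (N := N)
      (fun s t hst => hc j s t q (by tauto))
    rw [fs_range (N := 2 * N), fs_range₂ (N := N)] at this
    · rw [this]
    · intro s t hst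
      rw [hc j s t q (by tauto), smul_zero]
    · intro p hp
      rw [hz j p hp, smul_zero]
  simp only [d2]
  rw [fs_range (N := N)]
  swap
  · intro q hq
    rw [Finset.sum_eq_zero, smul_zero]
    intro j _
    rw [Finset.sum_eq_zero, smul_zero]
    intro s _
    apply Finset.sum_eq_zero
    intro t _
    rw [hc j s t q (by tauto), smul_zero]
  simp only [Finset.smul_sum]
  rw [Finset.sum_comm (s := Finset.range N) (t := Finset.range N)
    (f := fun q j => ∑ s ∈ Finset.range N, ∑ t ∈ Finset.range N, Ring.choose β q •
      Ring.choose (m : ℂ) j • (Ring.choose α s * Ring.choose (α - s) t) •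
        C (m + n - j + (t + q : ℕ)) (l + s + j))]
  apply Finset.sum_congr rfl
  intro j _
  rw [Finset.sum_comm (s := Finset.range N) (t := Finset.range N)
    (f := fun q s => ∑ t ∈ Finset.range N, Ring.choose β q •
      Ring.choose (m : ℂ) j • (Ring.choose α s * Ring.choose (α - s) t) •
        C (m + n - j + (t + q : ℕ)) (l + s + j))]
  apply Finset.sum_congr rfl
  intro s _
  rw [Finset.sum_comm]
  apply Finset.sum_congr rfl
  intro q _
  apply Finset.sum_congr rfl
  intro t _
  simp only [smul_smul]
  congr 1
  ring

end Sums

/-! ### Vertex operator algebras -/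

/-- A vertex operator algebra `(V, Y, 𝟏, ω)` over `ℂ`.  The modes `u_n` of `Y(u,z) = ∑ u_n z^{-n-1}`
are `VertexOperator.ncoeff (Y u) n`; the truncation property `u_n v = 0` for `n ≫ 0` is part of
Mathlib's `VertexOperator`.  The Jacobi identity is stated by equating the coefficients of
`z₀^{-l-1} z₁^{-m-1} z₂^{-n-1}` (all sums are finite by truncation). -/
class VertexOperatorAlgebra (V : Type u) [AddCommGroup V] [Module ℂ V] where
  /-- the state-field correspondence -/
  Y : V →ₗ[ℂ] VertexOperator ℂ V
  /-- the vacuum -/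
  vac : V
  /-- the Virasoro vector -/
  omega : V
  /-- the central charge -/
  rank : ℂ
  vac_mode : ∀ (n : ℤ) (v : V), VertexOperator.ncoeff (Y vac) n v = if n = -1 then v else 0
  creation : ∀ v : V, VertexOperator.ncoeff (Y v) (-1) vac = v
  creation_nonneg : ∀ (v : V) (n : ℤ), 0 ≤ n → VertexOperator.ncoeff (Y v) n vac = 0
  jacobi : ∀ (u v w : V) (l m n : ℤ),
    ∑ᶠ i : ℕ, Ring.choose (m : ℂ) i • VertexOperator.ncoeff
        (Y (VertexOperator.ncoeff (Y u) (l + i) v)) (m + n - i) w =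
    ∑ᶠ i : ℕ, ((-1 : ℂ) ^ i * Ring.choose (l : ℂ) i) •
      (VertexOperator.ncoeff (Y u) (l + m - i) (VertexOperator.ncoeff (Y v) (n + i) w) -
        (-1 : ℂ) ^ l •
          VertexOperator.ncoeff (Y v) (l + n - i) (VertexOperator.ncoeff (Y u) (m + i) w))
  /-- the Virasoro relations for `L(n) = ω_{n+1}` -/
  virasoro : ∀ (m n : ℤ) (v : V),
    VertexOperator.ncoeff (Y omega) (m + 1) (VertexOperator.ncoeff (Y omega) (n + 1) v) -
      VertexOperator.ncoeff (Y omega) (n + 1) (VertexOperator.ncoeff (Y omega) (m + 1) v) =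
    ((m : ℂ) - n) • VertexOperator.ncoeff (Y omega) (m + n + 1) v +
      (if m + n = 0 then ((m : ℂ) ^ 3 - m) / 12 * rank else 0) • v
  /-- the `L(-1)`-derivative property `Y(L(-1)v, z) = d/dz Y(v,z)` -/
  derivative : ∀ (v : V) (n : ℤ), VertexOperator.ncoeff (Y (VertexOperator.ncoeff (Y omega) 0 v)) n =
    (-n : ℂ) • VertexOperator.ncoeff (Y v) (n - 1)
  /-- `V` is the direct sum of the eigenspaces `V_n`, `n ∈ ℤ`, of `L(0)` -/
  grading : DirectSum.IsInternal
    (fun n : ℤ => Module.End.eigenspace (VertexOperator.ncoeff (Y omega) 1) (n : ℂ))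
  finite_dim : ∀ n : ℤ, FiniteDimensional ℂ
    (Module.End.eigenspace (VertexOperator.ncoeff (Y omega) 1) (n : ℂ))
  bounded_below : ∃ N : ℤ, ∀ n : ℤ, n < N →
    Module.End.eigenspace (VertexOperator.ncoeff (Y omega) 1) (n : ℂ) = ⊥

section VOA

open VertexOperatorAlgebra

variable {V : Type u} [AddCommGroup V] [Module ℂ V] [VertexOperatorAlgebra V]

/-- The mode `u_n` of `Y(u,z) = ∑ u_n z^{-n-1}`. -/
def md (u : V) (n : ℤ) : Module.End ℂ V := VertexOperator.ncoeff (Y u) n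

variable (V) in
/-- The homogeneous space `V_k` of vectors of weight `k`. -/
def wt (k : ℤ) : Submodule ℂ V := Module.End.eigenspace (md (omega : V) 1) (k : ℂ)

lemma md_add (u v : V) (n : ℤ) : md (u + v) n = md u n + md v n := by simp [md]

lemma md_smul (c : ℂ) (u : V) (n : ℤ) : md (c • u) n = c • md u n := by simp [md]

lemma md_zero (n : ℤ) : md (0 : V) n = 0 := by simp [md]

lemma md_sum {ι : Type*} (s : Finset ι) (f : ι → V) (n : ℤ) :
    md (∑ i ∈ s, f i) n = ∑ i ∈ s, md (f i) n := by
  simp [md]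

lemma md_trunc (u v : V) : ∃ N : ℤ, ∀ n, N ≤ n → md u n v = 0 := by
  refine ⟨-HahnSeries.order ((HahnModule.of ℂ).symm (Y u v)), fun n hn => ?_⟩
  apply VertexOperator.ncoeff_eq_zero_of_lt_order
  omega

lemma md_jacobi (u v w : V) (l m n : ℤ) :
    ∑ᶠ i : ℕ, Ring.choose (m : ℂ) i • md (md u (l + i) v) (m + n - i) w =
    ∑ᶠ i : ℕ, ((-1 : ℂ) ^ i * Ring.choose (l : ℂ) i) •
      (md u (l + m - i) (md v (n + i) w) - (-1 : ℂ) ^ l • md v (l + n - i) (md u (m + i) w)) :=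
  jacobi u v w l m n

lemma trunc_mul (a b w : V) : Trunc (fun i j => md a i (md b j w)) := by
  apply trunc_of
  · obtain ⟨N, hN⟩ := md_trunc b w
    exact ⟨N, fun i j hj => by simp [hN j hj]⟩
  · intro j
    exact md_trunc a _

lemma trunc_iter (a b w : V) : Trunc (fun k s => md (md a s b) k w) := by
  apply trunc_of
  · obtain ⟨N, hN⟩ := md_trunc a b
    exact ⟨N, fun i j hj => by simp [hN j hj, md_zero]⟩
  · intro j
    exact md_trunc _ _

lemma borcherds_md (a b w : V) : Borcherds (fun i j => md a i (md b j w))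
    (fun j i => md b j (md a i w)) (fun k s => md (md a s b) k w) :=
  fun l m n => md_jacobi a b w l m n

/-- The commutator formula `[u_m, v_n] = ∑ᵢ C(m,i) (u_i v)_{m+n-i}`. -/
lemma md_comm (u v w : V) (m n : ℤ) : md u m (md v n w) - md v n (md u m w) =
    ∑ᶠ i : ℕ, Ring.choose (m : ℂ) i • md (md u i v) (m + n - i) w := by
  have := md_jacobi u v w 0 m n
  simp only [zero_add] at this
  rw [this, fs_range (N := 1)]
  · simp
  · intro i hi
    obtain ⟨j, rfl⟩ : ∃ j, i = j + 1 := ⟨i - 1, by omega⟩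
    simp [Ring.choose_zero_succ]

lemma mem_wt {k : ℤ} {v : V} : v ∈ wt V k ↔ md (omega : V) 1 v = (k : ℂ) • v :=
  Module.End.mem_eigenspace_iff

lemma md_deriv (v : V) (n : ℤ) : md (md (omega : V) 0 v) n = (-n : ℂ) • md v (n - 1) :=
  derivative v n

lemma md_wt {j k : ℤ} {u v : V} (hu : u ∈ wt V j) (hv : v ∈ wt V k) (n : ℤ) :
    md u n v ∈ wt V (j + k - n - 1) := by
  rw [mem_wt] at *
  have := md_comm (omega : V) u v 1 n
  rw [fs_range (N := 2)] at this
  · simp only [Finset.sum_range_succ, Finset.range_zero, Finset.sum_empty, zero_add] at this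
    simp only [Ring.choose_zero_right, Ring.choose_one_right, Nat.cast_zero, Nat.cast_one,
      Int.cast_one, md_deriv, hu, hv, map_smul, md_smul] at this
    rw [sub_eq_iff_eq_add] at this
    rw [this]
    simp only [one_smul, LinearMap.smul_apply, show (1 : ℤ) + n - 0 - 1 = n by ring,
      show (1 : ℤ) + n - 1 = n by ring]
    push_cast
    module
  · intro i hi
    have h0 : Ring.choose ((1 : ℤ) : ℂ) i = 0 := by
      have := Ring.choose_natCast (R := ℂ) 1 i
      rw [Nat.choose_eq_zero_of_lt (by omega)] at this
      simpa using this
    rw [h0, zero_smul]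

/-- `Res_z (1+z)^α z^k Y(u,z) v = ∑ⱼ C(α,j) u_{k+j} v`, bilinear in `u` and `v`. -/
def resMode (α : ℂ) (k : ℤ) : V →ₗ[ℂ] V →ₗ[ℂ] V :=
  LinearMap.mk₂ ℂ (fun u v => ∑ᶠ j : ℕ, Ring.choose α j • md u (k + j) v)
    (by
      intro u u' v
      obtain ⟨N, hN⟩ := md_trunc u v
      obtain ⟨N', hN'⟩ := md_trunc u' v
      rw [fs_range (N := (max N N' - k).toNat), fs_range (N := (max N N' - k).toNat),
        fs_range (N := (max N N' - k).toNat), ← Finset.sum_add_distrib]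
      · apply Finset.sum_congr rfl
        intro i _
        simp [md_add]
      · intro i hi; rw [hN' _ (by omega), smul_zero]
      · intro i hi; rw [hN _ (by omega), smul_zero]
      · intro i hi; simp [md_add, hN _ (show N ≤ k + i by omega), hN' _ (show N' ≤ k + i by omega)])
    (by
      intro c u v
      rw [smul_finsum]
      apply finsum_congr
      intro j
      simp only [md_smul, LinearMap.smul_apply]
      rw [smul_comm])
    (by
      intro u v v'
      obtain ⟨N, hN⟩ := md_trunc u v
      obtain ⟨N', hN'⟩ := md_trunc u v'
      rw [fs_range (N := (max N N' - k).toNat), fs_range (N := (max N N' - k).toNat),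
        fs_range (N := (max N N' - k).toNat), ← Finset.sum_add_distrib]
      · apply Finset.sum_congr rfl
        intro i _
        simp
      · intro i hi; rw [hN' _ (by omega), smul_zero]
      · intro i hi; rw [hN _ (by omega), smul_zero]
      · intro i hi; simp [hN _ (show N ≤ k + i by omega), hN' _ (show N' ≤ k + i by omega)])
    (by
      intro c u v
      rw [smul_finsum]
      apply finsum_congr
      intro j
      simp only [map_smul]
      rw [smul_comm])

lemma resMode_apply (α : ℂ) (k : ℤ) (u v : V) :
    resMode α k u v = ∑ᶠ j : ℕ, Ring.choose α j • md u (k + j) v := rfl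

lemma resMode_range {u v : V} {N : ℤ} (hN : ∀ n, N ≤ n → md u n v = 0) (α : ℂ) (k : ℤ) {M : ℕ}
    (hM : N ≤ k + M) :
    resMode α k u v = ∑ j ∈ Finset.range M, Ring.choose α j • md u (k + j) v :=
  fs_range fun i hi => by rw [hN _ (by omega), smul_zero]

lemma resMode_trunc (α : ℂ) (u v : V) : ∃ N : ℤ, ∀ k, N ≤ k → resMode α k u v = 0 := by
  obtain ⟨N, hN⟩ := md_trunc u v
  exact ⟨N, fun k hk => by rw [resMode_range hN α k (M := 0) (by simpa using hk)]; simp⟩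

lemma resMode_resMode (α β : ℂ) (k n : ℤ) (a b w : V) : resMode α k a (resMode β n b w) =
    ∑ᶠ p : ℕ, Ring.choose α p • ∑ᶠ q : ℕ, Ring.choose β q • md a (k + p) (md b (n + q) w) := by
  rw [resMode_apply]
  apply finsum_congr
  intro p
  obtain ⟨N, hN⟩ := md_trunc b w
  rw [resMode_range hN β n (M := (N - n).toNat) (by omega), map_sum,
    fs_range (N := (N - n).toNat)]
  · simp
  · intro i hi
    rw [hN _ (by omega), map_zero, smul_zero]

/-- The Jacobi identity after taking residues against `(1+z₁)^α (1+z₂)^β z₀^l z₁^m z₂^n`. -/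
lemma res_identity (α β : ℂ) (l m n : ℤ) (a b w : V) :
    ∑ᶠ j : ℕ, Ring.choose (m : ℂ) j • ∑ᶠ s : ℕ, Ring.choose α s •
      resMode (α + β - s) (m + n - j) (md a (l + s + j) b) w =
    ∑ᶠ i : ℕ, ((-1 : ℂ) ^ i * Ring.choose (l : ℂ) i) •
      (resMode α (l + m - i) a (resMode β (n + i) b w) -
        (-1 : ℂ) ^ l • resMode β (l + n - i) b (resMode α (m + i) a w)) := by
  have := borcherds_res (trunc_mul a b w) (trunc_mul b a w) (trunc_iter a b w)
    (borcherds_md a b w) α β l m n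
  simp only [resMode_resMode]
  exact this

lemma wt_internal : DirectSum.IsInternal (fun n : ℤ => wt V n) := VertexOperatorAlgebra.grading

lemma wt_bijective : Function.Bijective (DirectSum.coeLinearMap fun n : ℤ => wt V n) :=
  wt_internal

/-- The linear map on `V = ⨁ V_k` that agrees with `f k` on `V_k`. -/
def homExt {X : Type*} [AddCommGroup X] [Module ℂ X] (f : ℤ → V →ₗ[ℂ] X) : V →ₗ[ℂ] X :=
  (DirectSum.toModule ℂ ℤ X fun k => (f k).comp (wt V k).subtype).comp
    (LinearEquiv.ofBijective (DirectSum.coeLinearMap fun k => wt V k) wt_bijective).symm.toLinearMap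

lemma homExt_apply {X : Type*} [AddCommGroup X] [Module ℂ X] (f : ℤ → V →ₗ[ℂ] X) {k : ℤ} {v : V}
    (hv : v ∈ wt V k) : homExt f v = f k v := by
  have : (LinearEquiv.ofBijective (DirectSum.coeLinearMap fun k => wt V k) wt_bijective).symm v =
      DirectSum.lof ℂ ℤ (fun k => wt V k) k ⟨v, hv⟩ := by
    rw [LinearEquiv.symm_apply_eq, LinearEquiv.ofBijective_apply, DirectSum.coeLinearMap_lof]
  simp only [homExt, LinearMap.comp_apply, LinearEquiv.coe_coe, this, DirectSum.toModule_lof,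
    Submodule.subtype_apply]

end VOA

/-! ### Automorphisms of finite order and their eigenspaces -/

section Aut

open VertexOperatorAlgebra

/-- An automorphism of finite order of the vertex operator algebra `V`. -/
structure FiniteOrderAut (V : Type u) [AddCommGroup V] [Module ℂ V]
    [VertexOperatorAlgebra V] where
  toEquiv : V ≃ₗ[ℂ] V
  map_vac : toEquiv vac = vac
  map_omega : toEquiv omega = omega
  map_mode : ∀ (u v : V) (n : ℤ), toEquiv (md u n v) = md (toEquiv u) n (toEquiv v)
  finite_order : IsOfFinOrder toEquiv

variable {V : Type u} [AddCommGroup V] [Module ℂ V] [VertexOperatorAlgebra V]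

namespace FiniteOrderAut

variable (g : FiniteOrderAut V)

/-- The order of `g`. -/
def T : ℕ := orderOf g.toEquiv

/-- `e^{2πiq}` -/
def ex (q : ℚ) : ℂ := Complex.exp (2 * Real.pi * Complex.I * (q : ℂ))

/-- The eigenspace `{v | g v = e^{2πiq} v}`, `q ∈ ℚ`.  It only depends on `q` modulo `ℤ`, it is `0`
unless `q ∈ (1/T)ℤ`, and for `q = r/T` it is the eigenspace `V^r`. -/
def eig (q : ℚ) : Submodule ℂ V :=
  Module.End.eigenspace (g.toEquiv : V →ₗ[ℂ] V) (ex q)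

/-- The projection of `V` onto `g.eig q` along the other eigenspaces of `g`
(it is `0` if `q ∉ (1/T)ℤ`, since then `g.eig q = 0`). -/
def eigProj (q : ℚ) : V →ₗ[ℂ] V :=
  open Classical in
  if ∃ k : ℤ, q * g.T = k then
    (g.T : ℂ)⁻¹ • ∑ j ∈ Finset.range g.T, ex (-(q * j)) • (g.toEquiv : V →ₗ[ℂ] V) ^ j
  else 0

lemma T_pos : 0 < g.T := orderOf_pos_iff.2 g.finite_order

lemma T_ne : (g.T : ℂ) ≠ 0 := by exact_mod_cast g.T_pos.ne'

lemma T_neQ : (g.T : ℚ) ≠ 0 := by exact_mod_cast g.T_pos.ne'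

lemma ex_add (p q : ℚ) : ex (p + q) = ex p * ex q := by
  rw [ex, ex, ex, ← Complex.exp_add]; push_cast; ring_nf

lemma ex_zero : ex 0 = 1 := by simp [ex]

lemma ex_eq_one_iff (q : ℚ) : ex q = 1 ↔ ∃ k : ℤ, q = k := by
  rw [ex, Complex.exp_eq_one_iff]
  have h : (2 * Real.pi * Complex.I : ℂ) ≠ 0 := Complex.two_pi_I_ne_zero
  constructor
  · rintro ⟨k, hk⟩
    refine ⟨k, ?_⟩
    rw [mul_comm (k : ℂ)] at hk
    exact_mod_cast mul_left_cancel₀ h hk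
  · rintro ⟨k, rfl⟩
    exact ⟨k, by push_cast; ring⟩

lemma ex_int (k : ℤ) : ex (k : ℚ) = 1 := (ex_eq_one_iff _).2 ⟨k, rfl⟩

lemma ex_ne (q : ℚ) : ex q ≠ 0 := Complex.exp_ne_zero _

lemma ex_eq_iff (p q : ℚ) : ex p = ex q ↔ ∃ k : ℤ, p = q + k := by
  have : ex p = ex (p - q) * ex q := by rw [← ex_add]; ring_nf
  rw [this, mul_eq_right₀ (ex_ne q), ex_eq_one_iff]
  constructor
  · rintro ⟨k, hk⟩; exact ⟨k, by linarith⟩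
  · rintro ⟨k, hk⟩; exact ⟨k, by linarith⟩

lemma ex_mul_nat (q : ℚ) (n : ℕ) : ex (q * n) = ex q ^ n := by
  rw [ex, ex, ← Complex.exp_nat_mul]; push_cast; ring_nf

lemma mem_eig {q : ℚ} {v : V} : v ∈ g.eig q ↔ g.toEquiv v = ex q • v :=
  Module.End.mem_eigenspace_iff

lemma eig_add_int (q : ℚ) (k : ℤ) : g.eig (q + k) = g.eig q := by
  rw [eig, eig, ex_add, ex_int, mul_one]

lemma pow_T_apply (v : V) : ((g.toEquiv : V →ₗ[ℂ] V) ^ g.T) v = v := by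
  have h : g.toEquiv ^ g.T = 1 := pow_orderOf_eq_one _
  have h2 : ∀ n : ℕ, ((g.toEquiv : V →ₗ[ℂ] V) ^ n) v = (g.toEquiv ^ n) v := by
    intro n
    induction n with
    | zero => simp
    | succ n ih => rw [pow_succ', pow_succ']; simp [ih]
  rw [h2, h]; rfl

lemma pow_apply_eig {q : ℚ} {v : V} (hv : v ∈ g.eig q) (j : ℕ) :
    ((g.toEquiv : V →ₗ[ℂ] V) ^ j) v = ex (q * j) • v := by
  rw [ex_mul_nat]
  induction j with
  | zero => simp
  | succ n ih =>
    rw [pow_succ', Module.End.mul_apply, ih, map_smul]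
    rw [mem_eig] at hv
    simp [hv, smul_smul, pow_succ]

lemma exists_int_of_mem {q : ℚ} {v : V} (hv : v ∈ g.eig q) (h0 : v ≠ 0) :
    ∃ k : ℤ, q * g.T = k := by
  have := g.pow_apply_eig hv g.T
  rw [pow_T_apply] at this
  rw [← ex_eq_one_iff]
  by_contra hc
  have h2 : (ex (q * g.T) - 1) • v = 0 := by rw [sub_smul, one_smul, ← this, sub_self]
  rcases smul_eq_zero.1 h2 with h3 | h3
  · exact hc (sub_eq_zero.1 h3)
  · exact h0 h3

lemma g_eigProj (q : ℚ) (v : V) : g.toEquiv (g.eigProj q v) = g.eigProj q (g.toEquiv v) := by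
  rw [eigProj]
  split_ifs
  · simp only [LinearMap.smul_apply, map_smul, LinearMap.sum_apply, map_sum]
    congr 1
    apply Finset.sum_congr rfl
    intro j _
    congr 1
    have := LinearMap.congr_fun (pow_succ (g.toEquiv : V →ₗ[ℂ] V) j) v
    rw [pow_succ'] at this
    exact this
  · simp

lemma eigProj_mem (q : ℚ) (v : V) : g.eigProj q v ∈ g.eig q := by
  rw [eigProj]
  split_ifs with h
  · obtain ⟨k, hk⟩ := h
    rw [mem_eig]
    simp only [LinearMap.smul_apply, map_smul, LinearMap.sum_apply, map_sum]
    rw [smul_comm]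
    congr 1
    rw [Finset.smul_sum]
    let F : ℕ → V := fun j => ex (q - q * j) • ((g.toEquiv : V →ₗ[ℂ] V) ^ j) v
    have h1 : ∀ j : ℕ, ex (-(q * j)) • g.toEquiv (((g.toEquiv : V →ₗ[ℂ] V) ^ j) v) = F (j + 1) := by
      intro j
      simp only [F, pow_succ', Module.End.mul_apply]
      rw [show q - q * ((j + 1 : ℕ) : ℚ) = -(q * j) by push_cast; ring]
      rfl
    have h2 : ∀ j : ℕ, ex q • ex (-(q * j)) • ((g.toEquiv : V →ₗ[ℂ] V) ^ j) v = F j := by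
      intro j
      simp only [F, smul_smul, ← ex_add, sub_eq_add_neg]
    have h3 : F g.T = F 0 := by
      simp only [F, pow_T_apply, hk]
      have : ex (q - k) = ex (q - q * (0 : ℕ)) := by
        rw [ex_eq_iff]; exact ⟨-k, by push_cast; ring⟩
      rw [this]; simp
    simp only [h1, h2]
    have h4 := Finset.sum_range_succ F g.T
    rw [Finset.sum_range_succ', h3] at h4
    exact add_right_cancel h4
  · simp

lemma eigProj_of_mem {q : ℚ} {v : V} (hv : v ∈ g.eig q) : g.eigProj q v = v := by
  by_cases h0 : v = 0
  · simp [h0]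
  · rw [eigProj, if_pos (g.exists_int_of_mem hv h0)]
    simp only [LinearMap.smul_apply, LinearMap.sum_apply, g.pow_apply_eig hv, smul_smul, ← ex_add]
    simp [ex_zero, ← Nat.cast_smul_eq_nsmul ℂ, smul_smul, g.T_ne]

lemma eq_zero_of_mem {p q : ℚ} {v : V} (hp : v ∈ g.eig p) (hq : v ∈ g.eig q)
    (h : ¬∃ k : ℤ, p = q + k) : v = 0 := by
  rw [mem_eig] at hp hq
  rw [hp] at hq
  have h2 : (ex p - ex q) • v = 0 := by rw [sub_smul, hq, sub_self]
  rcases smul_eq_zero.1 h2 with h3 | h3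
  · exact absurd ((ex_eq_iff _ _).1 (sub_eq_zero.1 h3)) h
  · exact h3

lemma eigProj_of_mem_ne {p q : ℚ} {v : V} (hv : v ∈ g.eig p) (h : ¬∃ k : ℤ, p = q + k) :
    g.eigProj q v = 0 := by
  refine g.eq_zero_of_mem (p := p) ?_ (g.eigProj_mem q v) h
  rw [mem_eig] at *
  rw [g_eigProj, hv, map_smul]

lemma sum_eigProj (v : V) : ∑ r ∈ Finset.range g.T, g.eigProj (r / g.T) v = v := by
  have hT := g.T_ne
  have hTQ := g.T_neQ
  have h1 : ∀ r : ℕ, g.eigProj (r / g.T) v = (g.T : ℂ)⁻¹ • ∑ j ∈ Finset.range g.T,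
      (ex (-(j / g.T))) ^ r • ((g.toEquiv : V →ₗ[ℂ] V) ^ j) v := by
    intro r
    rw [eigProj, if_pos ⟨r, by field_simp; simp⟩]
    simp only [LinearMap.smul_apply, LinearMap.sum_apply]
    congr 1
    apply Finset.sum_congr rfl
    intro j _
    congr 1
    rw [← ex_mul_nat]
    congr 1
    ring
  simp only [h1]
  rw [← Finset.smul_sum, Finset.sum_comm]
  simp only [← Finset.sum_smul]
  rw [Finset.sum_eq_single 0]
  · simp [ex_zero, ← Nat.cast_smul_eq_nsmul ℂ, smul_smul, hT]
  · intro j hj hj0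
    have hj' : j < g.T := by simpa using hj
    have hne : ex (-(j / g.T)) ≠ 1 := by
      rw [Ne, ex_eq_one_iff]
      rintro ⟨k, hk⟩
      have h2 : (-(j : ℚ)) = k * g.T := by field_simp at hk; linarith
      have h3 : (-(j : ℤ)) = k * g.T := by exact_mod_cast h2
      have h4 : (j : ℤ) ≤ 0 := by
        by_contra hc
        have : (g.T : ℤ) ∣ j := ⟨-k, by linarith⟩
        have := Int.le_of_dvd (by omega) this
        omega
      omega
    have hpow : ex (-(j / g.T)) ^ g.T = 1 := by
      rw [← ex_mul_nat, ex_eq_one_iff]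
      exact ⟨-j, by field_simp; simp⟩
    rw [geom_sum_eq hne, hpow]
    simp
  · intro h
    exact absurd (Finset.mem_range.2 g.T_pos) h

lemma g_wt {k : ℤ} {v : V} (hv : v ∈ wt V k) : g.toEquiv v ∈ wt V k := by
  rw [mem_wt] at *
  have := g.map_mode omega v 1
  rw [g.map_omega, hv, map_smul] at this
  exact this.symm

lemma eigProj_wt (q : ℚ) {k : ℤ} {v : V} (hv : v ∈ wt V k) : g.eigProj q v ∈ wt V k := by
  rw [eigProj]
  split_ifs
  · simp only [LinearMap.smul_apply, LinearMap.sum_apply]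
    refine Submodule.smul_mem _ _ (Submodule.sum_mem _ fun j _ => Submodule.smul_mem _ _ ?_)
    have h : ∀ j : ℕ, ((g.toEquiv : V →ₗ[ℂ] V) ^ j) v ∈ wt V k := by
      intro j
      induction j with
      | zero => simpa
      | succ n ih => rw [pow_succ']; exact g.g_wt ih
    exact h j
  · simp

lemma md_eig {p q : ℚ} {u v : V} (hu : u ∈ g.eig p) (hv : v ∈ g.eig q) (n : ℤ) :
    md u n v ∈ g.eig (p + q) := by
  rw [mem_eig] at *
  rw [g.map_mode, hu, hv, ex_add, md_smul, map_smul, LinearMap.smul_apply, smul_smul, mul_comm]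

/-- To check an additive statement on `V` it suffices to do so on homogeneous eigenvectors. -/
lemma hom_induction {P : V → Prop} (h0 : P 0) (hadd : ∀ u v, P u → P v → P (u + v))
    (h : ∀ (k : ℤ) (q : ℚ) (u : V), 0 ≤ q → q < 1 → u ∈ wt V k → u ∈ g.eig q → P u) (v : V) :
    P v := by
  have hsum : ∀ (s : Finset ℕ) (f : ℕ → V), (∀ i ∈ s, P (f i)) → P (∑ i ∈ s, f i) := fun s f hf =>
    Finset.sum_induction f P hadd h0 hf
  have h1 : ∀ (k : ℤ) (u : V), u ∈ wt V k → P u := by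
    intro k u hu
    rw [← g.sum_eigProj u]
    apply hsum
    intro r hr
    have hT : (0 : ℚ) < g.T := by exact_mod_cast g.T_pos
    refine h k (r / g.T) _ (by positivity) ?_ (g.eigProj_wt _ hu) (g.eigProj_mem _ _)
    rw [div_lt_one hT]
    exact_mod_cast Finset.mem_range.1 hr
  have htop : v ∈ ⨆ k : ℤ, wt V k := by
    rw [wt_internal.submodule_iSup_eq_top]; trivial
  induction htop using Submodule.iSup_induction' with
  | mem k x hx => exact h1 k x hx
  | zero => exact h0
  | add x y _ _ hx hy => exact hadd x y hx hy

/-! ### The associative algebra `A_g(V)` -/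

/-- `δ_r`, for `q = r/T`. -/
def del (q : ℚ) : ℤ := if q = 0 then 1 else 0

/-- `u ∘_g v = Res_z (1+z)^{wt u - 1 + δ_r + r/T} z^{-1-δ_r} Y(u,z) v` for `u ∈ V^r` of weight `k`,
where `q = r/T`. -/
def circ (k : ℤ) (q : ℚ) (u v : V) : V :=
  resMode ((k : ℂ) - 1 + del q + q) (-1 - del q) u v

/-- `O_g(V)`, the linear span of all `u ∘_g v` with `u ∈ V^r` homogeneous, `0 ≤ r < T` (`q = r/T`),
and `v ∈ V`. -/
def O : Submodule ℂ V :=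
  Submodule.span ℂ {x | ∃ (k : ℤ) (q : ℚ) (u v : V),
    0 ≤ q ∧ q < 1 ∧ u ∈ wt V k ∧ u ∈ g.eig q ∧ x = circ k q u v}

/-- The product `*_g` on `V`: `u *_g v = Res_z (1+z)^{wt u} z^{-1} Y(u,z) v` for homogeneous
`u ∈ V^0`, and `u *_g v = 0` for `u ∈ V^r`, `0 < r < T`. -/
def star : V →ₗ[ℂ] V →ₗ[ℂ] V :=
  (homExt fun k : ℤ => resMode (k : ℂ) (-1)).comp (g.eigProj 0)

variable {g}

lemma star_apply {k : ℤ} {u : V} (hk : u ∈ wt V k) (h0 : u ∈ g.eig 0) (v : V) :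
    g.star u v = resMode (k : ℂ) (-1) u v := by
  rw [star, LinearMap.comp_apply, g.eigProj_of_mem h0, homExt_apply _ hk]

lemma star_of_ne {q : ℚ} {u : V} (hu : u ∈ g.eig q) (hq : 0 < q) (hq1 : q < 1) : g.star u = 0 := by
  rw [star, LinearMap.comp_apply, g.eigProj_of_mem_ne hu, map_zero]
  rintro ⟨k, hk⟩
  rw [zero_add] at hk
  subst hk
  have : (0 : ℤ) < k := by exact_mod_cast hq
  have : k < (1 : ℤ) := by exact_mod_cast hq1
  omega

lemma resMode_succ (α : ℂ) (k : ℤ) (u v : V) :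
    resMode (α + 1) k u v = resMode α k u v + resMode α (k + 1) u v := by
  obtain ⟨N, hN⟩ := md_trunc u v
  obtain ⟨M, hM⟩ : ∃ M : ℕ, M = (N - k).toNat := ⟨_, rfl⟩
  rw [resMode_range hN (α + 1) k (M := M + 1) (by push_cast; omega),
    resMode_range hN α k (M := M + 1) (by push_cast; omega),
    resMode_range hN α (k + 1) (M := M) (by omega),
    Finset.sum_range_succ', Finset.sum_range_succ' (n := M)]
  simp only [Ring.choose_succ_succ, add_smul, Finset.sum_add_distrib, Ring.choose_zero_right]
  rw [add_comm (∑ x ∈ Finset.range M, Ring.choose α x • _), add_right_comm]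
  congr 1
  apply Finset.sum_congr rfl
  intro i _
  congr 3
  push_cast; ring

lemma succ_mul_choose (α : ℂ) (j : ℕ) :
    ((j : ℂ) + 1) * Ring.choose (α + 1) (j + 1) = (α + 1) * Ring.choose α j := by
  have := choose_mul (α + 1) 1 j
  rw [Ring.choose_one_right, add_comm 1 j, Nat.choose_one_right] at this
  push_cast at this
  rw [mul_comm, this]
  congr 2
  ring

/-- `Res_z (1+z)^{α+1} z^{-c} Y(L(-1)u, z)v`, by partial integration. -/
lemma resMode_deriv (α : ℂ) (c : ℤ) (u v : V) :
    resMode (α + 1) (-c) (md omega 0 u) v =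
      (c : ℂ) • resMode α (-c - 1) u v + ((c : ℂ) - α - 1) • resMode α (-c) u v := by
  obtain ⟨N, hN⟩ := md_trunc u v
  have hN' : ∀ n, N + 1 ≤ n → md (md (omega : V) 0 u) n v = 0 := by
    intro n hn
    rw [md_deriv, LinearMap.smul_apply, hN _ (by omega), smul_zero]
  obtain ⟨M, hM⟩ : ∃ M : ℕ, M = (N + 1 + c).toNat := ⟨_, rfl⟩
  have key : resMode (α + 1) (-c) (md omega 0 u) v =
      (c : ℂ) • resMode (α + 1) (-c - 1) u v - (α + 1) • resMode α (-c) u v := by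
    rw [resMode_range hN' (α + 1) (-c) (M := M + 1) (by push_cast; omega),
      resMode_range hN (α + 1) (-c - 1) (M := M + 1) (by push_cast; omega),
      resMode_range hN α (-c) (M := M) (by omega)]
    have h1 : ∀ j : ℕ, Ring.choose (α + 1) j • md (md (omega : V) 0 u) (-c + j) v =
        (c : ℂ) • Ring.choose (α + 1) j • md u (-c - 1 + j) v -
          ((j : ℂ) * Ring.choose (α + 1) j) • md u (-c - 1 + j) v := by
      intro j
      rw [md_deriv, LinearMap.smul_apply, show -c + (j : ℤ) - 1 = -c - 1 + j by ring]
      push_cast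
      module
    simp only [h1, Finset.sum_sub_distrib, ← Finset.smul_sum]
    congr 1
    rw [Finset.sum_range_succ', Finset.smul_sum]
    simp only [Nat.cast_zero, zero_mul, zero_smul, add_zero]
    apply Finset.sum_congr rfl
    intro j _
    push_cast
    rw [succ_mul_choose, mul_smul, show -c - 1 + ((j : ℤ) + 1) = -c + j by ring]
  rw [key, resMode_succ]
  rw [show -c - 1 + 1 = -c by ring]
  module

end FiniteOrderAut

end Aut

section Algebra

open VertexOperatorAlgebra

variable {V : Type u} [AddCommGroup V] [Module ℂ V] [VertexOperatorAlgebra V]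

namespace FiniteOrderAut

variable {g : FiniteOrderAut V}

lemma del_nonneg (q : ℚ) : 0 ≤ del q := by unfold del; split_ifs <;> simp

lemma omega_eig : (omega : V) ∈ g.eig 0 := by
  rw [mem_eig, g.map_omega, ex_zero, one_smul]

lemma deriv_wt {k : ℤ} {u : V} (hu : u ∈ wt V k) : md omega 0 u ∈ wt V (k + 1) := by
  rw [mem_wt] at *
  have hv := virasoro 0 (-1) u
  simp only [zero_add, neg_add_cancel] at hv
  change md omega 1 (md omega 0 u) - md omega 0 (md omega 1 u) = _ at hv
  rw [sub_eq_iff_eq_add, hu, map_smul] at hv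
  rw [hv]
  simp
  change md omega 0 u + _ = _
  module

lemma deriv_eig {q : ℚ} {u : V} (hu : u ∈ g.eig q) : md omega 0 u ∈ g.eig q := by
  simpa using g.md_eig omega_eig hu 0

lemma circ_mem {k : ℤ} {q : ℚ} {u : V} (h0 : 0 ≤ q) (h1 : q < 1) (hu : u ∈ wt V k)
    (hq : u ∈ g.eig q) (v : V) : circ k q u v ∈ g.O :=
  Submodule.subset_span ⟨k, q, u, v, h0, h1, hu, hq, rfl⟩

/-- `Res_z (1+z)^{wt u - 1 + δ_r + r/T} z^{-1-δ_r-m} Y(u,z)v ∈ O_g(V)`. -/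
lemma res_mem_O₀ (q : ℚ) (h0 : 0 ≤ q) (h1 : q < 1) (v : V) (m : ℕ) :
    ∀ (k : ℤ) (u : V), u ∈ wt V k → u ∈ g.eig q →
      resMode ((k : ℂ) - 1 + del q + q) (-1 - del q - m) u v ∈ g.O := by
  induction m with
  | zero =>
    intro k u hu hq
    simpa [circ] using circ_mem h0 h1 hu hq v
  | succ m ih =>
    intro k u hu hq
    have e1 := ih (k + 1) (md omega 0 u) (deriv_wt hu) (deriv_eig hq)
    have e2 := ih k u hu hq
    have e3 := resMode_deriv ((k : ℂ) - 1 + del q + q) (1 + del q + m) u v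
    have hc : (((1 + del q + m : ℤ)) : ℂ) ≠ 0 := by
      have := del_nonneg q
      exact_mod_cast (show (1 + del q + m : ℤ) ≠ 0 by omega)
    rw [show -(1 + del q + (m : ℤ)) - 1 = -1 - del q - ((m + 1 : ℕ) : ℤ) by push_cast; ring,
      show -(1 + del q + (m : ℤ)) = -1 - del q - m by ring,
      show (k : ℂ) - 1 + del q + q + 1 = ((k + 1 : ℤ) : ℂ) - 1 + del q + q by push_cast; ring,
      ← sub_eq_iff_eq_add] at e3
    rw [← Submodule.smul_mem_iff _ hc, ← e3]
    exact Submodule.sub_mem _ e1 (Submodule.smul_mem _ _ e2)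

/-- `Res_z (1+z)^{wt u - 1 + δ_r + r/T + n} z^{-1-δ_r-m} Y(u,z)v ∈ O_g(V)` for `m ≥ n ≥ 0`. -/
lemma res_mem_O {q : ℚ} (h0 : 0 ≤ q) (h1 : q < 1) {k : ℤ} {u : V} (hu : u ∈ wt V k)
    (hq : u ∈ g.eig q) (v : V) (n m : ℕ) (hnm : n ≤ m) {α : ℂ} {c : ℤ}
    (hα : α = (k : ℂ) - 1 + del q + q + n) (hc : c = -1 - del q - m) :
    resMode α c u v ∈ g.O := by
  subst hα hc
  induction n generalizing m with
  | zero => simpa using res_mem_O₀ q h0 h1 v m k u hu hq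
  | succ n ih =>
    have e := resMode_succ ((k : ℂ) - 1 + del q + q + n) (-1 - del q - m) u v
    push_cast
    rw [← add_assoc, e]
    refine Submodule.add_mem _ (ih m (by omega)) ?_
    have := ih (m - 1) (by omega)
    rwa [show (-1 - del q - ((m - 1 : ℕ) : ℤ)) = -1 - del q - m + 1 by
      push_cast [show 1 ≤ m by omega]; ring] at this

lemma finsum_mem_sub {W : Submodule ℂ V} {f : ℕ → V} (h : ∀ i, f i ∈ W) : ∑ᶠ i, f i ∈ W :=
  finsum_induction (· ∈ W) W.zero_mem (fun _ _ => W.add_mem) h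

lemma resMode_mem_eig {p q : ℚ} {u v : V} (hu : u ∈ g.eig p) (hv : v ∈ g.eig q) (α : ℂ) (k : ℤ) :
    resMode α k u v ∈ g.eig (p + q) :=
  finsum_mem_sub fun _ => Submodule.smul_mem _ _ (g.md_eig hu hv _)

lemma star_mem_eig {q : ℚ} (u : V) {v : V} (hv : v ∈ g.eig q) : g.star u v ∈ g.eig q := by
  induction u using g.hom_induction with
  | h0 => simp
  | hadd u v hu hv => rw [map_add]; exact Submodule.add_mem _ hu hv
  | h k p u h0 h1 hk hp =>
    rcases h0.eq_or_lt with rfl | h0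
    · rw [star_apply hk hp]
      simpa using resMode_mem_eig hp hv _ _
    · simp [star_of_ne hp h0 h1]

/-- `V^r ⊆ O_g(V)` for `0 < r < T`. -/
lemma eig_le_O {q : ℚ} (h0 : 0 < q) (h1 : q < 1) {v : V} (hv : v ∈ g.eig q) : v ∈ g.O := by
  have key : ∀ (k : ℤ) (u : V), u ∈ wt V k → u ∈ g.eig q → u ∈ g.O := by
    intro k u hk hu
    have := circ_mem h0.le h1 hk hu vac
    rw [circ] at this
    have hd : del q = 0 := by simp [del, h0.ne']
    rw [resMode_apply, fs_range (N := 1)] at this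
    · have hc : md u (-1) vac = u := creation u
      simpa [hd, hc] using this
    · intro i hi
      have : md u (-1 - del q + i) vac = 0 := creation_nonneg u _ (by omega)
      rw [this, smul_zero]
  have hP : ∀ v : V, g.eigProj q v ∈ g.O := by
    intro v
    induction v using g.hom_induction with
    | h0 => simp
    | hadd u v hu hv => rw [map_add]; exact Submodule.add_mem _ hu hv
    | h k p u _ _ hk _ => exact key k _ (g.eigProj_wt q hk) (g.eigProj_mem _ _)
  simpa [g.eigProj_of_mem hv] using hP v

lemma sub_mem_of_tail {f : ℕ → V} {N : ℕ} (hN : ∀ i, N ≤ i → f i = 0) {x : V} {W : Submodule ℂ V}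
    (h0 : f 0 - x ∈ W) (h : ∀ i, f (i + 1) ∈ W) : ∑ᶠ i, f i - x ∈ W := by
  rw [fs_range (N := N + 1) (fun i hi => hN i (by omega)), Finset.sum_range_succ', add_sub_assoc]
  exact Submodule.add_mem _ (Submodule.sum_mem _ fun i _ => h i) h0

lemma res_rhs_trunc (α β : ℂ) (l m n : ℤ) (a b w : V) : ∃ N : ℕ, ∀ i : ℕ, N ≤ i →
    ((-1 : ℂ) ^ i * Ring.choose (l : ℂ) i) •
      (resMode α (l + m - i) a (resMode β (n + i) b w) -
        (-1 : ℂ) ^ l • resMode β (l + n - i) b (resMode α (m + i) a w)) = 0 := by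
  obtain ⟨N1, h1⟩ := resMode_trunc β b w
  obtain ⟨N2, h2⟩ := resMode_trunc α a w
  refine ⟨N1.natAbs + N2.natAbs + m.natAbs + n.natAbs, fun i hi => ?_⟩
  rw [h1 _ (by omega), h2 _ (by omega)]
  simp

lemma choose_int_zero (j : ℕ) : Ring.choose (((0 : ℤ)) : ℂ) (j + 1) = 0 := by
  simp [Ring.choose_zero_succ]

/-- `res_identity` for `m = 0`. -/
lemma res_assoc (α β : ℂ) (l n : ℤ) (a b w : V) :
    ∑ᶠ s : ℕ, Ring.choose α s • resMode (α + β - s) n (md a (l + s) b) w =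
    ∑ᶠ i : ℕ, ((-1 : ℂ) ^ i * Ring.choose (l : ℂ) i) •
      (resMode α (l - i) a (resMode β (n + i) b w) -
        (-1 : ℂ) ^ l • resMode β (l + n - i) b (resMode α i a w)) := by
  have := res_identity α β l 0 n a b w
  rw [fs_range (N := 1)] at this
  · simpa using this
  · intro i hi
    obtain ⟨j, rfl⟩ : ∃ j, i = j + 1 := ⟨i - 1, by omega⟩
    rw [choose_int_zero, zero_smul]

/-- `res_identity` for `l = 0`. -/
lemma res_comm (α β : ℂ) (m n : ℤ) (a b w : V) :
    resMode α m a (resMode β n b w) - resMode β n b (resMode α m a w) =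
    ∑ᶠ j : ℕ, Ring.choose (m : ℂ) j • ∑ᶠ s : ℕ, Ring.choose α s •
      resMode (α + β - s) (m + n - j) (md a (s + j) b) w := by
  have := res_identity α β 0 m n a b w
  rw [fs_range (N := 1) (f := fun i : ℕ => ((-1 : ℂ) ^ i * Ring.choose ((0 : ℤ) : ℂ) i) • _)]
    at this
  · simpa using this.symm
  · intro i hi
    obtain ⟨j, rfl⟩ : ∃ j, i = j + 1 := ⟨i - 1, by omega⟩
    rw [choose_int_zero, mul_zero, zero_smul]

/-- The product of a residue `∑ C(α,s) a_{l+s} b ∈ V^0`, with `a`, `b` homogeneous. -/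
lemma star_res {α : ℂ} {l : ℤ} {j k : ℤ} {p q : ℚ} {a b : V} (ha : a ∈ wt V j) (hb : b ∈ wt V k)
    (hp : a ∈ g.eig p) (hq : b ∈ g.eig q) {z : ℤ} (hpq : p + q = z) (c : V) {β : ℂ}
    (hβ : α + β = j + k - l - 1) :
    g.star (resMode α l a b) c =
      ∑ᶠ s : ℕ, Ring.choose α s • resMode (α + β - s) (-1) (md a (l + s) b) c := by
  obtain ⟨N, hN⟩ := md_trunc a b
  rw [resMode_range hN α l (M := (N - l).toNat) (by omega), fs_range (N := (N - l).toNat)]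
  · simp only [map_sum, LinearMap.sum_apply, map_smul, LinearMap.smul_apply]
    apply Finset.sum_congr rfl
    intro s _
    congr 1
    have h0 : md a (l + s) b ∈ g.eig 0 := by
      have := g.md_eig hp hq (l + s)
      rw [hpq] at this
      have h := g.eig_add_int 0 z
      rw [zero_add] at h
      rwa [h] at this
    rw [star_apply (md_wt ha hb (l + s)) h0, hβ]
    congr 3
    push_cast; ring
  · intro s hs
    rw [hN _ (by omega)]
    simp

/-- `O_g(V)` is a right ideal for `*_g`. -/
lemma star_O_left {x : V} (hx : x ∈ g.O) (c : V) : g.star x c ∈ g.O := by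
  induction hx using Submodule.span_induction with
  | zero => simp
  | add x y _ _ hx hy => rw [map_add]; exact Submodule.add_mem _ hx hy
  | smul r x _ hx => rw [map_smul]; exact Submodule.smul_mem _ _ hx
  | mem x hx =>
    obtain ⟨k, q, a, b, h0, h1, hk, hq, rfl⟩ := hx
    induction b using g.hom_induction with
    | h0 => simp [circ]
    | hadd u v hu hv =>
      rw [circ] at *
      rw [map_add, map_add]; exact Submodule.add_mem _ hu hv
    | h j p b hp0 hp1 hj hp =>
      rw [circ]
      by_cases hpq : ∃ z : ℤ, q + p = z
      swap
      · have hmem := resMode_mem_eig hq hp ((k : ℂ) - 1 + del q + q) (-1 - del q)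
        have : g.eigProj 0 (resMode ((k : ℂ) - 1 + del q + q) (-1 - del q) a b) = 0 :=
          g.eigProj_of_mem_ne hmem (by simpa using hpq)
        rw [star, LinearMap.comp_apply, this]
        simp
      obtain ⟨z, hz⟩ := hpq
      rw [star_res hk hj hq hp hz c (β := (j : ℂ) + 1 - q) (by push_cast; ring), res_assoc]
      apply finsum_mem_sub
      intro i
      apply Submodule.smul_mem
      apply Submodule.sub_mem
      · exact res_mem_O h0 h1 hk hq _ 0 i (by omega) (by simp) (by ring)
      · apply Submodule.smul_mem
        rcases h0.eq_or_lt with hq0 | hq0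
        · have hp' : p = 0 := by
            subst hq0
            rw [zero_add] at hz
            subst hz
            have : (0 : ℤ) ≤ z := by exact_mod_cast hp0
            have : z < (1 : ℤ) := by exact_mod_cast hp1
            have : z = 0 := by omega
            simp [this]
          subst hq0 hp'
          exact res_mem_O hp0 hp1 hj hp _ 1 (i + 1) (by omega) (by simp [del])
            (by simp [del]; ring)
        · have hp' : p = 1 - q := by
            have h3 : (0 : ℚ) < z := by rw [← hz]; linarith
            have h4 : (z : ℚ) < 2 := by rw [← hz]; linarith
            have : (0 : ℤ) < z := by exact_mod_cast h3
            have : z < (2 : ℤ) := by exact_mod_cast h4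
            have : z = 1 := by omega
            rw [this] at hz
            push_cast at hz
            linarith
          have hd : del q = 0 := by simp [del, hq0.ne']
          have hd' : del p = 0 := by
            have : p ≠ 0 := by rw [hp']; linarith
            simp [del, this]
          refine res_mem_O hp0 hp1 hj hp _ 1 (i + 1) (by omega) ?_ ?_
          · rw [hd', hp']; push_cast; ring
          · rw [hd, hd']; push_cast; ring

/-- `O_g(V)` is a left ideal for `*_g`. -/
lemma star_O_right (c : V) {x : V} (hx : x ∈ g.O) : g.star c x ∈ g.O := by
  induction c using g.hom_induction with
  | h0 => simp
  | hadd u v hu hv => rw [map_add]; exact Submodule.add_mem _ hu hv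
  | h j p c hp0 hp1 hj hp =>
  rcases hp0.eq_or_lt with hp' | hp'
  swap
  · simp [star_of_ne hp hp' hp1]
  subst hp'
  rw [star_apply hj hp]
  induction hx using Submodule.span_induction with
  | zero => simp
  | add x y _ _ hx hy => rw [map_add]; exact Submodule.add_mem _ hx hy
  | smul r x _ hx => rw [map_smul]; exact Submodule.smul_mem _ _ hx
  | mem x hx =>
    obtain ⟨k, q, a, b, h0, h1, hk, hq, rfl⟩ := hx
    have e := res_comm (j : ℂ) ((k : ℂ) - 1 + del q + q) (-1) (-1 - del q) c a b
    rw [sub_eq_iff_eq_add] at e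
    rw [circ, e]
    apply Submodule.add_mem _ _ (circ_mem h0 h1 hk hq _)
    apply finsum_mem_sub
    intro i
    apply Submodule.smul_mem
    apply finsum_mem_sub
    intro s
    apply Submodule.smul_mem
    refine res_mem_O h0 h1 (md_wt hj hk (s + i)) (by simpa using g.md_eig hp hq (s + i)) _
      (i + 1) (i + 1) le_rfl ?_ ?_
    · push_cast; ring
    · push_cast; ring

/-- `*_g` is associative modulo `O_g(V)`. -/
lemma star_assoc_mem (a b c : V) : g.star (g.star a b) c - g.star a (g.star b c) ∈ g.O := by
  induction a using g.hom_induction with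
  | h0 => simp
  | hadd u v hu hv =>
    simp only [map_add, LinearMap.add_apply]
    rw [add_sub_add_comm]; exact Submodule.add_mem _ hu hv
  | h j p a hp0 hp1 hj hp =>
  rcases hp0.eq_or_lt with hp' | hp'
  swap
  · simp [star_of_ne hp hp' hp1]
  subst hp'
  induction b using g.hom_induction with
  | h0 => simp
  | hadd u v hu hv =>
    simp only [map_add, LinearMap.add_apply]
    rw [add_sub_add_comm]; exact Submodule.add_mem _ hu hv
  | h k q b hq0 hq1 hk hq =>
  rcases hq0.eq_or_lt with hq' | hq'
  swap
  · rw [star_of_ne (star_mem_eig a hq) hq' hq1, star_of_ne hq hq' hq1]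
    simp
  subst hq'
  rw [star_apply hj hp, star_apply hj hp, star_apply hk hq,
    star_res hj hk hp hq (z := 0) (by simp) c (β := (k : ℂ)) (by push_cast; ring), res_assoc]
  obtain ⟨N, hN⟩ := res_rhs_trunc (j : ℂ) (k : ℂ) (-1) 0 (-1) a b c
  simp only [add_zero, zero_add] at hN
  apply sub_mem_of_tail hN
  · simp only [pow_zero, Ring.choose_zero_right, mul_one, one_smul, Nat.cast_zero, sub_zero,
      add_zero, sub_sub_cancel_left]
    rw [Submodule.neg_mem_iff]
    apply Submodule.smul_mem
    exact res_mem_O le_rfl one_pos hk hq _ 0 0 (by omega) (by simp [del]) (by simp [del])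
  · intro i
    apply Submodule.smul_mem
    apply Submodule.sub_mem
    · exact res_mem_O le_rfl one_pos hj hp _ 0 i (by omega) (by simp [del])
        (by simp [del]; ring)
    · apply Submodule.smul_mem
      exact res_mem_O le_rfl one_pos hk hq _ 0 (i + 1) (by omega) (by simp [del])
        (by simp [del])

lemma vac_eig : (vac : V) ∈ g.eig 0 := by
  rw [mem_eig, g.map_vac, ex_zero, one_smul]

lemma vac_wt : (vac : V) ∈ wt V 0 := by
  rw [mem_wt]
  have : md (omega : V) 1 vac = 0 := creation_nonneg _ _ (by norm_num)
  simp [this]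

lemma vac_star (v : V) : g.star vac v = v := by
  rw [star_apply vac_wt vac_eig, resMode_apply, fs_range (N := 1)]
  · have : md (vac : V) (-1) v = v := by simpa [md] using vac_mode (-1) v
    simp [this]
  · intro i hi
    obtain ⟨j, rfl⟩ : ∃ j, i = j + 1 := ⟨i - 1, by omega⟩
    rw [choose_int_zero, zero_smul]

lemma star_vac (v : V) : g.star v vac - v ∈ g.O := by
  induction v using g.hom_induction with
  | h0 => simp
  | hadd u v hu hv =>
    simp only [map_add, LinearMap.add_apply]
    rw [add_sub_add_comm]; exact Submodule.add_mem _ hu hv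
  | h k q u h0 h1 hk hq =>
    rcases h0.eq_or_lt with rfl | h0
    · rw [star_apply hk hq, resMode_apply, fs_range (N := 1)]
      · have hc : md u (-1) vac = u := creation u
        simp [hc]
      · intro i hi
        have : md u (-1 + i) vac = 0 := creation_nonneg u _ (by omega)
        rw [this, smul_zero]
    · rw [star_of_ne hq h0 h1]
      simpa using eig_le_O h0 h1 hq

variable (g)

/-- The algebra `A_g(V) = V / O_g(V)`. -/
def A : Type u := V ⧸ g.O

instance : AddCommGroup g.A := inferInstanceAs (AddCommGroup (V ⧸ g.O))

instance : Module ℂ g.A := inferInstanceAs (Module ℂ (V ⧸ g.O))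

/-- The class `a + O_g(V)` of `a ∈ V`. -/
def toA : V →ₗ[ℂ] g.A := g.O.mkQ

lemma toA_surjective : Function.Surjective g.toA := g.O.mkQ_surjective

lemma toA_eq_zero {x : V} : g.toA x = 0 ↔ x ∈ g.O := Submodule.Quotient.mk_eq_zero _

/-- The product induced by `*_g` on `A_g(V)`. -/
def mulA : g.A →ₗ[ℂ] g.A →ₗ[ℂ] g.A :=
  g.O.liftQ
    { toFun := fun u => g.O.liftQ (g.toA.comp (g.star u)) fun x hx =>
        (g.toA_eq_zero).2 (star_O_right u hx)
      map_add' := fun u v => by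
        apply LinearMap.ext
        intro x
        obtain ⟨x, rfl⟩ := g.toA_surjective x
        change g.toA (g.star (u + v) x) = g.toA (g.star u x) + g.toA (g.star v x)
        simp
      map_smul' := fun c u => by
        apply LinearMap.ext
        intro x
        obtain ⟨x, rfl⟩ := g.toA_surjective x
        change g.toA (g.star (c • u) x) = c • g.toA (g.star u x)
        simp }
    (fun u hu => by
      apply LinearMap.ext
      intro x
      obtain ⟨x, rfl⟩ := g.toA_surjective x
      exact (g.toA_eq_zero).2 (star_O_left hu x))

instance : Mul g.A := ⟨fun x y => g.mulA x y⟩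

instance : One g.A := ⟨g.toA vac⟩

lemma toA_mul (u v : V) : g.toA u * g.toA v = g.toA (g.star u v) := rfl

instance : Ring g.A :=
  { (inferInstance : AddCommGroup g.A), (inferInstance : Mul g.A), (inferInstance : One g.A) with
    left_distrib := fun a b c => (g.mulA a).map_add b c
    right_distrib := fun a b c => LinearMap.map_add₂ g.mulA a b c
    zero_mul := fun a => LinearMap.map_zero₂ g.mulA a
    mul_zero := fun a => (g.mulA a).map_zero
    mul_assoc := fun a b c => by
      obtain ⟨a, rfl⟩ := g.toA_surjective a
      obtain ⟨b, rfl⟩ := g.toA_surjective b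
      obtain ⟨c, rfl⟩ := g.toA_surjective c
      rw [toA_mul, toA_mul, toA_mul, toA_mul, ← sub_eq_zero, ← map_sub, toA_eq_zero]
      exact star_assoc_mem a b c
    one_mul := fun a => by
      obtain ⟨a, rfl⟩ := g.toA_surjective a
      exact congrArg g.toA (vac_star a)
    mul_one := fun a => by
      obtain ⟨a, rfl⟩ := g.toA_surjective a
      change g.toA (g.star a vac) = g.toA a
      rw [← sub_eq_zero, ← map_sub, toA_eq_zero]
      exact star_vac a }

instance : Algebra ℂ g.A :=
  Algebra.ofModule (fun c x y => LinearMap.map_smul₂ g.mulA c x y)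
    (fun c x y => (g.mulA x).map_smul c y)

end FiniteOrderAut

end Algebra

/-! ### The Lie algebra `V[g]` -/

section Lie

open VertexOperatorAlgebra

variable {V : Type u} [AddCommGroup V] [Module ℂ V] [VertexOperatorAlgebra V]

/-- The bracket `[t^m ⊗ a, t^n ⊗ b] = ∑ᵢ C(m,i) t^{m+n-i} ⊗ a_i b`, that is, the product `x_0 y` of
the vertex algebra of `V`-valued polynomials in rational powers of `t`; `t^q ⊗ a` is
`Finsupp.single q a`. -/
def brBasis (m n : ℚ) : V →ₗ[ℂ] V →ₗ[ℂ] (ℚ →₀ V) :=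
  LinearMap.mk₂ ℂ
    (fun a b => ∑ᶠ i : ℕ, Ring.choose (m : ℂ) i • Finsupp.single (m + n - i) (md a i b))
    (by
      intro u u' v
      obtain ⟨N, hN⟩ := md_trunc u v
      obtain ⟨N', hN'⟩ := md_trunc u' v
      rw [fs_range (N := (max N N').toNat), fs_range (N := (max N N').toNat),
        fs_range (N := (max N N').toNat), ← Finset.sum_add_distrib]
      · apply Finset.sum_congr rfl
        intro i _
        simp [md_add]
      · intro i hi; rw [hN' _ (by omega), Finsupp.single_zero, smul_zero]
      · intro i hi; rw [hN _ (by omega), Finsupp.single_zero, smul_zero]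
      · intro i hi; simp [md_add, hN _ (show N ≤ i by omega), hN' _ (show N' ≤ i by omega)])
    (by
      intro c u v
      rw [smul_finsum]
      apply finsum_congr
      intro j
      rw [md_smul, LinearMap.smul_apply, ← Finsupp.smul_single, smul_comm])
    (by
      intro u v v'
      obtain ⟨N, hN⟩ := md_trunc u v
      obtain ⟨N', hN'⟩ := md_trunc u v'
      rw [fs_range (N := (max N N').toNat), fs_range (N := (max N N').toNat),
        fs_range (N := (max N N').toNat), ← Finset.sum_add_distrib]
      · apply Finset.sum_congr rfl
        intro i _
        simp
      · intro i hi; rw [hN' _ (by omega), Finsupp.single_zero, smul_zero]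
      · intro i hi; rw [hN _ (by omega), Finsupp.single_zero, smul_zero]
      · intro i hi; simp [hN _ (show N ≤ i by omega), hN' _ (show N' ≤ i by omega)])
    (by
      intro c u v
      rw [smul_finsum]
      apply finsum_congr
      intro j
      rw [map_smul, ← Finsupp.smul_single, smul_comm])

/-- The bilinear extension of `brBasis`. -/
def br : (ℚ →₀ V) →ₗ[ℂ] (ℚ →₀ V) →ₗ[ℂ] (ℚ →₀ V) :=
  Finsupp.lsum ℂ fun m => (Finsupp.lsum ℂ).toLinearMap.comp (LinearMap.pi fun n => brBasis m n)

/-- `D = d/dt ⊗ 1 + 1 ⊗ L(-1)`. -/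
def Dop : (ℚ →₀ V) →ₗ[ℂ] (ℚ →₀ V) :=
  Finsupp.lsum ℂ fun m =>
    (m : ℂ) • Finsupp.lsingle (m - 1) + (Finsupp.lsingle m).comp (md (omega : V) 0)

lemma br_single (m n : ℚ) (a b : V) : br (Finsupp.single m a) (Finsupp.single n b) =
    ∑ᶠ i : ℕ, Ring.choose (m : ℂ) i • Finsupp.single (m + n - i) (md a i b) := by
  rw [br, Finsupp.lsum_single, LinearMap.comp_apply, LinearEquiv.coe_coe, Finsupp.lsum_single]
  rfl

lemma Dop_single (m : ℚ) (a : V) : Dop (Finsupp.single m a) =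
    (m : ℂ) • Finsupp.single (m - 1) a + Finsupp.single m (md omega 0 a) := by
  simp [Dop]

lemma br_Dop (x y : ℚ →₀ V) : br (Dop x) y = 0 := by
  induction x using Finsupp.induction_linear with
  | zero => simp
  | add x x' hx hx' => rw [map_add, map_add, LinearMap.add_apply, hx, hx', add_zero]
  | single m a =>
  induction y using Finsupp.induction_linear with
  | zero => simp
  | add y y' hy hy' => rw [map_add, hy, hy', add_zero]
  | single n b =>
  rw [Dop_single, map_add, map_smul, LinearMap.add_apply, LinearMap.smul_apply, br_single,
    br_single]
  obtain ⟨N, hN⟩ := md_trunc a b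
  obtain ⟨M, hM⟩ : ∃ M : ℕ, M = N.toNat := ⟨_, rfl⟩
  rw [fs_range (N := M), fs_range (N := M + 1), Finset.sum_range_succ']
  · simp only [md_deriv]
    rw [add_comm, Finset.smul_sum, add_right_comm, ← Finset.sum_add_distrib]
    have : ∀ i : ℕ, Ring.choose (m : ℂ) (i + 1) • Finsupp.single (m + n - ((i + 1 : ℕ) : ℚ))
        (((-((i + 1 : ℕ) : ℤ) : ℂ) • md a (((i + 1 : ℕ) : ℤ) - 1)) b) +
        (m : ℂ) • Ring.choose (((m - 1 : ℚ)) : ℂ) i • Finsupp.single (m - 1 + n - i) (md a i b) =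
          0 := by
      intro i
      have h1 := FiniteOrderAut.succ_mul_choose ((m : ℂ) - 1) i
      rw [sub_add_cancel] at h1
      have h2 : (m + n - ((i + 1 : ℕ) : ℚ)) = m - 1 + n - i := by push_cast; ring
      have h3 : (((i + 1 : ℕ) : ℤ) - 1) = i := by push_cast; ring
      rw [h2, h3, LinearMap.smul_apply, ← Finsupp.smul_single, smul_smul, smul_smul, ← add_smul]
      push_cast
      rw [← h1]
      rw [show Ring.choose (m : ℂ) (i + 1) * -((i : ℂ) + 1) +
        ((i : ℂ) + 1) * Ring.choose (m : ℂ) (i + 1) = 0 by ring, zero_smul]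
    rw [Finset.sum_eq_zero fun i _ => this i]
    simp
  · intro i hi
    rw [md_deriv, LinearMap.smul_apply, hN _ (by omega), smul_zero, Finsupp.single_zero, smul_zero]
  · intro i hi
    rw [hN _ (by omega), Finsupp.single_zero, smul_zero]

lemma single_finsum (q : ℚ) (f : ℕ → V) :
    Finsupp.single q (∑ᶠ i, f i) = ∑ᶠ i, Finsupp.single q (f i) :=
  AddMonoidHom.map_finsum_of_preimage_zero (Finsupp.singleAddHom q)
    (fun _ hx => Finsupp.single_eq_zero.1 hx) f

lemma trunc_single {f : ℤ → ℤ → V} (hf : Trunc f) (K : ℚ) :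
    Trunc (fun i j => Finsupp.single (K - i - j) (f i j)) := by
  intro j₀
  obtain ⟨N, hN⟩ := hf j₀
  exact ⟨N, fun i j hj hij => by
    change Finsupp.single _ (f i j) = 0
    rw [hN i j hj hij, Finsupp.single_zero]⟩

lemma borcherds_single (a b w : V) (K : ℚ) :
    Borcherds (fun i j => Finsupp.single (K - i - j) (md a i (md b j w)))
      (fun j i => Finsupp.single (K - j - i) (md b j (md a i w)))
      (fun k s => Finsupp.single (K - k - s) (md (md a s b) k w)) := by
  intro l m n
  have h := congrArg (Finsupp.single (K - l - m - n)) (md_jacobi a b w l m n)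
  rw [single_finsum, single_finsum] at h
  have e1 : ∀ i : ℕ, Ring.choose (m : ℂ) i • Finsupp.single
      (K - ((m + n - i : ℤ) : ℚ) - ((l + i : ℤ) : ℚ)) (md (md a (l + i) b) (m + n - i) w) =
      Finsupp.single (K - l - m - n)
        (Ring.choose (m : ℂ) i • md (md a (l + i) b) (m + n - i) w) := by
    intro i
    rw [← Finsupp.smul_single]
    congr 2
    push_cast; ring
  have e2 : ∀ i : ℕ, ((-1 : ℂ) ^ i * Ring.choose (l : ℂ) i) •
      (Finsupp.single (K - ((l + m - i : ℤ) : ℚ) - ((n + i : ℤ) : ℚ))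
        (md a (l + m - i) (md b (n + i) w)) - (-1 : ℂ) ^ l •
      Finsupp.single (K - ((l + n - i : ℤ) : ℚ) - ((m + i : ℤ) : ℚ))
        (md b (l + n - i) (md a (m + i) w))) =
      Finsupp.single (K - l - m - n) (((-1 : ℂ) ^ i * Ring.choose (l : ℂ) i) •
        (md a (l + m - i) (md b (n + i) w) - (-1 : ℂ) ^ l • md b (l + n - i) (md a (m + i) w))) := by
    intro i
    rw [← Finsupp.smul_single, Finsupp.single_sub, ← Finsupp.smul_single,
      show K - ((l + m - i : ℤ) : ℚ) - ((n + i : ℤ) : ℚ) = K - l - m - n by push_cast; ring,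
      show K - ((l + n - i : ℤ) : ℚ) - ((m + i : ℤ) : ℚ) = K - l - m - n by push_cast; ring]
  simp only [e1, e2]
  exact h

lemma br_br_left (m n k : ℚ) (a b c : V) :
    br (Finsupp.single m a) (br (Finsupp.single n b) (Finsupp.single k c)) =
      ∑ᶠ p : ℕ, Ring.choose (m : ℂ) p • ∑ᶠ q : ℕ, Ring.choose (n : ℂ) q •
        Finsupp.single (m + n + k - (p : ℤ) - (q : ℤ)) (md a p (md b q c)) := by
  obtain ⟨N, hN⟩ := trunc_mul a b c 0
  obtain ⟨M, hM⟩ : ∃ M : ℕ, M = N.toNat := ⟨_, rfl⟩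
  obtain ⟨N', hN'⟩ := md_trunc b c
  obtain ⟨M', hM'⟩ : ∃ M' : ℕ, M' = N'.toNat := ⟨_, rfl⟩
  rw [br_single, fs_range (N := M + M')]
  swap
  · intro q hq
    rw [hN' _ (by omega), Finsupp.single_zero, smul_zero]
  have e : ∀ p : ℕ, ∑ᶠ q : ℕ, Ring.choose (n : ℂ) q •
        Finsupp.single (m + n + k - (p : ℤ) - (q : ℤ)) (md a p (md b q c)) =
      ∑ q ∈ Finset.range (M + M'), Ring.choose (n : ℂ) q •
        Finsupp.single (m + n + k - (p : ℤ) - (q : ℤ)) (md a p (md b q c)) := by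
    intro p
    apply fs_range
    intro q hq
    rw [hN' _ (by omega), map_zero, Finsupp.single_zero, smul_zero]
  simp only [e, map_sum, map_smul, br_single]
  rw [fs_range (N := M + M')]
  · simp only [Finset.smul_sum]
    rw [Finset.sum_comm]
    apply Finset.sum_congr rfl
    intro q _
    rw [fs_range (N := M + M')]
    · rw [Finset.smul_sum]
      apply Finset.sum_congr rfl
      intro p _
      rw [smul_comm]
      congr 3
      push_cast; ring
    · intro p hp
      have : md a p (md b q c) = 0 := hN p q (by omega) (by omega)
      rw [this, Finsupp.single_zero, smul_zero]
  · intro p hp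
    rw [Finset.sum_eq_zero, smul_zero]
    intro q _
    have : md a p (md b q c) = 0 := hN p q (by omega) (by omega)
    rw [this, Finsupp.single_zero, smul_zero]

lemma br_br_right (m n k : ℚ) (a b c : V) :
    br (br (Finsupp.single m a) (Finsupp.single n b)) (Finsupp.single k c) =
      ∑ᶠ s : ℕ, Ring.choose (m : ℂ) s • ∑ᶠ q : ℕ, Ring.choose ((m : ℂ) + n - s) q •
        Finsupp.single (m + n + k - (q : ℤ) - (s : ℤ)) (md (md a s b) q c) := by
  obtain ⟨N', hN'⟩ := md_trunc a b
  obtain ⟨M', hM'⟩ : ∃ M' : ℕ, M' = N'.toNat := ⟨_, rfl⟩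
  rw [br_single, fs_range (N := M'), fs_range (N := M')]
  · simp only [map_sum, map_smul, LinearMap.sum_apply, LinearMap.smul_apply, br_single]
    apply Finset.sum_congr rfl
    intro s _
    congr 1
    apply finsum_congr
    intro q
    congr 2
    · push_cast; ring
    · push_cast; ring
  · intro s hs
    rw [hN' _ (by omega)]
    simp [md_zero]
  · intro s hs
    rw [hN' _ (by omega), Finsupp.single_zero, smul_zero]

lemma br_leibniz (x y z : ℚ →₀ V) : br x (br y z) = br (br x y) z + br y (br x z) := by
  induction x using Finsupp.induction_linear with
  | zero => simp
  | add x x' hx hx' =>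
    simp only [map_add, LinearMap.add_apply, hx, hx']
    abel
  | single m a =>
  induction y using Finsupp.induction_linear with
  | zero => simp
  | add y y' hy hy' =>
    simp only [map_add, LinearMap.add_apply, hy, hy']
    abel
  | single n b =>
  induction z using Finsupp.induction_linear with
  | zero => simp
  | add z z' hz hz' =>
    simp only [map_add, hz, hz']
    abel
  | single k c =>
  rw [← sub_eq_iff_eq_add, br_br_left, br_br_left, br_br_right]
  have h := borcherds_res (trunc_single (trunc_mul a b c) (m + n + k))
    (trunc_single (trunc_mul b a c) (m + n + k)) (trunc_single (trunc_iter a b c) (m + n + k))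
    (borcherds_single a b c (m + n + k)) m n 0 0 0
  rw [fs_range (N := 1), fs_range (N := 1)] at h
  · simp only [Finset.range_one, Finset.sum_singleton, Nat.cast_zero, Ring.choose_zero_right,
      one_smul, pow_zero, mul_one, zero_add, sub_zero, add_zero, zpow_zero, Int.cast_natCast] at h ⊢
    rw [h]
    simp only [show n + m + k = m + n + k by ring]
  · intro i hi
    obtain ⟨j, rfl⟩ : ∃ j, i = j + 1 := ⟨i - 1, by omega⟩
    rw [FiniteOrderAut.choose_int_zero, mul_zero, zero_smul]
  · intro i hi
    obtain ⟨j, rfl⟩ : ∃ j, i = j + 1 := ⟨i - 1, by omega⟩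
    rw [FiniteOrderAut.choose_int_zero, zero_smul]

lemma choose_neg_one (i : ℕ) : Ring.choose (((-1 : ℤ)) : ℂ) i = (-1) ^ i := by
  have := Ring.choose_neg (1 : ℂ) i
  rw [show (1 : ℂ) + i - 1 = (i : ℂ) by ring, Ring.choose_natCast, Nat.choose_self] at this
  push_cast
  rw [this]
  simp [Units.smul_def, Int.coe_negOnePow]

/-- Skew symmetry: `v_p u = ∑ᵢ (-1)^{p+i+1} (u_{p+i} v)_{-1-i} 𝟏`. -/
lemma md_skew (u v : V) (p : ℕ) : md v p u =
    ∑ᶠ i : ℕ, (-(-1 : ℂ) ^ (p + i)) • md (md u ((p + i : ℕ) : ℤ) v) (-1 - i) vac := by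
  have h := md_jacobi u v vac p (-1) 0
  rw [fs_range (N := 1) (f := fun i : ℕ => ((-1 : ℂ) ^ i * Ring.choose ((p : ℤ) : ℂ) i) • _)] at h
  · have h1 : md v 0 vac = 0 := creation_nonneg _ _ le_rfl
    have h2 : md u (-1) vac = u := creation u
    simp only [Finset.range_one, Finset.sum_singleton, pow_zero, Ring.choose_zero_right, mul_one,
      Nat.cast_zero, add_zero, sub_zero, h1, h2, map_zero, zero_sub, one_smul, zpow_natCast,
      choose_neg_one] at h
    have h3 : md v p u = (-(-1 : ℂ) ^ p) • -((-1 : ℂ) ^ p • md v p u) := by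
      rw [smul_neg, neg_smul, neg_neg, smul_smul, ← mul_pow]
      simp
    rw [h3, ← h, smul_finsum]
    apply finsum_congr
    intro i
    rw [smul_smul]
    congr 2
    ring
  · intro i hi
    have h1 : md v (0 + (i : ℤ)) vac = 0 := creation_nonneg _ _ (by omega)
    have h2 : md u (-1 + (i : ℤ)) vac = 0 := creation_nonneg _ _ (by omega)
    rw [h1, h2]
    simp

lemma choose_flip (x : ℂ) (i : ℕ) : Ring.choose x i = (-1) ^ i * Ring.choose ((i : ℂ) - 1 - x) i := by
  have := Ring.choose_neg (-x) i
  rw [neg_neg] at this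
  rw [this, show -x + (i : ℂ) - 1 = i - 1 - x by ring]
  simp [Units.smul_def, Int.coe_negOnePow]

lemma choose_alt (m n : ℂ) (s : ℕ) :
    ∑ x ∈ Finset.HasAntidiagonal.antidiagonal s,
      (-1 : ℂ) ^ x.1 * Ring.choose n x.1 * Ring.choose (m + n - x.1) x.2 = Ring.choose m s := by
  have h := Ring.add_choose_eq s (Commute.all n ((s : ℂ) - 1 - m - n))
  rw [show n + ((s : ℂ) - 1 - m - n) = s - 1 - m by ring] at h
  rw [choose_flip m s, h, Finset.mul_sum]
  apply Finset.sum_congr rfl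
  rintro ⟨p, i⟩ hx
  simp only [Finset.HasAntidiagonal.mem_antidiagonal] at hx
  subst hx
  simp only
  rw [choose_flip (m + n - p) i, show (i : ℂ) - 1 - (m + n - p) = ((p + i : ℕ) : ℂ) - 1 - m - n by
    push_cast; ring]
  ring

namespace FiniteOrderAut

variable (g : FiniteOrderAut V)

/-- `𝓛(V,g) = ⨁_r t^{r/T} ℂ[t,t⁻¹] ⊗ V^r`, the `g`-invariants of `ℂ[t^{1/T},t^{-1/T}] ⊗ V`:
the coefficient of `t^q` lies in the eigenspace of `g` for `e^{2πiq}`.  (The powers of `t` that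
occur are in `(1/T)ℤ`, since `g.eig q = 0` for all other `q`.) -/
def Lg : Submodule ℂ (ℚ →₀ V) where
  carrier := {f | ∀ q, f q ∈ g.eig q}
  add_mem' := fun ha hb q => Submodule.add_mem _ (ha q) (hb q)
  zero_mem' := fun _ => Submodule.zero_mem _
  smul_mem' := fun c _ ha q => Submodule.smul_mem _ c (ha q)

variable {g}

lemma single_mem_Lg {q : ℚ} {a : V} (ha : a ∈ g.eig q) : Finsupp.single q a ∈ g.Lg := by
  intro p
  rw [Finsupp.single_apply]
  split_ifs with h
  · exact h ▸ ha
  · exact Submodule.zero_mem _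

lemma Lg_induction {P : (ℚ →₀ V) → Prop} (h0 : P 0) (hadd : ∀ x y, P x → P y → P (x + y))
    (h : ∀ q a, a ∈ g.eig q → P (Finsupp.single q a)) {x : ℚ →₀ V} (hx : x ∈ g.Lg) : P x := by
  rw [← Finsupp.sum_single x]
  exact Finset.sum_induction _ P hadd h0 fun q _ => h q _ (hx q)

lemma eig_sub_nat (q : ℚ) (i : ℕ) : g.eig (q - i) = g.eig q := by
  have := g.eig_add_int q (-i)
  push_cast at this
  rwa [← sub_eq_add_neg] at this

lemma Dop_mem {x : ℚ →₀ V} (hx : x ∈ g.Lg) : Dop x ∈ g.Lg := by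
  refine Lg_induction (g := g) (P := fun x => Dop x ∈ g.Lg) (by simp)
    (fun x y hx hy => by rw [map_add]; exact Submodule.add_mem _ hx hy) ?_ hx
  intro q a ha
  rw [Dop_single]
  refine Submodule.add_mem _ (Submodule.smul_mem _ _ (single_mem_Lg ?_))
    (single_mem_Lg (deriv_eig ha))
  have := eig_sub_nat (g := g) q 1
  rw [Nat.cast_one] at this
  rwa [this]

lemma br_mem {x y : ℚ →₀ V} (hx : x ∈ g.Lg) (hy : y ∈ g.Lg) : br x y ∈ g.Lg := by
  refine Lg_induction (g := g) (P := fun x => br x y ∈ g.Lg) (by simp)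
    (fun x x' hx hx' => by
      rw [map_add, LinearMap.add_apply]; exact Submodule.add_mem _ hx hx') ?_ hx
  intro m a ha
  refine Lg_induction (g := g) (P := fun y => br (Finsupp.single m a) y ∈ g.Lg) (by simp)
    (fun x x' hx hx' => by rw [map_add]; exact Submodule.add_mem _ hx hx') ?_ hy
  intro n b hb
  rw [br_single]
  refine finsum_induction (· ∈ g.Lg) (Submodule.zero_mem _) (fun _ _ => Submodule.add_mem _) ?_
  intro i
  refine Submodule.smul_mem _ _ (single_mem_Lg ?_)
  rw [eig_sub_nat]
  exact g.md_eig ha hb i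

/-- `t^k ⊗ x_{-1-i} 𝟏 ≡ (-1)^i C(k,i) t^{k-i} ⊗ x` modulo `D 𝓛(V,g)`. -/
lemma single_desc (k : ℚ) (i : ℕ) : ∀ x : V, x ∈ g.eig k →
    (g.Lg.map Dop).mkQ (Finsupp.single k (md x (-1 - i) vac)) =
      ((-1 : ℂ) ^ i * Ring.choose (k : ℂ) i) • (g.Lg.map Dop).mkQ (Finsupp.single (k - i) x) := by
  induction i with
  | zero =>
    intro x _
    have : md x (-1) vac = x := creation x
    simp [this]
  | succ i ih =>
    intro x hx
    have h := ih (md omega 0 x) (deriv_eig hx)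
    rw [md_deriv, LinearMap.smul_apply, ← Finsupp.smul_single, map_smul] at h
    have hD : (g.Lg.map Dop).mkQ (Dop (Finsupp.single (k - i) x)) = 0 := by
      rw [Submodule.mkQ_apply, Submodule.Quotient.mk_eq_zero]
      exact Submodule.mem_map_of_mem (single_mem_Lg (by rwa [eig_sub_nat]))
    rw [Dop_single, map_add, map_smul] at hD
    rw [← neg_eq_iff_add_eq_zero.2 hD] at h
    have hne : ((i : ℂ) + 1) ≠ 0 := by exact_mod_cast Nat.succ_ne_zero i
    have e1 : (-1 - (i : ℤ) - 1) = -1 - ((i + 1 : ℕ) : ℤ) := by push_cast; ring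
    have e2 : k - (i : ℚ) - 1 = k - ((i + 1 : ℕ) : ℚ) := by push_cast; ring
    have e3 : (-((-1 - (i : ℤ) : ℤ) : ℂ)) = (i : ℂ) + 1 := by push_cast; ring
    rw [e1, e2, e3] at h
    rw [← smul_right_injective _ hne |>.eq_iff]
    rw [h, ← neg_smul, smul_smul, smul_smul]
    congr 1
    have h5 := choose_mul (k : ℂ) i 1
    rw [Ring.choose_one_right, Nat.choose_succ_self_right] at h5
    push_cast at h5 ⊢
    rw [pow_succ]
    linear_combination (-(-1 : ℂ) ^ i) * (-h5)

lemma br_skew_single {m n : ℚ} {a b : V} (ha : a ∈ g.eig m) (hb : b ∈ g.eig n) :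
    (g.Lg.map Dop).mkQ (br (Finsupp.single n b) (Finsupp.single m a)) =
      -(g.Lg.map Dop).mkQ (br (Finsupp.single m a) (Finsupp.single n b)) := by
  obtain ⟨N, hN⟩ := md_trunc a b
  obtain ⟨M, hM⟩ : ∃ M : ℕ, M = N.toNat := ⟨_, rfl⟩
  have hab : ∀ s : ℕ, M ≤ s → md a s b = 0 := fun s hs => hN _ (by omega)
  have e1 : ∀ p : ℕ, Finsupp.single (n + m - p) (md b p a) = ∑ i ∈ Finset.range M,
      (-(-1 : ℂ) ^ (p + i)) •
        Finsupp.single (n + m - p) (md (md a ((p + i : ℕ) : ℤ) b) (-1 - i) vac) := by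
    intro p
    rw [md_skew, single_finsum]
    rw [fs_range (N := M)]
    · simp only [← Finsupp.smul_single]
    · intro i hi
      rw [hab _ (by omega), md_zero]
      simp
  have hba : ∀ p : ℕ, M ≤ p → md b p a = 0 := by
    intro p hp
    rw [md_skew, finsum_eq_zero_of_forall_eq_zero]
    intro i
    rw [hab _ (by omega), md_zero]
    simp
  let f : ℕ → ℕ → (ℚ →₀ V) ⧸ (g.Lg.map Dop) := fun p i =>
    ((-1 : ℂ) ^ p * Ring.choose (n : ℂ) p * Ring.choose ((m : ℂ) + n - p) i) •
      (g.Lg.map Dop).mkQ (Finsupp.single (m + n - (p + i : ℕ)) (md a ((p + i : ℕ) : ℤ) b))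
  have hf : ∀ p i, M ≤ p ∨ M ≤ i → f p i = 0 := by
    intro p i hpi
    simp only [f]
    rw [hab _ (by omega)]
    simp
  have e2 : ∀ p i : ℕ, (g.Lg.map Dop).mkQ
      (Finsupp.single (n + m - p) (md (md a ((p + i : ℕ) : ℤ) b) (-1 - i) vac)) =
      ((-1 : ℂ) ^ i * Ring.choose ((m : ℂ) + n - p) i) • (g.Lg.map Dop).mkQ
        (Finsupp.single (m + n - (p + i : ℕ)) (md a ((p + i : ℕ) : ℤ) b)) := by
    intro p i
    rw [single_desc]
    · congr 2
      · push_cast; ring_nf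
      · push_cast; ring_nf
    · rw [eig_sub_nat, add_comm]
      exact g.md_eig ha hb _
  have e3 : (g.Lg.map Dop).mkQ (br (Finsupp.single n b) (Finsupp.single m a)) =
      -∑ p ∈ Finset.range M, ∑ i ∈ Finset.range M, f p i := by
    rw [br_single, fs_range (N := M), map_sum, ← Finset.sum_neg_distrib]
    · apply Finset.sum_congr rfl
      intro p _
      rw [map_smul, e1, map_sum, Finset.smul_sum, ← Finset.sum_neg_distrib]
      apply Finset.sum_congr rfl
      intro i _
      rw [map_smul, e2, smul_smul, smul_smul, ← neg_smul]
      congr 1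
      have : (-1 : ℂ) ^ i * (-1) ^ i = 1 := by rw [← mul_pow]; simp
      rw [pow_add]
      linear_combination (-(Ring.choose (n : ℂ) p * (-1) ^ p *
        Ring.choose ((m : ℂ) + n - p) i)) * this
    · intro p hp
      rw [hba p hp, Finsupp.single_zero, smul_zero]
  have e4 : ∑ᶠ i : ℕ, Ring.choose (m : ℂ) i • Finsupp.single (m + n - i) (md a i b) =
      ∑ i ∈ Finset.range M, Ring.choose (m : ℂ) i • Finsupp.single (m + n - i) (md a i b) :=
    fs_range fun i hi => by rw [hab i hi, Finsupp.single_zero, smul_zero]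
  rw [e3, ← fs_range₂ hf, fs_anti hf, br_single, e4, map_sum, fs_range (N := M)]
  · congr 1
    apply Finset.sum_congr rfl
    intro s _
    rw [map_smul, ← choose_alt (m : ℂ) (n : ℂ) s, Finset.sum_smul]
    apply Finset.sum_congr rfl
    rintro ⟨p, i⟩ hx
    simp only [Finset.HasAntidiagonal.mem_antidiagonal] at hx
    subst hx
    rfl
  · intro s hs
    apply Finset.sum_eq_zero
    rintro ⟨p, i⟩ hx
    simp only [Finset.HasAntidiagonal.mem_antidiagonal] at hx
    subst hx
    simp only [f]
    rw [hab _ hs]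
    simp

lemma br_skew {x y : ℚ →₀ V} (hx : x ∈ g.Lg) (hy : y ∈ g.Lg) :
    (g.Lg.map Dop).mkQ (br y x) = -(g.Lg.map Dop).mkQ (br x y) := by
  refine Lg_induction (g := g) (P := fun x => (g.Lg.map Dop).mkQ (br y x) =
    -(g.Lg.map Dop).mkQ (br x y)) (by simp)
    (fun x x' hx hx' => by
      simp only [map_add, LinearMap.add_apply, hx, hx', neg_add]) ?_ hx
  intro m a ha
  refine Lg_induction (g := g) (P := fun y => (g.Lg.map Dop).mkQ (br y (Finsupp.single m a)) =
    -(g.Lg.map Dop).mkQ (br (Finsupp.single m a) y)) (by simp)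
    (fun x x' hx hx' => by
      simp only [map_add, LinearMap.add_apply, hx, hx', neg_add]) ?_ hy
  intro n b hb
  exact br_skew_single ha hb

variable (g)

/-- The subspace `D 𝓛(V,g)` of `𝓛(V,g)`. -/
def DLg : Submodule ℂ g.Lg := (g.Lg.map Dop).comap g.Lg.subtype

/-- The bracket restricted to `𝓛(V,g)`. -/
def brL : g.Lg →ₗ[ℂ] g.Lg →ₗ[ℂ] g.Lg :=
  LinearMap.mk₂ ℂ (fun x y => ⟨br x.1 y.1, br_mem x.2 y.2⟩)
    (fun x x' y => Subtype.ext (by simp)) (fun c x y => Subtype.ext (by simp))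
    (fun x y y' => Subtype.ext (by simp)) (fun c x y => Subtype.ext (by simp))

lemma mem_DLg {x : g.Lg} : x ∈ g.DLg ↔ (g.Lg.map Dop).mkQ x.1 = 0 := by
  rw [DLg, Submodule.mem_comap, Submodule.mkQ_apply, Submodule.Quotient.mk_eq_zero]
  rfl

lemma brL_left {x : g.Lg} (hx : x ∈ g.DLg) (y : g.Lg) : g.brL x y = 0 := by
  obtain ⟨z, _, hz⟩ := hx
  apply Subtype.ext
  change br x.1 y.1 = 0
  rw [show x.1 = Dop z from hz.symm, br_Dop]

lemma brL_skew (x y : g.Lg) : g.brL x y + g.brL y x ∈ g.DLg := by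
  rw [mem_DLg]
  change (g.Lg.map Dop).mkQ (br x.1 y.1 + br y.1 x.1) = 0
  rw [map_add, br_skew x.2 y.2, add_neg_cancel]

lemma brL_right (x : g.Lg) {y : g.Lg} (hy : y ∈ g.DLg) : g.brL x y ∈ g.DLg := by
  have := g.brL_skew x y
  rwa [g.brL_left hy, add_zero] at this

/-- `V[g] = 𝓛(V,g) / D 𝓛(V,g)`. -/
def Vg : Type u := g.Lg ⧸ g.DLg

instance : AddCommGroup g.Vg := inferInstanceAs (AddCommGroup (g.Lg ⧸ g.DLg))

instance : Module ℂ g.Vg := inferInstanceAs (Module ℂ (g.Lg ⧸ g.DLg))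

/-- The quotient map `𝓛(V,g) → V[g]`. -/
def toVg : g.Lg →ₗ[ℂ] g.Vg := g.DLg.mkQ

lemma toVg_surjective : Function.Surjective g.toVg := g.DLg.mkQ_surjective

lemma toVg_eq_zero {x : g.Lg} : g.toVg x = 0 ↔ x ∈ g.DLg := Submodule.Quotient.mk_eq_zero _

/-- The bracket of `V[g]`. -/
def brVg : g.Vg →ₗ[ℂ] g.Vg →ₗ[ℂ] g.Vg :=
  g.DLg.liftQ
    { toFun := fun x => g.DLg.liftQ (g.toVg.comp (g.brL x)) fun y hy =>
        (g.toVg_eq_zero).2 (g.brL_right x hy)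
      map_add' := fun u v => by
        apply LinearMap.ext
        intro x
        obtain ⟨x, rfl⟩ := g.toVg_surjective x
        change g.toVg (g.brL (u + v) x) = g.toVg (g.brL u x) + g.toVg (g.brL v x)
        simp
      map_smul' := fun c u => by
        apply LinearMap.ext
        intro x
        obtain ⟨x, rfl⟩ := g.toVg_surjective x
        change g.toVg (g.brL (c • u) x) = c • g.toVg (g.brL u x)
        simp }
    (fun u hu => by
      apply LinearMap.ext
      intro x
      obtain ⟨x, rfl⟩ := g.toVg_surjective x
      change g.toVg (g.brL u x) = 0
      rw [g.brL_left hu, map_zero])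

instance : Bracket g.Vg g.Vg := ⟨fun x y => g.brVg x y⟩

lemma toVg_lie (x y : g.Lg) : ⁅g.toVg x, g.toVg y⁆ = g.toVg (g.brL x y) := rfl

instance : LieRing g.Vg where
  add_lie x y z := LinearMap.map_add₂ g.brVg x y z
  lie_add x y z := (g.brVg x).map_add y z
  lie_self x := by
    obtain ⟨x, rfl⟩ := g.toVg_surjective x
    have h := (g.toVg_eq_zero).2 (g.brL_skew x x)
    rw [map_add, ← two_smul ℂ] at h
    exact (smul_eq_zero.1 h).resolve_left two_ne_zero
  leibniz_lie x y z := by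
    obtain ⟨x, rfl⟩ := g.toVg_surjective x
    obtain ⟨y, rfl⟩ := g.toVg_surjective y
    obtain ⟨z, rfl⟩ := g.toVg_surjective z
    rw [toVg_lie, toVg_lie, toVg_lie, toVg_lie, toVg_lie, toVg_lie, ← map_add]
    exact congrArg g.toVg (Subtype.ext (br_leibniz x.1 y.1 z.1))

instance : LieAlgebra ℂ g.Vg where
  lie_smul c x y := (g.brVg x).map_smul c y

/-- The element `a(q) ∈ V[g]`, the image of `t^q ⊗ a`; for `a ∈ V` arbitrary, `a` is first projected
to the eigenspace of `g` that belongs to `q`, so that `a(q) = 0` for `a ∈ V^r`, `q ∉ r/T + ℤ`. -/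
def el (q : ℚ) : V →ₗ[ℂ] g.Vg :=
  g.toVg.comp (LinearMap.codRestrict g.Lg ((Finsupp.lsingle q).comp (g.eigProj q))
    fun a => single_mem_Lg (g.eigProj_mem q a))

/-- The subspace `V[g]_n` of degree `n`: it is spanned by the `a(q)` with `a` homogeneous in the
eigenspace of `g` that belongs to `q` and `wt a - q - 1 = n`. -/
def degVg (n : ℚ) : Submodule ℂ g.Vg :=
  Submodule.span ℂ {x | ∃ (k : ℤ) (q : ℚ) (a : V),
    a ∈ wt V k ∧ a ∈ g.eig q ∧ (k : ℚ) - q - 1 = n ∧ x = g.el q a}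

end FiniteOrderAut

end Lie

/-! ### Twisted modules -/

section Modules

open VertexOperatorAlgebra

variable {V : Type u} [AddCommGroup V] [Module ℂ V] [VertexOperatorAlgebra V]

/-- Weak `g`-twisted `V`-modules: `Y v n` is the mode `v_n` of `Y_M(v,z) = ∑_{n ∈ ℚ} v_n z^{-n-1}`.
The twisted Jacobi identity is stated by equating the coefficients of
`z₀^{-l-1} z₁^{-m-1} z₂^{-n-1}`, for `u ∈ V^r` and `m ∈ r/T + ℤ` (which is `u ∈ g.eig m`); for all
other `m` both sides vanish by `support`. -/
structure IsWeakTwisted (g : FiniteOrderAut V) {M : Type*} [AddCommGroup M] [Module ℂ M]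
    (Y : V →ₗ[ℂ] (ℚ → Module.End ℂ M)) : Prop where
  /-- `Y_M(u,z) = ∑_{n ∈ r/T + ℤ} u_n z^{-n-1}` for `u ∈ V^r` -/
  support : ∀ (q : ℚ) (u : V), u ∈ g.eig q → ∀ n : ℚ, (¬∃ k : ℤ, n = q + k) → Y u n = 0
  trunc : ∀ (v : V) (w : M), ∃ N : ℚ, ∀ n, N ≤ n → Y v n w = 0
  vacuum : ∀ n : ℚ, Y vac n = if n = -1 then 1 else 0
  jacobi : ∀ (m : ℚ) (u : V), u ∈ g.eig m → ∀ (v : V) (w : M) (l : ℤ) (n : ℚ),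
    ∑ᶠ i : ℕ, Ring.choose (m : ℂ) i • Y (md u (l + i) v) (m + n - i) w =
    ∑ᶠ i : ℕ, ((-1 : ℂ) ^ i * Ring.choose (l : ℂ) i) •
      (Y u (l + m - i) (Y v (n + i) w) - (-1 : ℂ) ^ l • Y v (l + n - i) (Y u (m + i) w))

/-- Admissible `g`-twisted `V`-modules: weak `g`-twisted modules with a grading
`M = ⨁ M(n)`, `n ∈ (1/T)ℤ_{≥0}`, such that `v_m M(n) ⊆ M(n + wt v - m - 1)`. -/
structure IsAdmissible (g : FiniteOrderAut V) {M : Type*} [AddCommGroup M] [Module ℂ M]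
    (Y : V →ₗ[ℂ] (ℚ → Module.End ℂ M)) (gr : ℚ → Submodule ℂ M) : Prop
    extends IsWeakTwisted g Y where
  gr_support : ∀ q : ℚ, (¬∃ k : ℕ, q = k / g.T) → gr q = ⊥
  gr_internal : DirectSum.IsInternal gr
  gr_mode : ∀ (k : ℤ) (v : V), v ∈ wt V k → ∀ (m n : ℚ) (w : M), w ∈ gr n →
    Y v m w ∈ gr (n + k - m - 1)

/-- The objects of the category of admissible `g`-twisted `V`-modules. -/
structure AdmMod (g : FiniteOrderAut V) where
  carrier : Type u
  [addCommGroup : AddCommGroup carrier]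
  [module : Module ℂ carrier]
  /-- the modes `v_n` -/
  Y : V →ₗ[ℂ] (ℚ → Module.End ℂ carrier)
  /-- the homogeneous subspaces `M(n)` -/
  gr : ℚ → Submodule ℂ carrier
  adm : IsAdmissible g Y gr

attribute [instance] AdmMod.addCommGroup AdmMod.module

variable {g : FiniteOrderAut V}

namespace AdmMod

/-- Morphisms of admissible modules: grade-preserving linear maps that commute with all modes. -/
@[ext]
structure Hom (M N : AdmMod g) where
  toLin : M.carrier →ₗ[ℂ] N.carrier
  map_Y : ∀ (v : V) (n : ℚ) (w : M.carrier), toLin (M.Y v n w) = N.Y v n (toLin w)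
  map_gr : ∀ (n : ℚ) (w : M.carrier), w ∈ M.gr n → toLin w ∈ N.gr n

instance : Category (AdmMod g) where
  Hom M N := Hom M N
  id M := ⟨LinearMap.id, fun _ _ _ => rfl, fun _ _ h => h⟩
  comp f f' := ⟨f'.toLin.comp f.toLin,
    fun v n w => by rw [LinearMap.comp_apply, f.map_Y, f'.map_Y, LinearMap.comp_apply],
    fun n w h => f'.map_gr n _ (f.map_gr n w h)⟩

/-- Graded submodules of an admissible module. -/
structure IsGradedSub (M : AdmMod g) (N : Submodule ℂ M.carrier) : Prop where
  stable : ∀ (v : V) (n : ℚ) (w : M.carrier), w ∈ N → M.Y v n w ∈ N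
  graded : N = ⨆ n : ℚ, N ⊓ M.gr n

/-- A graded submodule `N` that is simple as an admissible module, with the grading normalized
so that `N(0) ≠ 0`. -/
structure IsSimpleSub (M : AdmMod g) (N : Submodule ℂ M.carrier) : Prop where
  isGradedSub : M.IsGradedSub N
  eq_bot_or_eq : ∀ N' : Submodule ℂ M.carrier, M.IsGradedSub N' → N' ≤ N → N' = ⊥ ∨ N' = N
  normalized : N ⊓ M.gr 0 ≠ ⊥

/-- Simple admissible modules, with the grading normalized so that `M(0) ≠ 0`: the only graded
submodules are `0` and `M`. -/
def IsSimple : ObjectProperty (AdmMod g) := fun M => M.IsSimpleSub ⊤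

/-- Completely reducible admissible modules: direct sums of simple graded submodules. -/
def IsCompletelyReducible : ObjectProperty (AdmMod g) := fun M =>
  ∃ S : Set (Submodule ℂ M.carrier), (∀ N ∈ S, M.IsSimpleSub N) ∧
    DirectSum.IsInternal fun N : S => (N : Submodule ℂ M.carrier)

end AdmMod

/-! ### The functor `Ω` -/

section Omega

variable {M : Type*} [AddCommGroup M] [Module ℂ M]

/-- The space of lowest weight vectors `Ω(M) = {w | V[g]_- w = 0}`: the vectors killed by all modes
`v_m` with `v` homogeneous and `deg v_m = wt v - m - 1 < 0`. -/
def Omega (Y : V →ₗ[ℂ] (ℚ → Module.End ℂ M)) : Submodule ℂ M where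
  carrier := {w | ∀ (k : ℤ) (v : V), v ∈ wt V k → ∀ m : ℚ, (k : ℚ) - m - 1 < 0 → Y v m w = 0}
  add_mem' := fun ha hb k v hv m hm => by rw [map_add, ha k v hv m hm, hb k v hv m hm, add_zero]
  zero_mem' := fun _ _ _ _ _ => map_zero _
  smul_mem' := fun c _ ha k v hv m hm => by rw [map_smul, ha k v hv m hm, smul_zero]

/-- `o(a) = a_{wt a - 1}` for homogeneous `a`. -/
def zeroMode (Y : V →ₗ[ℂ] (ℚ → Module.End ℂ M)) : V →ₗ[ℂ] Module.End ℂ M :=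
  homExt fun k : ℤ => (LinearMap.proj ((k : ℚ) - 1)).comp Y

variable {Y : V →ₗ[ℂ] (ℚ → Module.End ℂ M)}

lemma zeroMode_apply {k : ℤ} {a : V} (ha : a ∈ wt V k) : zeroMode Y a = Y a ((k : ℚ) - 1) :=
  homExt_apply _ ha

lemma zeroMode_res (α : ℂ) (l : ℤ) {j k : ℤ} {a b : V} (ha : a ∈ wt V k) (hb : b ∈ wt V j) (w : M) :
    zeroMode Y (resMode α l a b) w =
      ∑ᶠ s : ℕ, Ring.choose α s • Y (md a (l + s) b) ((k : ℚ) + j - l - 2 - s) w := by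
  obtain ⟨N, hN⟩ := md_trunc a b
  rw [resMode_range hN α l (M := (N - l).toNat) (by omega), fs_range (N := (N - l).toNat)]
  · simp only [map_sum, LinearMap.sum_apply, map_smul, LinearMap.smul_apply]
    apply Finset.sum_congr rfl
    intro s _
    rw [zeroMode_apply (md_wt ha hb (l + s)),
      show ((k + j - (l + s) - 1 : ℤ) : ℚ) - 1 = k + j - l - 2 - s by push_cast; ring]
  · intro s hs
    rw [hN _ (by omega)]
    simp

namespace IsWeakTwisted

lemma Y_eigProj (h : IsWeakTwisted g Y) (v : V) (n : ℚ) : Y v n = Y (g.eigProj n v) n := by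
  induction v using g.hom_induction with
  | h0 => simp
  | hadd u v hu hv => simp only [map_add, Pi.add_apply] at *; rw [hu, hv]
  | h k q u _ _ _ hq =>
    by_cases hn : ∃ k : ℤ, n = q + k
    · obtain ⟨z, rfl⟩ := hn
      rw [g.eigProj_of_mem (by rwa [g.eig_add_int])]
    · rw [h.support q u hq n hn, g.eigProj_of_mem_ne hq]
      · simp
      · rintro ⟨z, hz⟩
        exact hn ⟨-z, by push_cast; linarith⟩

lemma comm (h : IsWeakTwisted g Y) {m : ℚ} {u : V} (hu : u ∈ g.eig m) (v : V) (w : M) (n : ℚ) :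
    Y u m (Y v n w) - Y v n (Y u m w) =
      ∑ᶠ i : ℕ, Ring.choose (m : ℂ) i • Y (md u i v) (m + n - i) w := by
  have := h.jacobi m u hu v w 0 n
  simp only [zero_add] at this
  rw [this, fs_range (N := 1)]
  · simp
  · intro i hi
    obtain ⟨j, rfl⟩ : ∃ j, i = j + 1 := ⟨i - 1, by omega⟩
    rw [FiniteOrderAut.choose_int_zero, mul_zero, zero_smul]

lemma zeroMode_of_ne (h : IsWeakTwisted g Y) {k : ℤ} {q : ℚ} {a : V} (ha : a ∈ wt V k) (hq : a ∈ g.eig q) (h0 : 0 < q)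
    (h1 : q < 1) : zeroMode Y a = 0 := by
  rw [zeroMode_apply ha]
  apply h.support q a hq
  rintro ⟨z, hz⟩
  have e : q = ((k - 1 - z : ℤ) : ℚ) := by push_cast; linarith
  rw [e] at h0 h1
  have : (0 : ℤ) < k - 1 - z := by exact_mod_cast h0
  have : k - 1 - z < (1 : ℤ) := by exact_mod_cast h1
  omega

lemma zeroMode_mem (h : IsWeakTwisted g Y) (a : V) {w : M} (hw : w ∈ Omega Y) : zeroMode Y a w ∈ Omega Y := by
  induction a using g.hom_induction with
  | h0 => simp
  | hadd u v hu hv => rw [map_add]; exact Submodule.add_mem _ hu hv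
  | h j q a h0 h1 hj hq =>
    rcases h0.eq_or_lt with rfl | h0
    swap
    · simp [h.zeroMode_of_ne hj hq h0 h1]
    rw [zeroMode_apply hj]
    intro k b hb n hn
    have hb' := g.eigProj_wt n hb
    have hbn := g.eigProj_mem n b
    rw [h.Y_eigProj]
    have e := h.comm hbn a w ((j : ℚ) - 1)
    rw [hw k _ hb' n hn, map_zero, sub_zero] at e
    rw [e]
    apply finsum_eq_zero_of_forall_eq_zero
    intro i
    rw [hw _ _ (md_wt hb' hj i) _ (by push_cast; linarith), smul_zero]

lemma zeroMode_O (h : IsWeakTwisted g Y) {x : V} (hx : x ∈ g.O) {w : M} (hw : w ∈ Omega Y) : zeroMode Y x w = 0 := by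
  induction hx using Submodule.span_induction with
  | zero => simp
  | add x y _ _ hx hy => rw [map_add, LinearMap.add_apply, hx, hy, add_zero]
  | smul r x _ hx => rw [map_smul, LinearMap.smul_apply, hx, smul_zero]
  | mem x hx =>
    obtain ⟨k, q, a, b, h0, h1, hk, hq, rfl⟩ := hx
    induction b using g.hom_induction with
    | h0 => simp [FiniteOrderAut.circ]
    | hadd u v hu hv =>
      rw [FiniteOrderAut.circ] at *
      rw [map_add, map_add, LinearMap.add_apply, hu, hv, add_zero]
    | h j p b hp0 hp1 hj hp =>
      rw [FiniteOrderAut.circ, zeroMode_res _ _ hk hj]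
      have hm : a ∈ g.eig ((k : ℚ) - 1 + FiniteOrderAut.del q + q) := by
        have := g.eig_add_int q (k - 1 + FiniteOrderAut.del q)
        rw [add_comm] at this
        push_cast at this
        rwa [this]
      have e := h.jacobi _ a hm b w (-1 - FiniteOrderAut.del q) ((j : ℚ) - q)
      have e2 : ∀ s : ℕ, (k : ℚ) + j - ((-1 - FiniteOrderAut.del q : ℤ) : ℚ) - 2 - s =
          (k : ℚ) - 1 + FiniteOrderAut.del q + q + (j - q) - s := by
        intro s; push_cast; ring
      simp only [e2]
      push_cast at e
      rw [e]
      apply finsum_eq_zero_of_forall_eq_zero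
      intro i
      have hi : (0 : ℚ) ≤ i := Nat.cast_nonneg i
      have hd : (0 : ℚ) < FiniteOrderAut.del q + q := by
        rcases h0.eq_or_lt with rfl | h0
        · simp [FiniteOrderAut.del]
        · have : (0 : ℚ) ≤ FiniteOrderAut.del q := by exact_mod_cast FiniteOrderAut.del_nonneg q
          linarith
      rw [hw j b hj _ (by linarith), hw k a hk _ (by linarith)]
      simp

lemma zeroMode_star (h : IsWeakTwisted g Y) (a b : V) {w : M} (hw : w ∈ Omega Y) :
    zeroMode Y (g.star a b) w = zeroMode Y a (zeroMode Y b w) := by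
  induction a using g.hom_induction with
  | h0 => simp
  | hadd u v hu hv => simp only [map_add, LinearMap.add_apply, hu, hv]
  | h k q a h0 h1 hk hq =>
  rcases h0.eq_or_lt with rfl | h0
  swap
  · rw [h.zeroMode_of_ne hk hq h0 h1, FiniteOrderAut.star_of_ne hq h0 h1]
    simp
  induction b using g.hom_induction with
  | h0 => simp
  | hadd u v hu hv => simp only [map_add, LinearMap.add_apply, hu, hv]
  | h j p b _ _ hj _ =>
    rw [FiniteOrderAut.star_apply hk hq, zeroMode_res _ _ hk hj, zeroMode_apply hk,
      zeroMode_apply hj]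
    have hm : a ∈ g.eig (k : ℚ) := by
      have := g.eig_add_int 0 k
      rw [zero_add] at this
      rwa [this]
    have e := h.jacobi _ a hm b w (-1) ((j : ℚ) - 1)
    have e2 : ∀ s : ℕ, (k : ℚ) + j - ((-1 : ℤ) : ℚ) - 2 - s = (k : ℚ) + (j - 1) - s := by
      intro s; push_cast; ring
    simp only [e2]
    push_cast at e
    rw [e, fs_range (N := 1)]
    · have h2 : Y a ((k : ℚ) + (0 : ℕ)) w = 0 := hw k a hk _ (by simp)
      rw [Finset.sum_range_one, h2]
      simp only [Nat.cast_zero, add_zero, sub_zero, map_zero, smul_zero, pow_zero,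
        Ring.choose_zero_right, mul_one, one_smul]
      rw [show (-1 : ℚ) + k = k - 1 by ring]
    · intro i hi
      have hi' : (1 : ℚ) ≤ i := by exact_mod_cast hi
      rw [hw j b hj _ (by linarith), hw k a hk _ (by linarith)]
      simp

end IsWeakTwisted

end Omega

namespace AdmMod

/-- The space `Ω(M)` of an admissible module `M`. -/
def Om (M : AdmMod g) : Type u := Omega M.Y

instance (M : AdmMod g) : AddCommGroup M.Om := inferInstanceAs (AddCommGroup (Omega M.Y))

instance (M : AdmMod g) : Module ℂ M.Om := inferInstanceAs (Module ℂ (Omega M.Y))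

/-- `a ↦ o(a)` as a map `V → End Ω(M)`. -/
def omV (M : AdmMod g) : V →ₗ[ℂ] Module.End ℂ M.Om where
  toFun a := (zeroMode M.Y a).restrict fun _ hw => M.adm.zeroMode_mem a hw
  map_add' a b := by
    ext w
    change zeroMode M.Y (a + b) w.1 = zeroMode M.Y a w.1 + zeroMode M.Y b w.1
    rw [map_add, LinearMap.add_apply]
  map_smul' c a := by
    ext w
    change zeroMode M.Y (c • a) w.1 = c • zeroMode M.Y a w.1
    rw [map_smul, LinearMap.smul_apply]

/-- The representation `a + O_g(V) ↦ o(a)` of `A_g(V)` on `Ω(M)`. -/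
def omA (M : AdmMod g) : g.A →ₐ[ℂ] Module.End ℂ M.Om :=
  AlgHom.ofLinearMap
    (g.O.liftQ M.omV fun x hx => by
      ext w
      exact Subtype.ext (M.adm.zeroMode_O hx w.2))
    (by
      change M.omV vac = 1
      ext w
      apply Subtype.ext
      change zeroMode M.Y vac w.1 = w.1
      rw [zeroMode_apply FiniteOrderAut.vac_wt, M.adm.vacuum, if_pos (by norm_num)]
      rfl)
    (by
      intro x y
      obtain ⟨a, rfl⟩ := g.toA_surjective x
      obtain ⟨b, rfl⟩ := g.toA_surjective y
      rw [g.toA_mul]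
      change M.omV (g.star a b) = M.omV a * M.omV b
      ext w
      exact Subtype.ext (M.adm.zeroMode_star a b w.2))

instance (M : AdmMod g) : Module g.A M.Om := Module.compHom M.Om M.omA.toRingHom

lemma toA_smul (M : AdmMod g) (a : V) (w : M.Om) : (g.toA a • w).1 = zeroMode M.Y a w.1 := rfl

lemma Hom.map_zeroMode {M N : AdmMod g} (f : Hom M N) (a : V) (w : M.carrier) :
    f.toLin (zeroMode M.Y a w) = zeroMode N.Y a (f.toLin w) := by
  induction a using g.hom_induction with
  | h0 => simp
  | hadd u v hu hv => simp only [map_add, LinearMap.add_apply, hu, hv]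
  | h k q a _ _ hk _ => rw [zeroMode_apply hk, zeroMode_apply hk, f.map_Y]

/-- The restriction of a morphism `M → N` to `Ω(M) → Ω(N)`. -/
def Hom.om {M N : AdmMod g} (f : Hom M N) : M.Om →ₗ[g.A] N.Om where
  toFun w := ⟨f.toLin w.1, fun k v hv m hm => by
    rw [← f.map_Y, w.2 k v hv m hm, map_zero]⟩
  map_add' w w' := Subtype.ext (map_add f.toLin w.1 w'.1)
  map_smul' x w := by
    obtain ⟨a, rfl⟩ := g.toA_surjective x
    apply Subtype.ext
    exact f.map_zeroMode a w.1

end AdmMod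

variable (g) in
/-- The functor `Ω` from admissible `g`-twisted `V`-modules to `A_g(V)`-modules. -/
def OmegaFunctor : AdmMod g ⥤ ModuleCat.{u} g.A where
  obj M := ModuleCat.of g.A M.Om
  map f := ModuleCat.ofHom (AdmMod.Hom.om f)
  map_id _ := rfl
  map_comp _ _ := rfl

end Modules

/-! ### The functor `L` -/

section Verma

open VertexOperatorAlgebra TensorProduct

open scoped ModuleCat

variable {V : Type u} [AddCommGroup V] [Module ℂ V] [VertexOperatorAlgebra V]

variable (g : FiniteOrderAut V)

/-- The universal enveloping algebra `U(V[g])`. -/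
abbrev UE : Type u := UniversalEnvelopingAlgebra ℂ g.Vg

/-- The subspace of degree `n` of `U(V[g])`, spanned by the products `y₁ ⋯ y_k` with
`y_i ∈ V[g]_{n_i}` and `n₁ + ⋯ + n_k = n`. -/
def degUE (n : ℚ) : Submodule ℂ (UE g) :=
  Submodule.span ℂ {x | ∃ l : List (ℚ × g.Vg), (∀ p ∈ l, p.2 ∈ g.degVg p.1) ∧
    (l.map Prod.fst).sum = n ∧
    x = (l.map fun p => UniversalEnvelopingAlgebra.ι ℂ p.2).prod}

variable {g}

/-- The relations of the induced module: `V[g]_-` annihilates `U`, and `o(a) = a(wt a - 1)` acts on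
`U` as `a + O_g(V) ∈ A_g(V)`, for homogeneous `a ∈ V^0`. -/
def relM (U : ModuleCat.{u} g.A) : Submodule (UE g) (UE g ⊗[ℂ] U) :=
  Submodule.span (UE g)
    ({x | ∃ (n : ℚ) (y : g.Vg) (u : U), n < 0 ∧ y ∈ g.degVg n ∧
        x = UniversalEnvelopingAlgebra.ι ℂ y ⊗ₜ u} ∪
     {x | ∃ (k : ℤ) (a : V) (u : U), a ∈ wt V k ∧ a ∈ g.eig 0 ∧
        x = UniversalEnvelopingAlgebra.ι ℂ (g.el ((k : ℚ) - 1) a) ⊗ₜ u - 1 ⊗ₜ (g.toA a • u)})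

/-- The induced module `M(U) = U(V[g]) ⊗_{U(P)} U`, `P = V[g]_- ⊕ V[g]_0`, where `V[g]_-` acts on `U`
by `0` and `V[g]_0`, which is spanned by the `o(a)`, acts through `A_g(V)`: the quotient of
`U(V[g]) ⊗_ℂ U` by the relations `x y ⊗ u = x ⊗ y u` for `y ∈ P`. -/
abbrev MU (U : ModuleCat.{u} g.A) : Type u := (UE g ⊗[ℂ] U) ⧸ relM U

/-- The homogeneous subspace `M(U)(n)`. -/
def grM (U : ModuleCat.{u} g.A) (n : ℚ) : Submodule ℂ (MU U) :=
  Submodule.span ℂ {w | ∃ x ∈ degUE g n, ∃ u : U, w = (relM U).mkQ (x ⊗ₜ u)}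

/-- The image of `U` in `M(U)`. -/
def imU (U : ModuleCat.{u} g.A) : Submodule ℂ (MU U) :=
  Submodule.span ℂ {w | ∃ u : U, w = (relM U).mkQ (1 ⊗ₜ u)}

/-- `J`, the largest graded `V[g]`-submodule of `M(U)` with `J ∩ U = 0`. -/
def JU (U : ModuleCat.{u} g.A) : Submodule (UE g) (MU U) :=
  sSup {N | N.restrictScalars ℂ = ⨆ n : ℚ, N.restrictScalars ℂ ⊓ grM U n ∧
    N.restrictScalars ℂ ⊓ imU U = ⊥}

/-- `L(U) = M(U) / J`. -/
abbrev LU (U : ModuleCat.{u} g.A) : Type u := MU U ⧸ JU U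

/-- The modes on `L(U)`: `v_q` acts as `v(q) ∈ V[g]`. -/
def LY (U : ModuleCat.{u} g.A) : V →ₗ[ℂ] (ℚ → Module.End ℂ (LU U)) :=
  LinearMap.pi fun q =>
    { toFun := fun v => Algebra.lsmul ℂ ℂ (LU U) (UniversalEnvelopingAlgebra.ι ℂ (g.el q v))
      map_add' := fun v v' => by rw [map_add, map_add, map_add]
      map_smul' := fun c v => by rw [map_smul, map_smul, map_smul, RingHom.id_apply] }

/-- The grading of `L(U)` induced from `M(U)`. -/
def Lgr (U : ModuleCat.{u} g.A) (n : ℚ) : Submodule ℂ (LU U) :=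
  (grM U n).map ((JU U).mkQ.restrictScalars ℂ)

/-- The map `M(U) → M(U')` induced by `f : U → U'`. -/
def mapM {U U' : ModuleCat.{u} g.A} (f : U ⟶ U') : MU U →ₗ[UE g] MU U' :=
  (relM U).mapQ (relM U')
    (TensorProduct.AlgebraTensorModule.lTensor (UE g) (UE g) (f.hom.restrictScalars ℂ))
    (by
      rw [relM, Submodule.span_le]
      rintro x (⟨n, y, u, hn, hy, rfl⟩ | ⟨k, a, u, hk, ha, rfl⟩)
      · exact Submodule.subset_span (Or.inl ⟨n, y, f.hom u, hn, hy, rfl⟩)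
      · refine Submodule.subset_span (Or.inr ⟨k, a, f.hom u, hk, ha, ?_⟩)
        rw [← map_smul, map_sub]
        rfl)

variable (g) in
/-- `L` is a well-defined functor to admissible modules: every `L(U)` is an admissible `g`-twisted
`V`-module, and `M(U) → M(U')` induces `L(U) → L(U')` for every `U → U'`. -/
structure LWellDefined : Prop where
  adm : ∀ U : ModuleCat.{u} g.A, IsAdmissible g (LY U) (Lgr U)
  map_J : ∀ (U U' : ModuleCat.{u} g.A) (f : U ⟶ U'), JU U ≤ (JU U').comap (mapM f)

lemma mapM_gr {U U' : ModuleCat.{u} g.A} (f : U ⟶ U') (n : ℚ) {w : MU U} (hw : w ∈ grM U n) :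
    mapM f w ∈ grM U' n := by
  have : grM U n ≤ (grM U' n).comap ((mapM f).restrictScalars ℂ) := by
    rw [grM, Submodule.span_le]
    rintro _ ⟨x, hx, u, rfl⟩
    exact Submodule.subset_span ⟨x, hx, f.hom u, rfl⟩
  exact this hw

lemma mapM_id (U : ModuleCat.{u} g.A) (w : MU U) : mapM (𝟙 U) w = w := by
  obtain ⟨w, rfl⟩ := (relM U).mkQ_surjective w
  induction w with
  | zero => simp
  | add x y hx hy => rw [map_add, map_add, hx, hy]
  | tmul x u => rfl

lemma mapM_comp {U U' U'' : ModuleCat.{u} g.A} (f : U ⟶ U') (f' : U' ⟶ U'') (w : MU U) :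
    mapM (f ≫ f') w = mapM f' (mapM f w) := by
  obtain ⟨w, rfl⟩ := (relM U).mkQ_surjective w
  induction w with
  | zero => simp
  | add x y hx hy => rw [map_add, map_add, hx, hy, map_add, map_add]
  | tmul x u => rfl

/-- The functor `L` from `A_g(V)`-modules to admissible `g`-twisted `V`-modules. -/
def LFunctor (h : LWellDefined g) : ModuleCat.{u} g.A ⥤ AdmMod g where
  obj U := { carrier := LU U, Y := LY U, gr := Lgr U, adm := h.adm U }
  map {U U'} f :=
    { toLin := ((JU U).mapQ (JU U') (mapM f) (h.map_J U U' f)).restrictScalars ℂ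
      map_Y := fun v n w =>
        ((JU U).mapQ (JU U') (mapM f) (h.map_J U U' f)).map_smul
          (UniversalEnvelopingAlgebra.ι ℂ (g.el n v)) w
      map_gr := by
        rintro n _ ⟨w, hw, rfl⟩
        exact ⟨mapM f w, mapM_gr f n hw, rfl⟩ }
  map_id U := by
    apply AdmMod.Hom.ext
    apply LinearMap.ext
    intro w
    obtain ⟨w, rfl⟩ := (JU U).mkQ_surjective w
    exact congrArg (JU U).mkQ (mapM_id U w)
  map_comp {U U' U''} f f' := by
    apply AdmMod.Hom.ext
    apply LinearMap.ext
    intro w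
    obtain ⟨w, rfl⟩ := (JU U).mkQ_surjective w
    exact congrArg (JU U'').mkQ (mapM_comp f f' w)

end Verma

/-! ### Full subcategories -/

section Restrict

universe v₁ v₂ u₁ u₂

variable {C : Type u₁} [Category.{v₁} C] {D : Type u₂} [Category.{v₂} D]

/-- The restriction of a functor to full subcategories. -/
def restrictFunctor (F : C ⥤ D) (P : ObjectProperty C) (Q : ObjectProperty D)
    (h : ∀ X, P X → Q (F.obj X)) : P.FullSubcategory ⥤ Q.FullSubcategory :=
  Q.lift (P.ι ⋙ F) fun X => h X.obj X.property

/-- The map induced by a functor on isomorphism classes of objects. -/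
def isoClassMap (F : C ⥤ D) : Quotient (isIsomorphicSetoid C) → Quotient (isIsomorphicSetoid D) :=
  Quotient.map F.obj fun _ _ ⟨e⟩ => ⟨F.mapIso e⟩

variable {V : Type u} [AddCommGroup V] [Module ℂ V] [VertexOperatorAlgebra V]

/-- Completely reducible `A_g(V)`-modules. -/
def completelyReducibleA (g : FiniteOrderAut V) : ObjectProperty (ModuleCat.{u} g.A) :=
  fun U => IsSemisimpleModule g.A U

/-- Simple `A_g(V)`-modules. -/
def simpleA (g : FiniteOrderAut V) : ObjectProperty (ModuleCat.{u} g.A) :=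
  fun U => IsSimpleModule g.A U

end Restrict


end TwistedVOA

end

/-! An admissible twisted module is the same thing as a graded `V[g]`-module without negative
degrees on which the twisted Jacobi identity holds and `1(-1)` acts as the identity (`AdmMod.rep`
gives one direction). The notion that carries the argument is `IsTight`: the module is generated by
its part of degree `0`, and every nonzero graded submodule meets degree `0`. A subspace of positive
degree that is stable under `V[g]_- ⊕ V[g]_0` generates a submodule of positive degree
(`IsGrRep.gen_pos`), and in a tight module this submodule is zero. Applied to lowest weight vectors,
the principle shows that they all have degree `0` (`IsGrRep.lowest_eq`), so that `Ω(M) = M(0)`.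
Applied to the failure of the Jacobi identity, it shows that the identity holds.

`L(U)` is tight by the maximality of `J`, and its part of degree `0` is `U`. The second point needs
that `U` embeds into `M(U)`. Modulo `O_g(V)` the commutator `[a][b] - [b][a]` is `∑ C(wt a - 1, i)
[a_i b]` (`toA_commutator`), and `(L(-1) + L(0)) a` vanishes (`deriv_add_mem_O`). Hence `a(wt a - 1)
↦ a + O_g(V)` defines a representation of `V[g]_- ⊕ V[g]_0` through `A_g(V)` (`rho_lie`), and
induction from a subalgebra with a linear complement is faithful on `U` (`exists_induced`, an
argument of Poincaré–Birkhoff–Witt type). The degree on `M(U)` and `L(U)` is an eigenvalue: it is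
the action of `ω(1)` minus the endomorphism induced by the class of `ω`, which is central in
`A_g(V)`.

For the Jacobi identity on `L(U)`, let the defect be the difference of its two sides. The bracket of
`V[g]` gives the case in which the exponent `l` of `z₀` is `0`. Multiplication by `z₀ = z₁ - z₂`
raises `l`, and `L(-1)`-derivatives lower it from `-1` on, so only `l = -1` remains
(`defect_eq_zero`). The commutator of a mode `c_p` with a defect is again a sum of defects
(`comm_defect`). On vectors of degree `0` the component of degree `0` of the defect vanishes: after
a shift of the exponents it says `o(a * b) = o(a) o(b)` if `a ∈ V^0`, and `o(a ∘ b) = 0` if `a ∈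
V^r` with `r > 0` (`IsGrRep.defect_zero_of_deg`). Hence the defects on degree `0` have positive
degree and are stable under `V[g]_- ⊕ V[g]_0`; tightness kills them, and `comm_defect` spreads the
identity to the whole module (`IsGrRep.isWeakTwisted`).

Simple and completely reducible admissible modules are tight (`IsSimple.tight`,
`IsCompletelyReducible.tight`); this is where the normalization of the gradings enters. For tight
`M`, a submodule `W` of `Ω(M)` generates a graded submodule whose part of degree `0` is again `W`,
and tightness controls graded submodules by their degree `0`. Therefore simplicity and complete
reducibility pass between `M` and `Ω(M)`. Finally `U ≅ Ω(L(U))` for every `U`, and for tight `M` the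
canonical map `M(Ω(M)) → M` is onto with kernel exactly `J` (`counitM_eq_zero`), so that `L(Ω(M)) ≅
M`. Both isomorphisms are natural. -/

noncomputable section

set_option linter.unusedSectionVars false

namespace TwistedVOA

/-! ### Induced modules of Lie algebras -/

namespace LieInduction

variable {k L I I' U : Type*} [Field k] [LieRing L] [LieAlgebra k L] [LinearOrder I]
  [AddCommGroup U] [Module k U]

/-- The underlying space of the induced module: `U`-valued polynomials in the variables `I`. -/
abbrev Poly (I U : Type*) [AddCommGroup U] : Type _ := Multiset I →₀ U

/-- `t` precedes the basis element `x`; all elements of `I'` come after those of `I`. -/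
def Prec (t : I) : I ⊕ I' → Prop := Sum.elim (fun i => t < i) fun _ => True

/-- The leading term of the action of `L`: multiplication by the variables. -/
def mulL (b : Module.Basis (I ⊕ I') k L) : L →ₗ[k] Module.End k (Poly I U) :=
  b.constr k (Sum.elim (fun i => Finsupp.lmapDomain U k fun T => i ::ₘ T) fun _ => 0)

variable (b : Module.Basis (I ⊕ I') k L) (ρ : L →ₗ[k] Module.End k U)

open Classical in
/-- One step of the recursion for the lower terms of the action. -/
def stepLow (F : L →ₗ[k] Module.End k (Poly I U)) : L →ₗ[k] Module.End k (Poly I U) :=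
  b.constr k fun x => Finsupp.lsum k fun T =>
    match T.sort (· ≤ ·) with
    | [] => (Finsupp.lsingle 0).comp (ρ (b x))
    -- This branch encodes `x t S = t (x S) + [x, t] S`. The leading part of `t (x S)` is the
    -- monomial `z_t z_x z_S`, which `mulL` already supplies, so only `t` applied to the lower part
    -- of `x S` and the bracket term are kept. If `x` does not come after `t`, then `x t S` is
    -- already ordered and has no lower terms.
    | t :: S => if Prec t x then
        ((mulL b (b (.inl t)) + F (b (.inl t))) * F (b x) +
          (mulL b ⁅b x, b (.inl t)⁆ + F ⁅b x, b (.inl t)⁆)).comp (Finsupp.lsingle (S : Multiset I))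
        else 0

/-- The approximations of the lower terms of the action. -/
def lowN : ℕ → L →ₗ[k] Module.End k (Poly I U)
  | 0 => 0
  | n + 1 => stepLow b ρ (lowN n)

lemma mulL_inl (i : I) (T : Multiset I) (u : U) :
    mulL b (b (.inl i)) (Finsupp.single T u) = Finsupp.single (i ::ₘ T) u := by
  simp [mulL]

lemma mulL_inr (i : I') : mulL (U := U) b (b (.inr i)) = 0 := by
  simp [mulL]

lemma stepLow_zero (F : L →ₗ[k] Module.End k (Poly I U)) (x : I ⊕ I') (u : U) :
    stepLow b ρ F (b x) (Finsupp.single 0 u) = Finsupp.single 0 (ρ (b x) u) := by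
  simp [stepLow]

-- A minimal variable stands at the head of the sorted list, so the recursion always removes the
-- smallest variable.
open Classical in
lemma stepLow_cons (F : L →ₗ[k] Module.End k (Poly I U)) (x : I ⊕ I') {t : I} {S : Multiset I}
    (h : ∀ s ∈ S, t ≤ s) (u : U) :
    stepLow b ρ F (b x) (Finsupp.single (t ::ₘ S) u) = if Prec t x then
      (mulL b (b (.inl t)) (F (b x) (Finsupp.single S u)) +
        F (b (.inl t)) (F (b x) (Finsupp.single S u))) +
      (mulL b ⁅b x, b (.inl t)⁆ (Finsupp.single S u) + F ⁅b x, b (.inl t)⁆ (Finsupp.single S u))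
      else 0 := by
  simp only [stepLow, Module.Basis.constr_basis, Finsupp.lsum_single]
  rw [Multiset.sort_cons _ _ (r := (· ≤ ·)) (by simpa using h)]
  change (if Prec t x then _ else 0 : U →ₗ[k] Poly I U) u = _
  split_ifs with hx
  · simp
  · simp

/-- The polynomials of degree at most `d`. -/
def degLE (I : Type*) (k U : Type*) [Field k] [AddCommGroup U] [Module k U] (d : ℕ) :
    Submodule k (Poly I U) :=
  Submodule.span k {w | ∃ (T : Multiset I) (u : U), T.card ≤ d ∧ w = Finsupp.single T u}

lemma single_mem_degLE {d : ℕ} {T : Multiset I} (h : T.card ≤ d) (u : U) :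
    Finsupp.single T u ∈ degLE I k U d := Submodule.subset_span ⟨T, u, h, rfl⟩

lemma degLE_mono {d e : ℕ} (h : d ≤ e) : degLE I k U d ≤ degLE I k U e :=
  Submodule.span_mono fun _ ⟨T, u, hT, hw⟩ => ⟨T, u, hT.trans h, hw⟩

@[elab_as_elim]
lemma basis_induction {ι : Type*} (b : Module.Basis ι k L) {p : L → Prop} (zero : p 0)
    (add : ∀ x y, p x → p y → p (x + y)) (smul : ∀ (c : k) x, p x → p (c • x))
    (mem : ∀ i, p (b i)) (y : L) : p y := by
  have hy : y ∈ Submodule.span k (Set.range b) := by rw [b.span_eq]; trivial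
  induction hy using Submodule.span_induction with
  | zero => exact zero
  | add x y _ _ hx hy => exact add x y hx hy
  | smul c x _ hx => exact smul c x hx
  | mem x hx => obtain ⟨i, rfl⟩ := hx; exact mem i

/-- A linear statement about `F x w`, `w` of degree at most `d`, may be checked on monomials and
basis elements. -/
lemma eq_on_degLE {F G : L →ₗ[k] Module.End k (Poly I U)} {d : ℕ}
    (h : ∀ x (T : Multiset I) u, T.card ≤ d →
      F (b x) (Finsupp.single T u) = G (b x) (Finsupp.single T u)) (y : L) {w : Poly I U}
    (hw : w ∈ degLE I k U d) : F y w = G y w := by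
  induction hw using Submodule.span_induction with
  | zero => simp
  | add v w _ _ hv hw => rw [map_add, map_add, hv, hw]
  | smul c w _ hw => rw [map_smul, map_smul, hw]
  | mem w hw =>
    obtain ⟨T, u, hT, rfl⟩ := hw
    have : F.flip (Finsupp.single T u) = G.flip (Finsupp.single T u) :=
      b.ext fun x => h x T u hT
    exact LinearMap.congr_fun this y

lemma map_degLE {F : L →ₗ[k] Module.End k (Poly I U)} {d e : ℕ}
    (h : ∀ x (T : Multiset I) u, T.card ≤ d → F (b x) (Finsupp.single T u) ∈ degLE I k U e)
    (y : L) {w : Poly I U} (hw : w ∈ degLE I k U d) : F y w ∈ degLE I k U e := by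
  induction hw using Submodule.span_induction with
  | zero => simp
  | add v w _ _ hv hw => rw [map_add]; exact Submodule.add_mem _ hv hw
  | smul c w _ hw => rw [map_smul]; exact Submodule.smul_mem _ _ hw
  | mem w hw =>
    obtain ⟨T, u, hT, rfl⟩ := hw
    induction y using basis_induction b with
    | zero => simp
    | add y z hy hz =>
      rw [map_add]; exact Submodule.add_mem _ hy hz
    | smul c y hy => rw [map_smul]; exact Submodule.smul_mem _ _ hy
    | mem x => exact h x T u hT

lemma mulL_degLE (y : L) {d : ℕ} {w : Poly I U} (hw : w ∈ degLE I k U d) :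
    mulL b y w ∈ degLE I k U (d + 1) := by
  refine map_degLE b (fun x T u hT => ?_) y hw
  rcases x with i | i
  · rw [mulL_inl]
    exact single_mem_degLE (by simpa using hT) u
  · simp [mulL_inr]

lemma exists_min_cons (T : Multiset I) : T = 0 ∨ ∃ t S, T = t ::ₘ S ∧ ∀ s ∈ S, t ≤ s := by
  rcases h : T.sort (· ≤ ·) with _ | ⟨t, S⟩
  · left
    rw [← Multiset.sort_eq T (· ≤ ·), h]; rfl
  · right
    refine ⟨t, S, ?_, ?_⟩
    · rw [← Multiset.sort_eq T (· ≤ ·), h]; rfl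
    · have := Multiset.pairwise_sort T (· ≤ ·)
      rw [h, List.pairwise_cons] at this
      simpa using this.1

/-- The recursion passes from `z_t z_S` to `z_S`, which loses one degree, and at most one
multiplication by a variable restores it. This is what makes the recursion well founded: inside it,
the lower terms are applied to outputs of lower terms. -/
lemma lowN_degLE (n : ℕ) : ∀ (y : L) (d : ℕ) {w : Poly I U}, w ∈ degLE I k U d →
    lowN b ρ n y w ∈ degLE I k U d := by
  induction n with
  | zero => intro y d w _; simp [lowN]
  | succ n ih =>
    intro y d w hw
    refine map_degLE b (fun x T u hT => ?_) y hw
    rcases exists_min_cons T with rfl | ⟨t, S, rfl, hS⟩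
    · rw [lowN, stepLow_zero]
      exact single_mem_degLE (by simp) _
    · rw [lowN, stepLow_cons b ρ _ x hS]
      rw [Multiset.card_cons] at hT
      obtain ⟨e, rfl⟩ : ∃ e, d = e + 1 := ⟨d - 1, by omega⟩
      have h1 : Finsupp.single S u ∈ degLE I k U e := single_mem_degLE (by omega) u
      split_ifs
      · exact Submodule.add_mem _
          (Submodule.add_mem _ (mulL_degLE b _ (ih _ _ h1))
            (degLE_mono (by omega) (ih _ _ (ih _ _ h1))))
          (Submodule.add_mem _ (mulL_degLE b _ h1) (degLE_mono (by omega) (ih _ _ h1)))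
      · exact Submodule.zero_mem _

/-- One unfolding reduces degree `d` to degree `d - 1`, so `n` steps settle all degrees below `n`.
-/
lemma lowN_stable (n : ℕ) : ∀ (d : ℕ), d < n → ∀ (y : L) {w : Poly I U}, w ∈ degLE I k U d →
    lowN b ρ (n + 1) y w = lowN b ρ n y w := by
  induction n with
  | zero => intro d hd; omega
  | succ n ih =>
    intro d hd y w hw
    refine eq_on_degLE b (fun x T u hT => ?_) y hw
    rcases exists_min_cons T with rfl | ⟨t, S, rfl, hS⟩
    · rw [lowN, lowN, stepLow_zero, stepLow_zero]
    · rw [lowN, lowN, stepLow_cons b ρ _ x hS, stepLow_cons b ρ _ x hS]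
      rw [Multiset.card_cons] at hT
      have h1 : Finsupp.single S u ∈ degLE I k U (d - 1) := single_mem_degLE (by omega) u
      rw [← lowN, ih (d - 1) (by omega) _ h1, ih (d - 1) (by omega) _ h1,
        ih (d - 1) (by omega) _ (lowN_degLE b ρ n _ _ h1)]

/-- The lower terms of the action of `L`. -/
def low : L →ₗ[k] Module.End k (Poly I U) :=
  (Finsupp.lsum k).toLinearMap.comp <| LinearMap.pi fun T =>
    -- On monomials of degree `T.card` the approximations are constant from index `T.card + 1` on.
    (LinearMap.lcomp k _ (Finsupp.lsingle T)).comp (lowN b ρ (T.card + 1))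

lemma low_single (y : L) (T : Multiset I) (u : U) :
    low b ρ y (Finsupp.single T u) = lowN b ρ (T.card + 1) y (Finsupp.single T u) := by
  simp [low]

lemma lowN_eq {n d : ℕ} (hd : d < n) (y : L) {w : Poly I U} (hw : w ∈ degLE I k U d) :
    low b ρ y w = lowN b ρ n y w := by
  refine eq_on_degLE b (fun x T u hT => ?_) y hw
  rw [low_single]
  have : ∀ m, lowN b ρ (T.card + 1 + m) (b x) (Finsupp.single T u) =
      lowN b ρ (T.card + 1) (b x) (Finsupp.single T u) := by
    intro m
    induction m with
    | zero => rfl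
    | succ m ih =>
      rw [← add_assoc, lowN_stable b ρ _ T.card (by omega) _ (single_mem_degLE le_rfl u), ih]
  obtain ⟨m, rfl⟩ := Nat.exists_eq_add_of_le (show T.card + 1 ≤ n by omega)
  exact (this m).symm

/-- The action of `L` on the induced module. -/
def act : L →ₗ[k] Module.End k (Poly I U) := mulL b + low b ρ

lemma act_apply (y : L) (w : Poly I U) : act b ρ y w = mulL b y w + low b ρ y w := rfl

lemma low_degLE (y : L) {d : ℕ} {w : Poly I U} (hw : w ∈ degLE I k U d) :
    low b ρ y w ∈ degLE I k U d := by
  rw [lowN_eq b ρ (Nat.lt_succ_self d) y hw]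
  exact lowN_degLE b ρ _ y d hw

lemma low_zero (y : L) (u : U) : low b ρ y (Finsupp.single 0 u) = Finsupp.single 0 (ρ y u) := by
  have : (low b ρ).flip (Finsupp.single 0 u) = (Finsupp.lsingle 0).comp (ρ.flip u) := by
    refine b.ext fun x => ?_
    change low b ρ (b x) (Finsupp.single 0 u) = Finsupp.single 0 (ρ (b x) u)
    rw [low_single, lowN, stepLow_zero]
  exact LinearMap.congr_fun this y

lemma low_cons {x : I ⊕ I'} {t : I} {S : Multiset I} (hS : ∀ s ∈ S, t ≤ s) (hx : Prec t x) (u : U) :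
    low b ρ (b x) (Finsupp.single (t ::ₘ S) u) =
      act b ρ (b (.inl t)) (low b ρ (b x) (Finsupp.single S u)) +
        act b ρ ⁅b x, b (.inl t)⁆ (Finsupp.single S u) := by
  have h1 : Finsupp.single S u ∈ degLE I k U S.card := single_mem_degLE le_rfl u
  rw [low_single, lowN, stepLow_cons b ρ _ x hS, if_pos hx, act_apply, act_apply,
    lowN_eq b ρ (n := S.card + 1) (by omega) _ h1, lowN_eq b ρ (n := S.card + 1) (by omega) _ h1,
    lowN_eq b ρ (n := S.card + 1) (by omega) _ (lowN_degLE b ρ _ _ _ h1), Multiset.card_cons]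

lemma low_cons_le {i t : I} {S : Multiset I} (hS : ∀ s ∈ S, t ≤ s) (hx : i ≤ t) (u : U) :
    low b ρ (b (.inl i)) (Finsupp.single (t ::ₘ S) u) = 0 := by
  rw [low_single, lowN, stepLow_cons b ρ _ _ hS, if_neg]
  simpa [Prec] using hx

/-- `x_i z_T = z_i z_T` if `i ≤ T`, up to the action on `U` if `T` is empty. -/
lemma act_inl {i : I} {T : Multiset I} (hT : ∀ s ∈ T, i ≤ s) (hρ : ∀ i, ρ (b (.inl i)) = 0)
    (u : U) : act b ρ (b (.inl i)) (Finsupp.single T u) = Finsupp.single (i ::ₘ T) u := by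
  rw [act_apply, mulL_inl]
  rcases exists_min_cons T with rfl | ⟨t, S, rfl, hS⟩
  · rw [low_zero, hρ]; simp
  · rw [low_cons_le b ρ hS (hT t (by simp)), add_zero]

/-- The commutation relation for a fixed vector `w`. -/
def Comm (w : Poly I U) : Prop := ∀ y z : L,
  act b ρ y (act b ρ z w) - act b ρ z (act b ρ y w) = act b ρ ⁅y, z⁆ w

lemma comm_of_basis {w : Poly I U} (h : ∀ x y : I ⊕ I', act b ρ (b x) (act b ρ (b y) w) -
    act b ρ (b y) (act b ρ (b x) w) = act b ρ ⁅b x, b y⁆ w) : Comm b ρ w := by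
  intro y z
  induction y using basis_induction b with
  | zero => simp
  | add y y' hy hy' =>
    simp only [add_lie, map_add, LinearMap.add_apply, ← hy, ← hy']
    abel
  | smul c y hy =>
    simp only [smul_lie, map_smul, LinearMap.smul_apply, ← hy, smul_sub]
  | mem x =>
    induction z using basis_induction b with
    | zero => simp
    | add y y' hy hy' =>
      simp only [lie_add, map_add, LinearMap.add_apply, ← hy, ← hy']
      abel
    | smul c y hy =>
      simp only [lie_smul, map_smul, LinearMap.smul_apply, ← hy, smul_sub]
    | mem y => exact h x y

lemma comm_add {v w : Poly I U} (hv : Comm b ρ v) (hw : Comm b ρ w) : Comm b ρ (v + w) := by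
  intro y z
  have h1 := hv y z
  have h2 := hw y z
  simp only [map_add] at *
  rw [← h1, ← h2]; abel

lemma comm_degLE {d : ℕ} (h : ∀ (T : Multiset I) (u : U), T.card ≤ d →
    Comm b ρ (Finsupp.single T u)) {w : Poly I U} (hw : w ∈ degLE I k U d) : Comm b ρ w := by
  induction hw using Submodule.span_induction with
  | zero => intro y z; simp
  | add v w _ _ hv hw => exact comm_add b ρ hv hw
  | smul c w _ hw =>
    intro y z
    have := hw y z
    simp only [map_smul, ← this, smul_sub]
  | mem w hw => obtain ⟨T, u, hT, rfl⟩ := hw; exact h T u hT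

/-! ### The commutation relation, by induction on the degree -/

variable (hρ : ∀ i, ρ (b (.inl i)) = 0)

include hρ in
/-- The commutation relation for `x_i`, `i ≤ T`, and a later basis element. -/
lemma comm_prec {i : I} {x : I ⊕ I'} {T : Multiset I} (hT : ∀ s ∈ T, i ≤ s) (hx : Prec i x) (u : U) :
    act b ρ (b x) (act b ρ (b (.inl i)) (Finsupp.single T u)) -
      act b ρ (b (.inl i)) (act b ρ (b x) (Finsupp.single T u)) =
    act b ρ ⁅b x, b (.inl i)⁆ (Finsupp.single T u) := by
  rw [act_inl b ρ hT hρ, act_apply b ρ (b x), act_apply b ρ (b x), map_add, low_cons b ρ hT hx]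
  have : act b ρ (b (.inl i)) (mulL b (b x) (Finsupp.single T u)) =
      mulL b (b x) (Finsupp.single (i ::ₘ T) u) := by
    rcases x with j | j
    · rw [mulL_inl, mulL_inl, act_inl b ρ _ hρ, Multiset.cons_swap]
      intro s hs
      rcases Multiset.mem_cons.1 hs with rfl | hs
      · exact le_of_lt hx
      · exact hT s hs
    · simp [mulL_inr]
  rw [this]
  abel

-- Write `z_T = t z_S` and move `y`, then `x`, past `t`. The two middle terms of the result are
-- interchanged by `x ↔ y`, so they cancel in the commutator.
include hρ in
lemma comm_swap {t : I} {x y : I ⊕ I'} {S : Multiset I} (hS : ∀ s ∈ S, t ≤ s) (hx : Prec t x)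
    (hy : Prec t y) (u : U) (ih : ∀ w ∈ degLE I k U S.card, Comm b ρ w) :
    act b ρ (b x) (act b ρ (b y) (Finsupp.single (t ::ₘ S) u)) =
      act b ρ (b (.inl t)) (act b ρ (b x) (act b ρ (b y) (Finsupp.single S u))) +
      act b ρ ⁅b x, b (.inl t)⁆ (act b ρ (b y) (Finsupp.single S u)) +
      act b ρ ⁅b y, b (.inl t)⁆ (act b ρ (b x) (Finsupp.single S u)) +
      act b ρ ⁅b x, ⁅b y, b (.inl t)⁆⁆ (Finsupp.single S u) := by
  have h1 : Finsupp.single S u ∈ degLE I k U S.card := single_mem_degLE le_rfl u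
  have e1 := ih _ h1 (b y) (b (.inl t))
  have e2 := ih _ h1 (b x) ⁅b y, b (.inl t)⁆
  have e3 : act b ρ (b x) (act b ρ (b (.inl t)) (act b ρ (b y) (Finsupp.single S u))) -
      act b ρ (b (.inl t)) (act b ρ (b x) (act b ρ (b y) (Finsupp.single S u))) =
      act b ρ ⁅b x, b (.inl t)⁆ (act b ρ (b y) (Finsupp.single S u)) := by
    have e4 := ih _ (low_degLE b ρ (b y) h1) (b x) (b (.inl t))
    -- The vector `y z_S` can have degree `S.card + 1`, beyond the induction hypothesis. Its lower
    -- part is covered by `ih`; its leading part is the monomial `z_y z_S`, whose variables are all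
    -- at least `t`, so that `comm_prec` applies.
    have e5 : act b ρ (b x) (act b ρ (b (.inl t)) (mulL b (b y) (Finsupp.single S u))) -
      act b ρ (b (.inl t)) (act b ρ (b x) (mulL b (b y) (Finsupp.single S u))) =
      act b ρ ⁅b x, b (.inl t)⁆ (mulL b (b y) (Finsupp.single S u)) := by
      rcases y with j | j
      · rw [mulL_inl]
        apply comm_prec b ρ hρ _ hx
        intro s hs
        rcases Multiset.mem_cons.1 hs with rfl | hs
        · exact le_of_lt hy
        · exact hS s hs
      · simp [mulL_inr]
    rw [act_apply b ρ (b y)]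
    simp only [map_add]
    rw [← e4, ← e5]
    abel
  rw [← act_inl b ρ hS hρ u, sub_eq_iff_eq_add.1 e1, map_add, sub_eq_iff_eq_add.1 e2,
    sub_eq_iff_eq_add.1 e3]
  abel

variable (hcl : ∀ i j : I', ∀ u : U, mulL (U := U) b ⁅b (.inr i), b (.inr j)⁆ = 0 ∧
  ρ (b (.inr i)) (ρ (b (.inr j)) u) - ρ (b (.inr j)) (ρ (b (.inr i)) u) =
    ρ ⁅b (.inr i), b (.inr j)⁆ u)

-- Induction on the degree of `T`, with smallest variable `t`. If one of the two basis elements is a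
-- variable not larger than `t`, the definition of the action gives the relation (`comm_prec`). If
-- both come after `t`, the induction hypothesis and the Jacobi identity of `L` give it.
include hρ hcl in
lemma comm_single (n : ℕ) : ∀ (T : Multiset I) (u : U), T.card ≤ n →
    Comm b ρ (Finsupp.single T u) := by
  induction n with
  | zero =>
    intro T u hT
    obtain rfl : T = 0 := by simpa using hT
    apply comm_of_basis
    have key : ∀ (i : I) (x : I ⊕ I'), Prec i x → _ := fun i x hx =>
      comm_prec b ρ hρ (i := i) (x := x) (T := 0) (by simp) hx u
    rintro (i | i) (j | j)
    · rcases lt_trichotomy i j with h | rfl | h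
      · have := key i (.inl j) h
        rw [← lie_skew, map_neg, LinearMap.neg_apply, ← this]; abel
      · simp
      · exact key j (.inl i) h
    · have := key i (.inr j) trivial
      rw [← lie_skew, map_neg, LinearMap.neg_apply, ← this]; abel
    · exact key j (.inr i) trivial
    -- Only here it is used that `P` is closed under the bracket and that `ρ` is a representation of
    -- `P`.
    · obtain ⟨h1, h2⟩ := hcl i j u
      simp only [act_apply, mulL_inr, h1, LinearMap.zero_apply, zero_add, low_zero]
      rw [← h2, Finsupp.single_sub]
  | succ n ih =>
    intro T u hT
    rcases exists_min_cons T with rfl | ⟨t, S, rfl, hS⟩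
    · exact ih 0 u (by simp)
    rw [Multiset.card_cons] at hT
    have ih' : ∀ w ∈ degLE I k U S.card, Comm b ρ w := fun w hw =>
      comm_degLE b ρ (fun T u hT => ih T u (by omega)) hw
    apply comm_of_basis
    have key : ∀ (i : I) (x : I ⊕ I'), i ≤ t → Prec i x →
        act b ρ (b x) (act b ρ (b (.inl i)) (Finsupp.single (t ::ₘ S) u)) -
        act b ρ (b (.inl i)) (act b ρ (b x) (Finsupp.single (t ::ₘ S) u)) =
        act b ρ ⁅b x, b (.inl i)⁆ (Finsupp.single (t ::ₘ S) u) := by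
      intro i x hi hx
      apply comm_prec b ρ hρ _ hx
      intro s hs
      rcases Multiset.mem_cons.1 hs with rfl | hs
      · exact hi
      · exact hi.trans (hS s hs)
    intro x y
    by_cases hx : Prec t x
    · by_cases hy : Prec t y
      -- The difference of the two expansions is `t [x,y] z_S + [x,[y,t]] z_S - [y,[x,t]] z_S`. By
      -- the Jacobi identity this is `t [x,y] z_S + [[x,y],t] z_S = [x,y] t z_S`.
      · rw [comm_swap b ρ hρ hS hx hy u ih', comm_swap b ρ hρ hS hy hx u ih',
          ← act_inl b ρ hS hρ u]
        have h1 : Finsupp.single S u ∈ degLE I k U S.card := single_mem_degLE le_rfl u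
        have e1 := ih' _ h1 (b x) (b y)
        have e2 := ih' _ h1 ⁅b x, b y⁆ (b (.inl t))
        rw [sub_eq_iff_eq_add.1 e2, ← e1, map_sub, lie_lie, map_sub, LinearMap.sub_apply]
        abel
      · rcases y with j | j
        · have hj : j ≤ t := by simpa [Prec] using hy
          refine key j x hj ?_
          rcases x with i | i
          · exact lt_of_le_of_lt hj hx
          · trivial
        · exact absurd trivial hy
    · rcases x with i | i
      swap
      · exact absurd trivial hx
      have hi : i ≤ t := by simpa [Prec] using hx
      rcases y with j | j
      · rcases lt_trichotomy i j with h | rfl | h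
        · have := key i (.inl j) hi h
          rw [← lie_skew, map_neg, LinearMap.neg_apply, ← this]; abel
        · simp
        · exact key j (.inl i) (h.le.trans hi) h
      · have := key i (.inr j) hi trivial
        rw [← lie_skew, map_neg, LinearMap.neg_apply, ← this]; abel

include hρ hcl in
lemma act_lie (y z : L) : act b ρ ⁅y, z⁆ = act b ρ y * act b ρ z - act b ρ z * act b ρ y := by
  apply Finsupp.lhom_ext
  intro T u
  exact (comm_single b ρ hρ hcl T.card T u le_rfl y z).symm

end LieInduction

/-- If `L = N ⊕ P` with a subalgebra `P` and `ρ` is a linear map that restricts to a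
representation of `P` on `U`, then `U` embeds `P`-equivariantly into an `L`-module. -/
theorem exists_induced {k : Type*} {L : Type u} {U : Type*} [Field k] [LieRing L] [LieAlgebra k L]
    [AddCommGroup U] [Module k U] {N P : Submodule k L} (hNP : IsCompl N P)
    (hP : ∀ x ∈ P, ∀ y ∈ P, ⁅x, y⁆ ∈ P) (ρ : L →ₗ[k] Module.End k U)
    (hρ : ∀ x ∈ P, ∀ y ∈ P, ρ ⁅x, y⁆ = ρ x * ρ y - ρ y * ρ x) (hN : ∀ x ∈ N, ρ x = 0) :
    ∃ (ι : Type u) (φ : L →ₗ[k] Module.End k (ι →₀ U)) (i : ι),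
      (∀ x y, φ ⁅x, y⁆ = φ x * φ y - φ y * φ x) ∧
      ∀ x ∈ P, ∀ u, φ x (Finsupp.single i u) = Finsupp.single i (ρ x u) := by
  let bN := Module.Basis.ofVectorSpace k N
  let bP := Module.Basis.ofVectorSpace k P
  let b := (bN.prod bP).map (Submodule.prodEquivOfIsCompl N P hNP)
  let I := Module.Basis.ofVectorSpaceIndex k N
  -- Any linear order on the basis of the complement would do.
  let _ : LinearOrder I := open Classical in linearOrderOfSTO (WellOrderingRel (α := I))
  have hbN : ∀ i, b (.inl i) ∈ N := by intro i; simp [b]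
  have hbP : ∀ i, b (.inr i) ∈ P := by intro i; simp [b]
  have hmul : ∀ x ∈ P, LieInduction.mulL (U := U) b x = 0 := by
    intro x hx
    have : (LieInduction.mulL (U := U) b).comp P.subtype = 0 := by
      refine bP.ext fun i => ?_
      have := LieInduction.mulL_inr (U := U) b i
      simpa [b] using this
    exact LinearMap.congr_fun this ⟨x, hx⟩
  -- The index `0` is the empty monomial; there `P` has no leading term and acts through `ρ` alone.
  refine ⟨Multiset I, LieInduction.act b ρ, 0, fun x y => ?_, ?_⟩
  · refine LieInduction.act_lie b ρ (fun i => hN _ (hbN i)) (fun i j u => ⟨?_, ?_⟩) x y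
    · exact hmul _ (hP _ (hbP i) _ (hbP j))
    · rw [hρ _ (hbP i) _ (hbP j)]; rfl
  · intro x hx u
    rw [LieInduction.act_apply, hmul x hx, LieInduction.low_zero]
    simp

/-! ### Auxiliary facts -/

lemma map_fs {X Y : Type*} [AddCommGroup X] [Module ℂ X] [AddCommGroup Y] [Module ℂ Y]
    (F : X →ₗ[ℂ] Y) {f : ℕ → X} {N : ℕ} (h : ∀ i, N ≤ i → f i = 0) :
    F (∑ᶠ i, f i) = ∑ᶠ i, F (f i) := by
  rw [fs_range h, fs_range (N := N) fun i hi => by rw [h i hi, map_zero], map_sum]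

/-- The sum of the homogeneous subspaces whose degree satisfies `p`. -/
def sumOver {X : Type*} [AddCommGroup X] [Module ℂ X] (gr : ℚ → Submodule ℂ X) (p : ℚ → Prop) :
    Submodule ℂ X := ⨆ (n : ℚ) (_ : p n), gr n

section SumOver

variable {X : Type*} [AddCommGroup X] [Module ℂ X] {gr : ℚ → Submodule ℂ X}

lemma le_sumOver {p : ℚ → Prop} {n : ℚ} (h : p n) : gr n ≤ sumOver gr p :=
  le_iSup₂_of_le n h le_rfl

lemma sumOver_le {p : ℚ → Prop} {N : Submodule ℂ X} (h : ∀ n, p n → gr n ≤ N) :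
    sumOver gr p ≤ N := iSup₂_le h

lemma sumOver_disjoint (h : iSupIndep gr) {p q : ℚ → Prop} (hpq : ∀ n, p n → ¬ q n) :
    Disjoint (sumOver gr p) (sumOver gr q) :=
  h.disjoint_biSup_biSup (s := {n | p n}) (t := {n | q n})
    (Set.disjoint_left.2 fun n hn hn' => hpq n hn hn')

end SumOver

/-! ### Generators, brackets and grading of `V[g]` -/

section VgStructure

open VertexOperatorAlgebra

variable {V : Type u} [AddCommGroup V] [Module ℂ V] [VertexOperatorAlgebra V]

lemma md_nat_trunc (u v : V) : ∃ N : ℕ, ∀ i : ℕ, N ≤ i → md u i v = 0 := by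
  obtain ⟨N, hN⟩ := md_trunc u v
  exact ⟨N.toNat, fun i hi => hN _ (by omega)⟩

namespace FiniteOrderAut

variable {g : FiniteOrderAut V}

lemma eig_int (k : ℤ) : g.eig (k : ℚ) = g.eig 0 := by
  have := g.eig_add_int 0 k
  rwa [zero_add] at this

lemma el_eigProj (q : ℚ) (a : V) : g.el q (g.eigProj q a) = g.el q a := by
  change g.toVg ⟨Finsupp.single q (g.eigProj q (g.eigProj q a)), _⟩ =
    g.toVg ⟨Finsupp.single q (g.eigProj q a), _⟩
  congr 3
  exact g.eigProj_of_mem (g.eigProj_mem q a)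

lemma el_of_mem {q : ℚ} {a : V} (ha : a ∈ g.eig q) :
    g.el q a = g.toVg ⟨Finsupp.single q a, single_mem_Lg ha⟩ := by
  change g.toVg ⟨Finsupp.single q (g.eigProj q a), _⟩ = _
  congr 3
  exact g.eigProj_of_mem ha

lemma el_of_ne {p q : ℚ} {a : V} (ha : a ∈ g.eig p) (h : ¬∃ k : ℤ, p = q + k) : g.el q a = 0 := by
  rw [← el_eigProj, g.eigProj_of_mem_ne ha h, map_zero]

/-- `V[g]` is spanned by the `a(q)`, `a` a homogeneous eigenvector. -/
@[elab_as_elim]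
lemma Vg_induction {P : g.Vg → Prop} (zero : P 0) (add : ∀ x y, P x → P y → P (x + y))
    (mem : ∀ (k : ℤ) (q : ℚ) (a : V), a ∈ wt V k → a ∈ g.eig q → P (g.el q a)) (y : g.Vg) : P y := by
  obtain ⟨⟨x, hx⟩, rfl⟩ := g.toVg_surjective y
  have key : ∃ hx : x ∈ g.Lg, P (g.toVg ⟨x, hx⟩) := by
    refine Lg_induction (g := g) (P := fun x => ∃ hx : x ∈ g.Lg, P (g.toVg ⟨x, hx⟩))
      ⟨Submodule.zero_mem _, ?_⟩ ?_ ?_ hx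
    · have : g.toVg ⟨0, Submodule.zero_mem _⟩ = 0 := map_zero g.toVg
      rwa [this]
    · rintro x y ⟨hx, hPx⟩ ⟨hy, hPy⟩
      refine ⟨Submodule.add_mem _ hx hy, ?_⟩
      have := add _ _ hPx hPy
      rwa [← map_add] at this
    · intro q a ha
      refine ⟨single_mem_Lg ha, ?_⟩
      rw [← el_of_mem ha]
      clear ha
      induction a using g.hom_induction with
      | h0 => rwa [map_zero]
      | hadd u v hu hv => rw [map_add]; exact add _ _ hu hv
      | h k p a _ _ hk _ =>
        rw [← el_eigProj]
        exact mem k q _ (g.eigProj_wt q hk) (g.eigProj_mem q a)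
  obtain ⟨_, h⟩ := key
  exact h

lemma el_lie_of_mem {m n : ℚ} {a b : V} (ha : a ∈ g.eig m) (hb : b ∈ g.eig n) :
    ⁅g.el m a, g.el n b⁆ = ∑ᶠ i : ℕ, Ring.choose (m : ℂ) i • g.el (m + n - i) (md a i b) := by
  obtain ⟨N, hN⟩ := md_nat_trunc a b
  have hmem : ∀ i : ℕ, md a i b ∈ g.eig (m + n - i) := fun i => by
    rw [eig_sub_nat]; exact g.md_eig ha hb i
  rw [el_of_mem ha, el_of_mem hb, toVg_lie, fs_range (N := N) fun i hi => by
    rw [hN i hi, map_zero, smul_zero]]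
  have : g.brL ⟨Finsupp.single m a, single_mem_Lg ha⟩ ⟨Finsupp.single n b, single_mem_Lg hb⟩ =
      ∑ i ∈ Finset.range N, Ring.choose (m : ℂ) i •
        (⟨Finsupp.single (m + n - i) (md a i b), single_mem_Lg (hmem i)⟩ : g.Lg) := by
    apply Subtype.ext
    change br (Finsupp.single m a) (Finsupp.single n b) = _
    rw [br_single, fs_range (N := N) fun i hi => by rw [hN i hi, Finsupp.single_zero, smul_zero]]
    simp
  rw [this, map_sum]
  refine Finset.sum_congr rfl fun i _ => ?_
  rw [map_smul, el_of_mem (hmem i)]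

/-- The components of `b` outside the eigenspace for `n` contribute nothing to either side, since
the `a_i` shift all eigenvalues by the same factor. So the formula holds without a condition on `b`.
-/
lemma el_lie {m : ℚ} {a : V} (ha : a ∈ g.eig m) (n : ℚ) (b : V) :
    ⁅g.el m a, g.el n b⁆ = ∑ᶠ i : ℕ, Ring.choose (m : ℂ) i • g.el (m + n - i) (md a i b) := by
  induction b using g.hom_induction with
  | h0 => simp
  | hadd u v hu hv =>
    obtain ⟨N, hN⟩ := md_nat_trunc a u
    obtain ⟨N', hN'⟩ := md_nat_trunc a v
    rw [map_add, lie_add, hu, hv, fs_range (N := max N N'), fs_range (N := max N N'),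
      fs_range (N := max N N'), ← Finset.sum_add_distrib]
    · simp
    · intro i hi
      rw [map_add, hN i (by omega), hN' i (by omega)]; simp
    · intro i hi
      rw [hN' i (by omega)]; simp
    · intro i hi
      rw [hN i (by omega)]; simp
  | h k q b _ _ _ hq =>
    by_cases hn : ∃ z : ℤ, q = n + z
    · obtain ⟨z, rfl⟩ := hn
      rw [g.eig_add_int] at hq
      exact el_lie_of_mem ha hq
    · rw [el_of_ne hq hn, lie_zero, finsum_eq_zero_of_forall_eq_zero]
      intro i
      rw [el_of_ne (g.md_eig ha hq i), smul_zero]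
      rintro ⟨z, hz⟩
      exact hn ⟨z - i, by push_cast; linarith⟩

/-- The relation `D (t^q ⊗ a) = 0` in the quotient; components of `a` in other eigenspaces vanish on
both sides. -/
lemma el_deriv (q : ℚ) (a : V) : g.el q (md omega 0 a) = -(q : ℂ) • g.el (q - 1) a := by
  have key : ∀ a ∈ g.eig q, g.el q (md omega 0 a) = -(q : ℂ) • g.el (q - 1) a := by
    intro a ha
    have ha' : a ∈ g.eig (q - 1) := by
      have := eig_sub_nat (g := g) q 1
      rw [Nat.cast_one] at this
      rwa [this]
    rw [el_of_mem (deriv_eig ha), el_of_mem ha', ← map_smul, ← sub_eq_zero, ← map_sub,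
      toVg_eq_zero, DLg, Submodule.mem_comap]
    refine ⟨Finsupp.single q a, single_mem_Lg ha, ?_⟩
    rw [Dop_single]
    simp only [Submodule.subtype_apply, Submodule.coe_sub, Submodule.coe_smul]
    module
  induction a using g.hom_induction with
  | h0 => simp
  | hadd u v hu hv => simp only [map_add, hu, hv, smul_add]
  | h k p a _ _ _ hp =>
    by_cases hn : ∃ z : ℤ, p = q + z
    · obtain ⟨z, rfl⟩ := hn
      rw [g.eig_add_int] at hp
      exact key a hp
    · rw [el_of_ne (deriv_eig hp) hn, el_of_ne hp, smul_zero]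
      rintro ⟨z, hz⟩
      exact hn ⟨z - 1, by push_cast; linarith⟩

/-- Since `L(-1) 1 = 0`, the derivative relation at `n + 1` reads `(n + 1) 1(n) = 0`. -/
lemma el_vac {n : ℚ} (hn : n ≠ -1) : g.el n vac = 0 := by
  have h := el_deriv (g := g) (n + 1) vac
  have h0 : md (omega : V) 0 vac = 0 := creation_nonneg _ _ le_rfl
  rw [h0, map_zero, add_sub_cancel_right] at h
  refine (smul_eq_zero.1 h.symm).resolve_left ?_
  rw [neg_eq_zero]
  exact_mod_cast fun hc : n + 1 = 0 => hn (by linarith)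

/-- All `1_i` with `i ≥ 0` vanish. Centrality will force `1(-1)` to be the identity on a module
generated by vectors that it fixes. -/
lemma el_vac_lie (y : g.Vg) : ⁅g.el (-1) vac, y⁆ = 0 := by
  have hv : (vac : V) ∈ g.eig (-1) := by
    have := eig_int (g := g) (-1)
    push_cast at this
    rw [this]; exact vac_eig
  induction y using Vg_induction with
  | zero => simp
  | add x y hx hy => rw [lie_add, hx, hy, add_zero]
  | mem k q a _ _ =>
    rw [el_lie hv, finsum_eq_zero_of_forall_eq_zero]
    intro i
    have : md (vac : V) i a = 0 := by
      have := vac_mode (i : ℤ) a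
      rw [if_neg (by omega)] at this
      exact this
    rw [this, map_zero, smul_zero]

lemma el_mem_degVg {k : ℤ} {v : V} (hv : v ∈ wt V k) {q n : ℚ} (hn : (k : ℚ) - q - 1 = n) :
    g.el q v ∈ g.degVg n := by
  rw [← el_eigProj]
  exact Submodule.subset_span ⟨k, q, _, g.eigProj_wt q hv, g.eigProj_mem q v, hn, rfl⟩

lemma lie_mem_degVg {m n : ℚ} {x y : g.Vg} (hx : x ∈ g.degVg m) (hy : y ∈ g.degVg n) :
    ⁅x, y⁆ ∈ g.degVg (m + n) := by
  induction hx using Submodule.span_induction with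
  | zero => simp
  | add x x' _ _ hx hx' => rw [add_lie]; exact Submodule.add_mem _ hx hx'
  | smul c x _ hx => rw [smul_lie]; exact Submodule.smul_mem _ _ hx
  | mem x hx =>
    obtain ⟨k, p, a, hk, hp, hm, rfl⟩ := hx
    induction hy using Submodule.span_induction with
    | zero => simp
    | add x x' _ _ hx hx' => rw [lie_add]; exact Submodule.add_mem _ hx hx'
    | smul c x _ hx => rw [lie_smul]; exact Submodule.smul_mem _ _ hx
    | mem y hy =>
      obtain ⟨j, q, b, hj, hq, hn, rfl⟩ := hy
      rw [el_lie hp]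
      refine finsum_induction (· ∈ g.degVg (m + n)) (Submodule.zero_mem _)
        (fun _ _ => Submodule.add_mem _) fun i => Submodule.smul_mem _ _ ?_
      refine el_mem_degVg (md_wt hk hj i) ?_
      push_cast
      linarith

/-- `L(0) = ω(1)` acts on `V[g]_n` as `n`. -/
lemma omega_lie {n : ℚ} {y : g.Vg} (hy : y ∈ g.degVg n) : ⁅g.el 1 omega, y⁆ = (n : ℂ) • y := by
  induction hy using Submodule.span_induction with
  | zero => simp
  | add x x' _ _ hx hx' => rw [lie_add, hx, hx', smul_add]
  | smul c x _ hx => rw [lie_smul, hx, smul_comm]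
  | mem y hy =>
    obtain ⟨k, q, a, hk, hq, hn, rfl⟩ := hy
    have ho : (omega : V) ∈ g.eig 1 := by
      have := eig_int (g := g) 1
      push_cast at this
      rw [this]; exact omega_eig
    -- Since `C(1, i) = 0` for `i ≥ 2`, only `ω_0 = L(-1)` and `ω_1 = L(0)` contribute, with total
    -- factor `wt a - (q + 1)`.
    rw [el_lie ho, fs_range (N := 2)]
    · rw [Finset.sum_range_succ, Finset.sum_range_one]
      rw [mem_wt] at hk
      simp only [Rat.cast_one, Ring.choose_zero_right, Nat.cast_zero, one_smul, sub_zero,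
        Ring.choose_one_right, Nat.cast_one, hk, map_smul, el_deriv, add_sub_cancel_left, ← hn]
      push_cast
      module
    · intro i hi
      have h0 : Ring.choose ((1 : ℚ) : ℂ) i = 0 := by
        have := Ring.choose_natCast (R := ℂ) 1 i
        rw [Nat.choose_eq_zero_of_lt (by omega)] at this
        simpa using this
      rw [h0, zero_smul]

/-- The degree is an eigenvalue of `ad ω(1)`, and eigenspaces are independent. -/
lemma degVg_indep : iSupIndep g.degVg := by
  let d : Module.End ℂ g.Vg := g.brVg (g.el 1 omega)
  have h1 := Module.End.eigenspaces_iSupIndep d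
  refine (h1.comp (f := fun n : ℚ => (n : ℂ)) Rat.cast_injective).mono fun n y hy => ?_
  exact Module.End.mem_eigenspace_iff.2 (omega_lie hy)

lemma degVg_eq_bot {n : ℚ} (h : ¬∃ k : ℤ, n * g.T = k) : g.degVg n = ⊥ := by
  rw [eq_bot_iff, degVg, Submodule.span_le]
  rintro _ ⟨k, q, a, hk, hq, hn, rfl⟩
  by_cases ha : a = 0
  · simp [ha]
  · exfalso
    obtain ⟨z, hz⟩ := g.exists_int_of_mem hq ha
    refine h ⟨k * g.T - z - g.T, ?_⟩
    push_cast
    rw [← hn, ← hz]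
    ring

lemma iSup_degVg : ⨆ n, g.degVg n = ⊤ := by
  rw [eq_top_iff]
  rintro y -
  induction y using Vg_induction with
  | zero => exact Submodule.zero_mem _
  | add x y hx hy => exact Submodule.add_mem _ hx hy
  | mem k q a hk hq =>
    exact Submodule.mem_iSup_of_mem ((k : ℚ) - q - 1) (el_mem_degVg hk rfl)

/-! ### The action of `V[g]_- ⊕ V[g]_0` through `A_g(V)` -/

/-- `(L(-1) + L(0)) a ∈ O_g(V)`. -/
lemma deriv_add_mem_O {k : ℤ} {a : V} (hk : a ∈ wt V k) : (k : ℂ) • a + md omega 0 a ∈ g.O := by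
  have key : ∀ q : ℚ, 0 ≤ q → q < 1 → ∀ a ∈ wt V k, a ∈ g.eig q →
      (k : ℂ) • a + md omega 0 a ∈ g.O := by
    intro q h0 h1 a hk hq
    rcases h0.eq_or_lt with rfl | h0
    -- For `r = 0`, the element `a ∘ 1` is `a_{-2} 1 + (wt a) a_{-1} 1`, which is `L(-1) a + L(0)
    -- a`.
    · have := circ_mem le_rfl one_pos hk hq vac
      rw [circ, resMode_apply, fs_range (N := 2)] at this
      · have hc : md a (-1) vac = a := creation a
        have h2 : md a (-2) vac = md omega 0 a := by
          have h3 := LinearMap.congr_fun (md_deriv a (-1)) vac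
          rw [show md (md omega 0 a) (-1) vac = md omega 0 a from creation _] at h3
          rw [h3]
          simp
        simp only [del, Finset.sum_range_succ, Finset.sum_range_zero, if_true] at this
        norm_num [hc, h2] at this
        rwa [add_comm] at this
      · intro i hi
        have : md a (-1 - del 0 + i) vac = 0 := creation_nonneg a _ (by simp [del]; omega)
        rw [this, smul_zero]
    · exact Submodule.add_mem _ (Submodule.smul_mem _ _ (eig_le_O h0 h1 hq))
        (eig_le_O h0 h1 (deriv_eig hq))
  rw [← g.sum_eigProj a, map_sum, Finset.smul_sum, ← Finset.sum_add_distrib]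
  refine Submodule.sum_mem _ fun r hr => ?_
  have hT : (0 : ℚ) < g.T := by exact_mod_cast g.T_pos
  refine key (r / g.T) (by positivity) ?_ _ (g.eigProj_wt _ hk) (g.eigProj_mem _ _)
  rw [div_lt_one hT]
  exact_mod_cast Finset.mem_range.1 hr

variable (g) in
/-- The map `ℂ[t^{1/T}, t^{-1/T}] ⊗ V → A_g(V)` with `t^{wt a - 1} ⊗ a ↦ a + O_g(V)` that vanishes in
the other degrees. -/
def rhoF : (ℚ →₀ V) →ₗ[ℂ] g.A :=
  Finsupp.lsum ℂ fun q : ℚ => open Classical in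
    homExt fun k : ℤ => if (k : ℚ) - 1 = q then g.toA else 0

open Classical in
lemma rhoF_single {k : ℤ} {a : V} (hk : a ∈ wt V k) (q : ℚ) :
    g.rhoF (Finsupp.single q a) = if (k : ℚ) - 1 = q then g.toA a else 0 := by
  rw [rhoF, Finsupp.lsum_single, homExt_apply _ hk]
  split_ifs <;> simp

/-- `D (t^q ⊗ a)` has degree `0` only for `q = wt a`; in that case its image is the class of `(L(0)
+ L(-1)) a`, which is zero. -/
lemma rhoF_Dop (x : ℚ →₀ V) : g.rhoF (Dop x) = 0 := by
  induction x using Finsupp.induction_linear with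
  | zero => simp
  | add x y hx hy => rw [map_add, map_add, hx, hy, add_zero]
  | single q a =>
    induction a using g.hom_induction with
    | h0 => simp
    | hadd u v hu hv => rw [Finsupp.single_add, map_add, map_add, hu, hv, add_zero]
    | h k p a _ _ hk _ =>
      rw [Dop_single, map_add, map_smul, rhoF_single hk, rhoF_single (deriv_wt hk)]
      by_cases h : (k : ℚ) = q
      · subst h
        rw [if_pos rfl, if_pos (by push_cast; ring), ← map_smul, ← map_add, toA_eq_zero]
        simpa using deriv_add_mem_O hk
      · rw [if_neg fun hc => h (by linarith), if_neg fun hc => h (by push_cast at hc; linarith)]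
        simp

variable (g) in
/-- The map `V[g] → A_g(V)` with `a(wt a - 1) ↦ a + O_g(V)` that vanishes in degrees `≠ 0`. -/
def rho : g.Vg →ₗ[ℂ] g.A :=
  g.DLg.liftQ (g.rhoF.comp g.Lg.subtype) (by
    rintro x ⟨z, _, hz⟩
    change g.rhoF x.1 = 0
    rw [show x.1 = Dop z from hz.symm, rhoF_Dop])

open Classical in
lemma rho_el {k : ℤ} {q : ℚ} {a : V} (hk : a ∈ wt V k) (hq : a ∈ g.eig q) :
    g.rho (g.el q a) = if (k : ℚ) - 1 = q then g.toA a else 0 := by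
  rw [el_of_mem hq]
  exact rhoF_single hk q

lemma rho_degVg {n : ℚ} (hn : n ≠ 0) {y : g.Vg} (hy : y ∈ g.degVg n) : g.rho y = 0 := by
  induction hy using Submodule.span_induction with
  | zero => simp
  | add x x' _ _ hx hx' => rw [map_add, hx, hx', add_zero]
  | smul c x _ hx => rw [map_smul, hx, smul_zero]
  | mem y hy =>
    obtain ⟨k, q, a, hk, hq, h, rfl⟩ := hy
    rw [rho_el hk hq, if_neg]
    intro hc
    exact hn (by linarith)

/-- Induction from `x * 1 ≡ x`: the splitting `(1+z)^{α+1} = (1+z)^α + z (1+z)^α` lowers `i` by one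
modulo a residue that `res_mem_O` places in `O_g(V)`. -/
lemma res_vac_sub_mem {j : ℤ} {x : V} (hj : x ∈ wt V j) (hx : x ∈ g.eig 0) (i : ℕ) :
    ∀ n : ℤ, n = -1 - i → resMode ((j : ℂ) + i) n x vac - x ∈ g.O := by
  induction i with
  | zero =>
    rintro n rfl
    simpa [star_apply hj hx] using star_vac (g := g) x
  | succ i ih =>
    rintro n hn
    subst hn
    have e := resMode_succ ((j : ℂ) + i) (-1 - (i + 1 : ℕ)) x vac
    push_cast at e ⊢
    rw [← add_assoc, e, add_sub_assoc]
    refine Submodule.add_mem _ ?_ (ih _ (by ring))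
    exact res_mem_O le_rfl one_pos hj hx vac i i le_rfl (by simp [del]) (by simp [del]; ring)

/-- `[a][b] - [b][a] = ∑ C(wt a - 1, i) [a_i b]` in `A_g(V)`. -/
lemma toA_commutator {j k : ℤ} {a b : V} (hk : a ∈ wt V k) (ha : a ∈ g.eig 0) (hj : b ∈ wt V j)
    (hb : b ∈ g.eig 0) : g.toA a * g.toA b - g.toA b * g.toA a =
      ∑ᶠ i : ℕ, Ring.choose ((k : ℂ) - 1) i • g.toA (md a i b) := by
  obtain ⟨N, hN⟩ := md_nat_trunc a b
  -- Both products are evaluated on `1`, so that the commutator formula `res_comm` for residues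
  -- applies.
  have e1 : g.toA a * g.toA b - g.toA b * g.toA a =
      g.toA (g.star a (g.star b vac) - g.star b (g.star a vac)) := by
    have h : ∀ x : V, g.toA (g.star x vac) = g.toA x := fun x => by
      rw [← sub_eq_zero, ← map_sub, toA_eq_zero]; exact star_vac x
    rw [map_sub, ← toA_mul g a, ← toA_mul g b (g.star a vac), h, h]
  -- `res_comm` yields the coefficients `C(-1, i) C(wt a, s)` at `a_{s+i} b`; summed over fixed `s +
  -- i` they give `C(wt a - 1, s + i)`.
  have e2 := fs_vandermonde ((-1 : ℤ) : ℂ) (k : ℂ) (f := fun i : ℕ => g.toA (md a i b)) (N := N)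
    fun i hi => by rw [hN i hi, map_zero]
  have hmem : ∀ s i : ℕ, g.toA (resMode ((k : ℂ) + j - s) (-1 + -1 - i) (md a (s + i) b) vac) =
      g.toA (md a (s + i) b) := by
    intro s i
    rw [← sub_eq_zero, ← map_sub, toA_eq_zero]
    have := res_vac_sub_mem (g := g) (md_wt hk hj (s + i)) (by simpa using g.md_eig ha hb (s + i))
      (i + 1) (-1 + -1 - i) (by push_cast; ring)
    convert this using 4
    push_cast; ring_nf
  rw [e1, star_apply hk ha, star_apply hj hb, star_apply hj hb, star_apply hk ha, res_comm]
  rw [show ((-1 : ℤ) : ℂ) + k = k - 1 by push_cast; ring] at e2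
  rw [e2]
  have z1 : ∀ i s : ℕ, N ≤ i ∨ N ≤ s →
      resMode ((k : ℂ) + j - s) (-1 + -1 - i) (md a (s + i) b) vac = 0 := by
    intro i s h
    have : md a (s + i) b = 0 := by
      have := hN (s + i) (by omega)
      rwa [Nat.cast_add] at this
    rw [this]; simp
  rw [map_fs g.toA (N := N)]
  · apply finsum_congr
    intro i
    rw [map_smul, map_fs g.toA (N := N), smul_finsum]
    · apply finsum_congr
      intro s
      rw [map_smul, hmem, mul_smul]
      push_cast
      rw [add_comm (s : ℤ)]
    · intro s hs
      rw [z1 i s (by tauto), smul_zero]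
  · intro i hi
    rw [finsum_eq_zero_of_forall_eq_zero, smul_zero]
    intro s
    rw [z1 i s (by tauto), smul_zero]

/-- `V[g]_- ⊕ V[g]_0` -/
def nonpos (g : FiniteOrderAut V) : Submodule ℂ g.Vg := sumOver g.degVg (· ≤ 0)

@[elab_as_elim]
lemma nonpos_induction {P : (y : g.Vg) → y ∈ g.nonpos → Prop} (zero : P 0 (Submodule.zero_mem _))
    (add : ∀ x y hx hy, P x hx → P y hy → P (x + y) (Submodule.add_mem _ hx hy))
    (mem : ∀ (n : ℚ) (hn : n ≤ 0) (y : g.Vg) (hy : y ∈ g.degVg n),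
      P y (le_sumOver (p := (· ≤ 0)) hn hy)) {y : g.Vg} (hy : y ∈ g.nonpos) : P y hy := by
  have hy' := hy
  rw [nonpos, sumOver, iSup_subtype'] at hy'
  suffices h : ∃ hy : y ∈ g.nonpos, P y hy from h.2
  clear hy
  induction hy' using Submodule.iSup_induction' with
  | mem n x hx => exact ⟨_, mem n.1 n.2 x hx⟩
  | zero => exact ⟨_, zero⟩
  | add x y h1 h2 hx hy =>
    obtain ⟨hx, hPx⟩ := hx
    obtain ⟨hy, hPy⟩ := hy
    exact ⟨_, add x y hx hy hPx hPy⟩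

lemma lie_mem_nonpos {x y : g.Vg} (hx : x ∈ g.nonpos) (hy : y ∈ g.nonpos) : ⁅x, y⁆ ∈ g.nonpos := by
  induction hx using nonpos_induction with
  | zero => simp
  | add x x' _ _ hx hx' => rw [add_lie]; exact Submodule.add_mem _ hx hx'
  | mem m hm x hx =>
    induction hy using nonpos_induction with
    | zero => simp
    | add x x' _ _ hx hx' => rw [lie_add]; exact Submodule.add_mem _ hx hx'
    | mem n hn y hy => exact le_sumOver (p := (· ≤ 0)) (add_nonpos hm hn) (lie_mem_degVg hx hy)

/-- Degree `0` forces the exponent of `a` to be `wt a - 1`, so the bracket of `V[g]` has the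
binomial coefficients of `toA_commutator`. -/
lemma rho_lie_zero {x y : g.Vg} (hx : x ∈ g.degVg 0) (hy : y ∈ g.degVg 0) :
    g.rho ⁅x, y⁆ = g.rho x * g.rho y - g.rho y * g.rho x := by
  induction hx using Submodule.span_induction with
  | zero => simp
  | add x x' _ _ hx hx' => simp only [add_lie, map_add, hx, hx', add_mul, mul_add]; abel
  | smul c x _ hx =>
    simp only [smul_lie, map_smul, hx, smul_mul_assoc, mul_smul_comm, smul_sub]
  | mem x hx =>
    obtain ⟨k, p, a, hk, hp, hm, rfl⟩ := hx
    induction hy using Submodule.span_induction with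
    | zero => simp
    | add x x' _ _ hx hx' => simp only [lie_add, map_add, hx, hx', add_mul, mul_add]; abel
    | smul c x _ hx =>
      simp only [lie_smul, map_smul, hx, smul_mul_assoc, mul_smul_comm, smul_sub]
    | mem y hy =>
      obtain ⟨j, q, b, hj, hq, hn, rfl⟩ := hy
      obtain rfl : p = ((k - 1 : ℤ) : ℚ) := by push_cast; linarith
      obtain rfl : q = ((j - 1 : ℤ) : ℚ) := by push_cast; linarith
      have ha : a ∈ g.eig 0 := by rwa [eig_int] at hp
      have hb : b ∈ g.eig 0 := by rwa [eig_int] at hq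
      obtain ⟨N, hN⟩ := md_nat_trunc a b
      rw [rho_el hk hp, rho_el hj hq, if_pos (by push_cast; ring), if_pos (by push_cast; ring),
        toA_commutator hk ha hj hb, el_lie hp, map_fs g.rho (N := N) fun i hi => by
          rw [hN i hi, map_zero, smul_zero]]
      apply finsum_congr
      intro i
      rw [map_smul, rho_el (md_wt hk hj i), if_pos (by push_cast; ring)]
      · push_cast; rfl
      · rw [eig_sub_nat]; exact g.md_eig hp hq i

/-- `ρ` restricts to a representation of `V[g]_- ⊕ V[g]_0`. -/
lemma rho_lie {x y : g.Vg} (hx : x ∈ g.nonpos) (hy : y ∈ g.nonpos) :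
    g.rho ⁅x, y⁆ = g.rho x * g.rho y - g.rho y * g.rho x := by
  induction hx using nonpos_induction with
  | zero => simp
  | add x x' _ _ hx hx' => simp only [add_lie, map_add, hx, hx', add_mul, mul_add]; abel
  | mem m hm x hx =>
    induction hy using nonpos_induction with
    | zero => simp
    | add x x' _ _ hx hx' => simp only [lie_add, map_add, hx, hx', add_mul, mul_add]; abel
    | mem n hn y hy =>
      by_cases h : m = 0 ∧ n = 0
      · obtain ⟨rfl, rfl⟩ := h
        exact rho_lie_zero hx hy
      · have h1 : m + n ≠ 0 := fun hc => h ⟨by linarith, by linarith⟩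
        have h2 : g.rho x = 0 ∨ g.rho y = 0 := by
          by_cases hm0 : m = 0
          · exact Or.inr (rho_degVg (fun hc => h ⟨hm0, hc⟩) hy)
          · exact Or.inl (rho_degVg hm0 hx)
        rw [rho_degVg h1 (lie_mem_degVg hx hy)]
        rcases h2 with h2 | h2 <;> simp [h2]

lemma isCompl_pos_nonpos : IsCompl (sumOver g.degVg (0 < ·)) g.nonpos := by
  refine ⟨sumOver_disjoint degVg_indep fun n hn => not_le.2 hn, ?_⟩
  rw [codisjoint_iff, eq_top_iff, ← iSup_degVg]
  refine iSup_le fun n => ?_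
  rcases lt_or_ge 0 n with h | h
  · exact (le_sumOver (p := (0 < ·)) h).trans le_sup_left
  · exact (le_sumOver (p := (· ≤ 0)) h).trans le_sup_right

lemma rho_pos {y : g.Vg} (hy : y ∈ sumOver g.degVg (0 < ·)) : g.rho y = 0 := by
  have : sumOver g.degVg (0 < ·) ≤ LinearMap.ker g.rho :=
    sumOver_le fun n hn y hy => rho_degVg hn.ne' hy
  exact this hy

end FiniteOrderAut

end VgStructure

/-! ### Graded vector spaces -/

section Graded

section Projections

variable {X ι : Type*} [AddCommGroup X] [Module ℂ X] [DecidableEq ι] {gr : ι → Submodule ℂ X}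

lemma bijective_of_isInternal (h : DirectSum.IsInternal gr) :
    Function.Bijective (DirectSum.coeLinearMap gr) := h

/-- The projection onto the summand with index `n`. -/
def homProj (h : DirectSum.IsInternal gr) (n : ι) : X →ₗ[ℂ] X :=
  (gr n).subtype.comp ((DirectSum.component ℂ ι (fun n => gr n) n).comp
    (LinearEquiv.ofBijective (DirectSum.coeLinearMap gr) (bijective_of_isInternal h)).symm.toLinearMap)

lemma homProj_mem (h : DirectSum.IsInternal gr) (n : ι) (x : X) : homProj h n x ∈ gr n :=
  Subtype.coe_prop _

lemma homProj_apply (h : DirectSum.IsInternal gr) {m : ι} (n : ι) {x : X} (hx : x ∈ gr m) :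
    homProj h n x = if m = n then x else 0 := by
  have : (LinearEquiv.ofBijective (DirectSum.coeLinearMap gr) (bijective_of_isInternal h)).symm x =
      DirectSum.lof ℂ ι (fun n => gr n) m ⟨x, hx⟩ := by
    rw [LinearEquiv.symm_apply_eq, LinearEquiv.ofBijective_apply, DirectSum.coeLinearMap_lof]
  simp only [homProj, LinearMap.comp_apply, LinearEquiv.coe_coe, this]
  split_ifs with hmn
  · subst hmn
    rw [DirectSum.component.lof_self]; rfl
  · rw [DirectSum.component.of, dif_neg hmn]; simp

lemma homProj_self (h : DirectSum.IsInternal gr) {n : ι} {x : X} (hx : x ∈ gr n) :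
    homProj h n x = x := by rw [homProj_apply h n hx, if_pos rfl]

lemma homProj_of_ne (h : DirectSum.IsInternal gr) {m n : ι} (hmn : m ≠ n) {x : X} (hx : x ∈ gr m) :
    homProj h n x = 0 := by rw [homProj_apply h n hx, if_neg hmn]

@[elab_as_elim]
lemma homogeneous_induction (h : DirectSum.IsInternal gr) {P : X → Prop} (zero : P 0)
    (add : ∀ x y, P x → P y → P (x + y)) (mem : ∀ n, ∀ x ∈ gr n, P x) (x : X) : P x := by
  have hx : x ∈ ⨆ n, gr n := by rw [h.submodule_iSup_eq_top]; trivial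
  induction hx using Submodule.iSup_induction' with
  | mem n x hx => exact mem n x hx
  | zero => exact zero
  | add x y _ _ hx hy => exact add x y hx hy

/-- An element is the sum of its components. -/
lemma mem_of_homProj (h : DirectSum.IsInternal gr) {N : Submodule ℂ X} {x : X}
    (hx : ∀ n, homProj h n x ∈ N) : x ∈ N := by
  have e : ∃ s : Finset ι, x = ∑ n ∈ s, homProj h n x := by
    clear hx
    -- All larger index sets are allowed so that the statement passes to sums.
    have key : ∃ s : Finset ι, ∀ t : Finset ι, s ⊆ t → x = ∑ n ∈ t, homProj h n x := by
      induction x using homogeneous_induction h with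
      | zero => exact ⟨∅, by simp⟩
      | add x y hx hy =>
        obtain ⟨s, hs⟩ := hx
        obtain ⟨t, ht⟩ := hy
        refine ⟨s ∪ t, fun r hr => ?_⟩
        simp only [map_add, Finset.sum_add_distrib]
        rw [← hs r (Finset.union_subset_left hr), ← ht r (Finset.union_subset_right hr)]
      | mem n x hx =>
        refine ⟨{n}, fun t ht => ?_⟩
        rw [Finset.sum_eq_single n (fun m _ hm => homProj_of_ne h hm.symm hx)
          (fun hn => absurd (ht (Finset.mem_singleton_self n)) hn), homProj_self h hx]
    obtain ⟨s, hs⟩ := key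
    exact ⟨s, hs s subset_rfl⟩
  obtain ⟨s, hs⟩ := e
  rw [hs]
  exact Submodule.sum_mem _ fun n _ => hx n

end Projections

variable {X : Type*} [AddCommGroup X] [Module ℂ X] {gr : ℚ → Submodule ℂ X}

/-- A subspace is graded if it is the sum of its homogeneous subspaces. -/
def IsGr (gr : ℚ → Submodule ℂ X) (N : Submodule ℂ X) : Prop := N = ⨆ n : ℚ, N ⊓ gr n

lemma isGr_of_le {N : Submodule ℂ X} (h : N ≤ ⨆ n : ℚ, N ⊓ gr n) : IsGr gr N :=
  le_antisymm h (iSup_le fun _ => inf_le_left)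

@[elab_as_elim]
lemma IsGr.induction {N : Submodule ℂ X} (hN : IsGr gr N) {P : X → Prop} (zero : P 0)
    (add : ∀ x y, P x → P y → P (x + y)) (mem : ∀ n, ∀ x ∈ N, x ∈ gr n → P x) (x : X) (hx : x ∈ N) :
    P x := by
  rw [hN] at hx
  induction hx using Submodule.iSup_induction' with
  | mem n x hx => exact mem n x hx.1 hx.2
  | zero => exact zero
  | add x y _ _ hx hy => exact add x y hx hy

lemma isGr_iff (h : DirectSum.IsInternal gr) {N : Submodule ℂ X} :
    IsGr gr N ↔ ∀ n, ∀ x ∈ N, homProj h n x ∈ N := by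
  constructor
  · intro hN n x hx
    refine hN.induction (by simp) (fun x y hx hy => ?_) (fun m x hx hm => ?_) x hx
    · rw [map_add]; exact Submodule.add_mem _ hx hy
    · rw [homProj_apply h n hm]
      split_ifs
      · exact hx
      · exact Submodule.zero_mem _
  · intro hN
    refine isGr_of_le fun x hx => mem_of_homProj h fun n => ?_
    exact Submodule.mem_iSup_of_mem n ⟨hN n x hx, homProj_mem h n x⟩

lemma isGr_sSup {s : Set (Submodule ℂ X)} (h : ∀ N ∈ s, IsGr gr N) : IsGr gr (sSup s) := by
  refine isGr_of_le (sSup_le fun N hN => ?_)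
  rw [(h N hN : N = _)]
  exact iSup_mono fun n => inf_le_inf_right _ (le_sSup hN)

lemma IsGr.inf (h : DirectSum.IsInternal gr) {N N' : Submodule ℂ X} (hN : IsGr gr N)
    (hN' : IsGr gr N') : IsGr gr (N ⊓ N') := by
  rw [isGr_iff h] at *
  exact fun n x hx => ⟨hN n x hx.1, hN' n x hx.2⟩

lemma IsGr.map {Y : Type*} [AddCommGroup Y] [Module ℂ Y] {gr' : ℚ → Submodule ℂ Y}
    {f : X →ₗ[ℂ] Y} (hf : ∀ n, ∀ x ∈ gr n, f x ∈ gr' n) {N : Submodule ℂ X} (hN : IsGr gr N) :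
    IsGr gr' (N.map f) := by
  refine isGr_of_le ?_
  rintro _ ⟨x, hx, rfl⟩
  refine hN.induction (by simp) (fun x y hx hy => ?_) (fun m x hx hm => ?_) x hx
  · rw [map_add]; exact Submodule.add_mem _ hx hy
  · exact Submodule.mem_iSup_of_mem m ⟨⟨x, hx, rfl⟩, hf m x hm⟩

lemma homProj_map {Y : Type*} [AddCommGroup Y] [Module ℂ Y] {gr' : ℚ → Submodule ℂ Y}
    (h : DirectSum.IsInternal gr) (h' : DirectSum.IsInternal gr') {f : X →ₗ[ℂ] Y} {m : ℚ}
    (hf : ∀ n, ∀ x ∈ gr n, f x ∈ gr' (n + m)) (n : ℚ) (x : X) :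
    homProj h' (n + m) (f x) = f (homProj h n x) := by
  induction x using homogeneous_induction h with
  | zero => simp
  | add x y hx hy => simp only [map_add, hx, hy]
  | mem k x hx =>
    rw [homProj_apply h' _ (hf k x hx), homProj_apply h _ hx]
    by_cases hk : k = n
    · rw [if_pos hk, if_pos (by rw [hk])]
    · rw [if_neg hk, if_neg (by simpa using hk), map_zero]

lemma IsGr.comap {Y : Type*} [AddCommGroup Y] [Module ℂ Y] {gr' : ℚ → Submodule ℂ Y}
    (h : DirectSum.IsInternal gr) (h' : DirectSum.IsInternal gr') {f : X →ₗ[ℂ] Y}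
    (hf : ∀ n, ∀ x ∈ gr n, f x ∈ gr' n) {N : Submodule ℂ Y} (hN : IsGr gr' N) :
    IsGr gr (N.comap f) := by
  rw [isGr_iff h]
  rw [isGr_iff h'] at hN
  intro n x hx
  have := homProj_map h h' (f := f) (m := 0) (by simpa using hf) n x
  rw [add_zero] at this
  rw [Submodule.mem_comap, ← this]
  exact hN n _ hx

end Graded

/-! ### Graded modules for `V[g]` -/

section Rep

open VertexOperatorAlgebra FiniteOrderAut

variable {V : Type u} [AddCommGroup V] [Module ℂ V] [VertexOperatorAlgebra V]
  {g : FiniteOrderAut V} {X : Type*} [AddCommGroup X] [Module ℂ X]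

/-- A graded `V[g]`-module whose homogeneous subspaces of negative degree vanish. -/
structure IsGrRep (φ : g.Vg →ₗ[ℂ] Module.End ℂ X) (gr : ℚ → Submodule ℂ X) : Prop where
  lie : ∀ x y, φ ⁅x, y⁆ = φ x * φ y - φ y * φ x
  internal : DirectSum.IsInternal gr
  mode : ∀ (m n : ℚ), ∀ y ∈ g.degVg m, ∀ w ∈ gr n, φ y w ∈ gr (n + m)
  neg : ∀ n < 0, gr n = ⊥

variable (φ : g.Vg →ₗ[ℂ] Module.End ℂ X)

/-- Submodules. -/
def IsStable (N : Submodule ℂ X) : Prop := ∀ y, ∀ w ∈ N, φ y w ∈ N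

/-- The submodule generated by `S`. -/
def gen (S : Submodule ℂ X) : Submodule ℂ X := sInf {N | S ≤ N ∧ IsStable φ N}

/-- The closure of `S` under the elements of positive degree. -/
def posGen (S : Submodule ℂ X) : Submodule ℂ X :=
  sInf {N | S ≤ N ∧ ∀ n > 0, ∀ y ∈ g.degVg n, ∀ w ∈ N, φ y w ∈ N}

variable {φ}

lemma le_gen (S : Submodule ℂ X) : S ≤ gen φ S := le_sInf fun _ h => h.1

lemma gen_le {S N : Submodule ℂ X} (h : S ≤ N) (hN : IsStable φ N) : gen φ S ≤ N :=
  sInf_le ⟨h, hN⟩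

lemma gen_mono {S S' : Submodule ℂ X} (h : S ≤ S') : gen φ S ≤ gen φ S' :=
  le_sInf fun _ hN => gen_le (h.trans hN.1) hN.2

lemma gen_stable (S : Submodule ℂ X) : IsStable φ (gen φ S) := by
  intro y w hw
  rw [gen, Submodule.mem_sInf] at *
  exact fun N hN => hN.2 y w (hw N hN)

lemma isStable_of_degVg {N : Submodule ℂ X}
    (h : ∀ n, ∀ y ∈ g.degVg n, ∀ w ∈ N, φ y w ∈ N) : IsStable φ N := by
  intro y w hw
  have hy : y ∈ ⨆ n, g.degVg n := by rw [iSup_degVg]; trivial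
  induction hy using Submodule.iSup_induction' with
  | mem n x hx => exact h n x hx w hw
  | zero => simp
  | add x y _ _ hx hy => rw [map_add]; exact Submodule.add_mem _ hx hy

lemma isStable_sSup {s : Set (Submodule ℂ X)} (h : ∀ N ∈ s, IsStable φ N) :
    IsStable φ (sSup s) := by
  intro y
  have : sSup s ≤ (sSup s).comap (φ y) :=
    sSup_le fun N hN x hx => le_sSup hN (h N hN y x hx)
  exact fun w hw => this hw

lemma IsStable.inf {N N' : Submodule ℂ X} (h : IsStable φ N) (h' : IsStable φ N') :
    IsStable φ (N ⊓ N') := fun y w hw => ⟨h y w hw.1, h' y w hw.2⟩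

/-- This takes the place of the factorization `U(V[g]) = U(V[g]_+) U(V[g]_- ⊕ V[g]_0)`. The vectors
of `posGen φ S` that elements of degree `≤ 0` keep inside `posGen φ S` contain `S` and are closed
under positive degrees, so they exhaust it. -/
lemma gen_le_posGen (hφ : ∀ x y, φ ⁅x, y⁆ = φ x * φ y - φ y * φ x) {S : Submodule ℂ X}
    (hS : ∀ n ≤ 0, ∀ y ∈ g.degVg n, ∀ w ∈ S, φ y w ∈ S) : gen φ S ≤ posGen φ S := by
  have hSR : S ≤ posGen φ S := le_sInf fun _ h => h.1
  have hpos : ∀ n > 0, ∀ y ∈ g.degVg n, ∀ w ∈ posGen φ S, φ y w ∈ posGen φ S := by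
    intro n hn y hy w hw
    rw [posGen, Submodule.mem_sInf] at *
    exact fun N hN => hN.2 n hn y hy w (hw N hN)
  let Q : Submodule ℂ X :=
    { carrier := {w | w ∈ posGen φ S ∧ ∀ n ≤ 0, ∀ y ∈ g.degVg n, φ y w ∈ posGen φ S}
      add_mem' := fun ha hb => ⟨Submodule.add_mem _ ha.1 hb.1, fun n hn y hy => by
        rw [map_add]; exact Submodule.add_mem _ (ha.2 n hn y hy) (hb.2 n hn y hy)⟩
      zero_mem' := ⟨Submodule.zero_mem _, fun n hn y hy => by simp⟩
      smul_mem' := fun c x hx => ⟨Submodule.smul_mem _ _ hx.1, fun n hn y hy => by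
        rw [map_smul]; exact Submodule.smul_mem _ _ (hx.2 n hn y hy)⟩ }
  have hQ : posGen φ S ≤ Q := by
    refine sInf_le ⟨fun w hw => ⟨hSR hw, fun n hn y hy => hSR (hS n hn y hy w hw)⟩, ?_⟩
    rintro n hn y hy w ⟨hw1, hw2⟩
    refine ⟨hpos n hn y hy w hw1, fun m hm x hx => ?_⟩
    have e : φ x (φ y w) = φ ⁅x, y⁆ w + φ y (φ x w) := by
      rw [hφ]; simp
    rw [e]
    refine Submodule.add_mem _ ?_ (hpos n hn y hy _ (hw2 m hm x hx))
    -- The bracket may have either sign of degree, and both cases are controlled by the definition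
    -- of `Q`.
    rcases le_or_gt (m + n) 0 with h | h
    · exact hw2 _ h _ (lie_mem_degVg hx hy)
    · exact hpos _ h _ (lie_mem_degVg hx hy) w hw1
  refine gen_le hSR (isStable_of_degVg fun n y hy w hw => ?_)
  rcases le_or_gt n 0 with h | h
  · exact (hQ hw).2 n h y hy
  · exact hpos n h y hy w hw

variable {gr : ℚ → Submodule ℂ X}

lemma gen_isGr (hmode : ∀ (m n : ℚ), ∀ y ∈ g.degVg m, ∀ w ∈ gr n, φ y w ∈ gr (n + m))
    {S : Submodule ℂ X} (hS : IsGr gr S) : IsGr gr (gen φ S) := by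
  refine isGr_of_le (gen_le ?_ (isStable_of_degVg fun m y hy => ?_))
  · rw [hS]
    exact iSup_mono fun n => inf_le_inf_right _ (by rw [← hS]; exact le_gen S)
  · have : (⨆ n, gen φ S ⊓ gr n) ≤ (⨆ n, gen φ S ⊓ gr n).comap (φ y) :=
      iSup_le fun n w hw => Submodule.mem_iSup_of_mem (n + m)
        ⟨gen_stable S y w hw.1, hmode m n y hy w hw.2⟩
    exact fun w hw => this hw

/-- By `gen_le_posGen` only elements of positive degree have to be applied to `S`, and they move
degrees `≥ 0` into degrees `> 0`. -/
lemma gen_le_sup (hφ : ∀ x y, φ ⁅x, y⁆ = φ x * φ y - φ y * φ x)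
    (hmode : ∀ (m n : ℚ), ∀ y ∈ g.degVg m, ∀ w ∈ gr n, φ y w ∈ gr (n + m)) {S : Submodule ℂ X}
    (hS : ∀ n ≤ 0, ∀ y ∈ g.degVg n, ∀ w ∈ S, φ y w ∈ S) (h0 : S ≤ sumOver gr (0 ≤ ·)) :
    gen φ S ≤ S ⊔ sumOver gr (0 < ·) := by
  refine (gen_le_posGen hφ hS).trans (sInf_le ⟨le_sup_left, fun m hm y hy w hw => ?_⟩)
  have h1 : S ⊔ sumOver gr (0 < ·) ≤ sumOver gr (0 ≤ ·) :=
    sup_le h0 (sumOver_le fun n hn => le_sumOver (p := (0 ≤ ·)) (le_of_lt hn))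
  have h2 : sumOver gr (0 ≤ ·) ≤ (sumOver gr (0 < ·)).comap (φ y) :=
    sumOver_le fun n hn w hw => le_sumOver (p := (0 < ·)) (by linarith)
      (hmode m n y hy w hw)
  exact (le_sup_right : _ ≤ S ⊔ sumOver gr (0 < ·)) (h2 (h1 hw))

/-- The lowest weight vectors of a graded `V[g]`-module. -/
def lowest (φ : g.Vg →ₗ[ℂ] Module.End ℂ X) : Submodule ℂ X where
  carrier := {w | ∀ n < 0, ∀ y ∈ g.degVg n, φ y w = 0}
  add_mem' := fun ha hb n hn y hy => by rw [map_add, ha n hn y hy, hb n hn y hy, add_zero]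
  zero_mem' := fun _ _ _ _ => map_zero _
  smul_mem' := fun c _ ha n hn y hy => by rw [map_smul, ha n hn y hy, smul_zero]

/-- Graded modules that are generated in degree `0` and whose nonzero graded submodules meet the
subspace of degree `0`. -/
structure IsTight (φ : g.Vg →ₗ[ℂ] Module.End ℂ X) (gr : ℚ → Submodule ℂ X) : Prop where
  gen_zero : gen φ (gr 0) = ⊤
  eq_bot : ∀ N : Submodule ℂ X, IsStable φ N → IsGr gr N → N ⊓ gr 0 = ⊥ → N = ⊥

namespace IsGrRep

variable (R : IsGrRep φ gr)

include R

lemma indep : iSupIndep gr := R.internal.submodule_iSupIndep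

lemma eq_bot_of_le_pos {N : Submodule ℂ X} (h : N ≤ sumOver gr (0 < ·)) : N ⊓ gr 0 = ⊥ := by
  have h1 := sumOver_disjoint R.indep (p := (0 < ·)) (q := (· = 0)) fun n hn => hn.ne'
  rw [← disjoint_iff]
  exact h1.mono h (le_sumOver (p := (· = 0)) rfl)

/-- Without negative degrees, a graded subspace meets degree `0` trivially if and only if it lies in
positive degree. The second condition, unlike the first, visibly passes to sums and images. -/
lemma le_pos {N : Submodule ℂ X} (hN : IsGr gr N) (h : N ⊓ gr 0 = ⊥) : N ≤ sumOver gr (0 < ·) := by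
  rw [hN]
  refine iSup_le fun n => ?_
  rcases lt_trichotomy n 0 with hn | rfl | hn
  · rw [R.neg n hn]; simp
  · rw [h]; simp
  · exact inf_le_right.trans (le_sumOver (p := (0 < ·)) hn)

lemma le_nonneg (N : Submodule ℂ X) : N ≤ sumOver gr (0 ≤ ·) := by
  rw [show sumOver gr (0 ≤ ·) = ⊤ from ?_]
  · exact le_top
  · rw [eq_top_iff, ← R.internal.submodule_iSup_eq_top]
    refine iSup_le fun n => ?_
    rcases lt_or_ge n 0 with hn | hn
    · rw [R.neg n hn]; simp
    · exact le_sumOver (p := (0 ≤ ·)) hn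

/-- On a vector of degree `d`, the result of `v(n)` has degree `d + wt v - n - 1`, which is negative
for large `n`. -/
lemma trunc (v : V) (w : X) : ∃ N : ℚ, ∀ n, N ≤ n → φ (g.el n v) w = 0 := by
  induction v using g.hom_induction with
  | h0 => exact ⟨0, by simp⟩
  | hadd u v hu hv =>
    obtain ⟨N, hN⟩ := hu
    obtain ⟨N', hN'⟩ := hv
    refine ⟨max N N', fun n hn => ?_⟩
    rw [map_add, map_add, LinearMap.add_apply, hN n ((le_max_left _ _).trans hn),
      hN' n ((le_max_right _ _).trans hn), add_zero]
  | h k q v _ _ hk _ =>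
    induction w using homogeneous_induction R.internal with
    | zero => exact ⟨0, by simp⟩
    | add x y hx hy =>
      obtain ⟨N, hN⟩ := hx
      obtain ⟨N', hN'⟩ := hy
      refine ⟨max N N', fun n hn => ?_⟩
      rw [map_add, hN n ((le_max_left _ _).trans hn), hN' n ((le_max_right _ _).trans hn), add_zero]
    | mem d w hw =>
      refine ⟨d + k, fun n hn => ?_⟩
      have := R.mode _ d _ (el_mem_degVg (g := g) (q := n) hk rfl) w hw
      rw [R.neg _ (by linarith)] at this
      exact this

/-- If `S` consists of vectors of degree `0` then so does the degree `0` part of `gen S`. -/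
lemma gen_inf_zero {S : Submodule ℂ X} (h0 : S ≤ gr 0)
    (hS : ∀ y ∈ g.degVg 0, ∀ w ∈ S, φ y w ∈ S) : gen φ S ⊓ gr 0 = S := by
  apply le_antisymm _ (le_inf (le_gen S) h0)
  rintro x ⟨hx, hx0⟩
  have h1 : gen φ S ≤ S ⊔ sumOver gr (0 < ·) := by
    refine gen_le_sup R.lie R.mode (fun n hn y hy w hw => ?_) (R.le_nonneg S)
    rcases hn.eq_or_lt with rfl | hn
    · exact hS y hy w hw
    · have := R.mode n 0 y hy w (h0 hw)
      rw [R.neg _ (by linarith)] at this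
      rw [(Submodule.mem_bot ℂ).1 this]
      exact Submodule.zero_mem _
  obtain ⟨s, hs, t, ht, rfl⟩ := Submodule.mem_sup.1 (h1 hx)
  have h2 := R.eq_bot_of_le_pos (N := sumOver gr (0 < ·)) le_rfl
  have h3 : t ∈ sumOver gr (0 < ·) ⊓ gr 0 := ⟨ht, by simpa using Submodule.sub_mem _ hx0 (h0 hs)⟩
  rw [h2, Submodule.mem_bot] at h3
  rwa [h3, add_zero]

/-- Together with tightness this is the vanishing principle of the proof: such a graded `S` is zero
in a tight module. -/
lemma gen_pos {S : Submodule ℂ X} (hS : ∀ n ≤ 0, ∀ y ∈ g.degVg n, ∀ w ∈ S, φ y w ∈ S)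
    (h0 : S ≤ sumOver gr (0 < ·)) : gen φ S ≤ sumOver gr (0 < ·) :=
  (gen_le_sup R.lie R.mode hS (R.le_nonneg S)).trans (sup_le h0 le_rfl)

lemma isGr_gr (n : ℚ) : IsGr gr (gr n) :=
  isGr_of_le (le_iSup_of_le n (by simp))

lemma isGr_of_le_zero {S : Submodule ℂ X} (h0 : S ≤ gr 0) : IsGr gr S :=
  isGr_of_le (le_iSup_of_le 0 (by simp [h0]))

lemma zero_le_lowest : gr 0 ≤ lowest φ := by
  intro w hw n hn y hy
  have := R.mode n 0 y hy w hw
  rw [R.neg _ (by linarith)] at this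
  exact this

lemma lowest_stable {w : X} (hw : w ∈ lowest φ) {y : g.Vg} (hy : y ∈ g.degVg 0) :
    φ y w ∈ lowest φ := by
  intro n hn x hx
  have e : φ x (φ y w) = φ ⁅x, y⁆ w + φ y (φ x w) := by
    rw [R.lie]; simp
  rw [e, hw n hn x hx, map_zero, add_zero]
  exact hw _ (by linarith) _ (lie_mem_degVg hx hy)

lemma lowest_isGr : IsGr gr (lowest φ) := by
  rw [isGr_iff R.internal]
  intro n x hx m hm y hy
  rw [← homProj_map R.internal R.internal (f := φ y) (m := m) (fun k w hw => R.mode m k y hy w hw),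
    hx m hm y hy, map_zero]

/-- Lowest weight vectors of a degree `n > 0` are stable under `V[g]_0` and killed by `V[g]_-`. They
generate a graded submodule of positive degree, which tightness excludes. -/
lemma lowest_eq (ht : IsTight φ gr) : lowest φ = gr 0 := by
  apply le_antisymm _ R.zero_le_lowest
  rw [R.lowest_isGr]
  refine iSup_le fun n => ?_
  rcases lt_trichotomy n 0 with hn | rfl | hn
  · rw [R.neg n hn]; simp
  · exact inf_le_right
  · have h1 : gen φ (lowest φ ⊓ gr n) ≤ sumOver gr (0 < ·) := by
      refine R.gen_pos (fun m hm y hy w hw => ?_) (inf_le_right.trans (le_sumOver (p := (0 < ·)) hn))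
      rcases hm.eq_or_lt with rfl | hm
      · exact ⟨R.lowest_stable hw.1 hy, by simpa using R.mode 0 n y hy w hw.2⟩
      · rw [hw.1 m hm y hy]; exact Submodule.zero_mem _
    have h2 := ht.eq_bot _ (gen_stable _)
      (gen_isGr R.mode (IsGr.inf R.internal R.lowest_isGr (R.isGr_gr n))) (R.eq_bot_of_le_pos h1)
    have := le_gen (φ := φ) (lowest φ ⊓ gr n)
    rw [h2] at this
    exact this.trans bot_le

end IsGrRep

end Rep

/-! ### The Jacobi identity for spaces with a commutator formula -/

section Sequences

variable {X : Type*} [AddCommGroup X] [Module ℂ X]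

/-- Sequences with finitely many nonzero terms. -/
def Ev (f : ℕ → X) : Prop := ∃ N, ∀ i, N ≤ i → f i = 0

lemma Ev.smul {f : ℕ → X} (h : Ev f) (c : ℕ → ℂ) : Ev fun i => c i • f i := by
  obtain ⟨N, hN⟩ := h
  exact ⟨N, fun i hi => by simp only [hN i hi, smul_zero]⟩

lemma Ev.add {f f' : ℕ → X} (h : Ev f) (h' : Ev f') : Ev fun i => f i + f' i := by
  obtain ⟨N, hN⟩ := h
  obtain ⟨N', hN'⟩ := h'
  exact ⟨max N N', fun i hi => by simp only [hN i (by omega), hN' i (by omega), add_zero]⟩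

lemma fs_map {Y : Type*} [AddCommGroup Y] [Module ℂ Y] (F : X →ₗ[ℂ] Y) {f : ℕ → X} (h : Ev f) :
    F (∑ᶠ i, f i) = ∑ᶠ i, F (f i) := map_fs F h.choose_spec

lemma fs_add {f f' : ℕ → X} (h : Ev f) (h' : Ev f') :
    ∑ᶠ i, (f i + f' i) = ∑ᶠ i, f i + ∑ᶠ i, f' i := by
  obtain ⟨N, hN⟩ := h
  obtain ⟨N', hN'⟩ := h'
  rw [fs_range (N := max N N'), fs_range (N := max N N'), fs_range (N := max N N'),
    Finset.sum_add_distrib]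
  · intro i hi; exact hN' i (by omega)
  · intro i hi; exact hN i (by omega)
  · intro i hi; rw [hN i (by omega), hN' i (by omega), add_zero]

lemma fs_sub {f f' : ℕ → X} (h : Ev f) (h' : Ev f') :
    ∑ᶠ i, (f i - f' i) = ∑ᶠ i, f i - ∑ᶠ i, f' i := by
  have := fs_add h (h'.smul fun _ => -1)
  simp only [neg_smul, one_smul, ← sub_eq_add_neg, finsum_neg_distrib] at this
  exact this

lemma fs_pascal (α : ℂ) {f : ℕ → X} (h : Ev f) : ∑ᶠ i : ℕ, Ring.choose (α + 1) i • f i =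
    ∑ᶠ i : ℕ, Ring.choose α i • f i + ∑ᶠ i : ℕ, Ring.choose α i • f (i + 1) := by
  obtain ⟨N, hN⟩ := h
  rw [fs_range (N := N + 1), fs_range (N := N + 1), fs_range (N := N), Finset.sum_range_succ',
    Finset.sum_range_succ' (n := N)]
  · simp only [Ring.choose_succ_succ, add_smul, Finset.sum_add_distrib, Ring.choose_zero_right]
    abel
  · intro i hi; rw [hN _ (by omega), smul_zero]
  · intro i hi; rw [hN _ (by omega), smul_zero]
  · intro i hi; rw [hN _ (by omega), smul_zero]

lemma fs_pascal_alt (α : ℂ) {f : ℕ → X} (h : Ev f) :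
    ∑ᶠ i : ℕ, ((-1 : ℂ) ^ i * Ring.choose (α + 1) i) • f i =
      ∑ᶠ i : ℕ, ((-1 : ℂ) ^ i * Ring.choose α i) • f i -
        ∑ᶠ i : ℕ, ((-1 : ℂ) ^ i * Ring.choose α i) • f (i + 1) := by
  have := fs_pascal α (h.smul fun i => (-1 : ℂ) ^ i)
  simp only [smul_smul, pow_succ, mul_neg, mul_one, neg_smul, smul_neg, finsum_neg_distrib,
    ← sub_eq_add_neg] at this
  simpa only [mul_comm] using this

lemma fs_deriv (α : ℂ) {f : ℕ → X} (h : Ev f) : ∑ᶠ i : ℕ, ((i : ℂ) * Ring.choose (α + 1) i) • f i =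
    (α + 1) • ∑ᶠ i : ℕ, Ring.choose α i • f (i + 1) := by
  obtain ⟨N, hN⟩ := h
  rw [fs_range (N := N + 1), fs_range (N := N), Finset.sum_range_succ', Finset.smul_sum]
  · simp only [Nat.cast_zero, zero_mul, zero_smul, add_zero, Nat.cast_add, Nat.cast_one,
      FiniteOrderAut.succ_mul_choose, mul_smul]
  · intro i hi; rw [hN _ (by omega), smul_zero]
  · intro i hi; rw [hN _ (by omega), smul_zero]

lemma fs_deriv_alt (α : ℂ) {f : ℕ → X} (h : Ev f) :
    ∑ᶠ i : ℕ, ((-1 : ℂ) ^ i * ((i : ℂ) * Ring.choose (α + 1) i)) • f i =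
      -((α + 1) • ∑ᶠ i : ℕ, ((-1 : ℂ) ^ i * Ring.choose α i) • f (i + 1)) := by
  have := fs_deriv α (h.smul fun i => (-1 : ℂ) ^ i)
  simp only [smul_smul, pow_succ, mul_neg, mul_one, neg_smul, finsum_neg_distrib, smul_neg] at this
  simpa only [mul_comm, mul_left_comm] using this

/-- Double sequences that vanish if one of the indices is large. -/
def Ev₂ (f : ℕ → ℕ → X) : Prop := ∃ N, ∀ i j, N ≤ i ∨ N ≤ j → f i j = 0

lemma ev₂_of {f : ℕ → ℕ → X} (h1 : ∃ N, ∀ i j, N ≤ i → f i j = 0) (h2 : ∀ i, Ev (f i)) : Ev₂ f := by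
  obtain ⟨N, hN⟩ := h1
  choose M hM using h2
  refine ⟨max N ((Finset.range N).sup M), fun i j hij => ?_⟩
  by_cases hi : N ≤ i
  · exact hN i j hi
  · have h3 : M i ≤ (Finset.range N).sup M := Finset.le_sup (by simpa using hi)
    exact hM i j (by omega)

lemma ev₂_of' {f : ℕ → ℕ → X} (h1 : ∃ N, ∀ i j, N ≤ j → f i j = 0) (h2 : ∀ j, Ev fun i => f i j) :
    Ev₂ f := by
  obtain ⟨N, hN⟩ := ev₂_of (f := fun j i => f i j)
    (by obtain ⟨N, hN⟩ := h1; exact ⟨N, fun i j hij => hN j i hij⟩) h2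
  exact ⟨N, fun i j hij => hN j i hij.symm⟩

lemma Ev₂.smul {f : ℕ → ℕ → X} (h : Ev₂ f) (c : ℕ → ℕ → ℂ) : Ev₂ fun i j => c i j • f i j := by
  obtain ⟨N, hN⟩ := h
  exact ⟨N, fun i j hij => by simp only [hN i j hij, smul_zero]⟩

lemma Ev₂.comm {f : ℕ → ℕ → X} (h : Ev₂ f) : ∑ᶠ i, ∑ᶠ j, f i j = ∑ᶠ j, ∑ᶠ i, f i j :=
  fs_comm h.choose_spec

lemma Ev₂.row {f : ℕ → ℕ → X} (h : Ev₂ f) (i : ℕ) : Ev (f i) := by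
  obtain ⟨N, hN⟩ := h
  exact ⟨N, fun j hj => hN i j (Or.inr hj)⟩

lemma Ev₂.sum {f : ℕ → ℕ → X} (h : Ev₂ f) : Ev fun i => ∑ᶠ j, f i j := by
  obtain ⟨N, hN⟩ := h
  exact ⟨N, fun i hi => finsum_eq_zero_of_forall_eq_zero fun j => hN i j (Or.inl hi)⟩

lemma Ev₂.flip {f : ℕ → ℕ → X} (h : Ev₂ f) : Ev₂ fun j i => f i j := by
  obtain ⟨N, hN⟩ := h
  exact ⟨N, fun i j hij => hN j i hij.symm⟩

/-- Interchange of weighted sums. -/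
lemma Ev₂.smul_comm {f : ℕ → ℕ → X} (h : Ev₂ f) (c d : ℕ → ℂ) :
    ∑ᶠ i, c i • ∑ᶠ j, d j • f i j = ∑ᶠ j, d j • ∑ᶠ i, c i • f i j := by
  simp only [smul_finsum, smul_smul]
  rw [Ev₂.comm (h.smul fun i j => c i * d j)]
  simp only [mul_comm]

end Sequences

/-! ### The Jacobi defect and its recursion in the exponent of `z₀` -/

section Defect

open VertexOperatorAlgebra FiniteOrderAut

variable {V : Type u} [AddCommGroup V] [Module ℂ V] [VertexOperatorAlgebra V]
  {g : FiniteOrderAut V} {X : Type*} [AddCommGroup X] [Module ℂ X]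

/-- Modes on `X` that satisfy the truncation property, the commutator formula and the
`L(-1)`-derivative property. -/
structure HasCommutator (g : FiniteOrderAut V) (Y : V →ₗ[ℂ] (ℚ → Module.End ℂ X)) : Prop where
  trunc : ∀ (v : V) (w : X), ∃ N : ℚ, ∀ n, N ≤ n → Y v n w = 0
  comm : ∀ (p : ℚ) (c : V), c ∈ g.eig p → ∀ (v : V) (n : ℚ) (w : X),
    Y c p (Y v n w) = Y v n (Y c p w) +
      ∑ᶠ i : ℕ, Ring.choose (p : ℂ) i • Y (md c i v) (p + n - i) w
  deriv : ∀ (v : V) (n : ℚ), Y (md omega 0 v) n = -(n : ℂ) • Y v (n - 1)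

variable (Y : V →ₗ[ℂ] (ℚ → Module.End ℂ X))

/-- `∑ C(m,i) (a_{l+i} b)_{m+n-i} w` -/
def iterSum (l : ℤ) (m n : ℚ) (a b : V) (w : X) : X :=
  ∑ᶠ i : ℕ, Ring.choose (m : ℂ) i • Y (md a (l + i) b) (m + n - i) w

/-- `∑ (-1)^i C(l,i) a_{l+m-i} b_{n+i} w` -/
def prodSum (l : ℤ) (m n : ℚ) (a b : V) (w : X) : X :=
  ∑ᶠ i : ℕ, ((-1 : ℂ) ^ i * Ring.choose (l : ℂ) i) • Y a (l + m - i) (Y b (n + i) w)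

/-- The difference of the two sides of the Jacobi identity. -/
def defect (l : ℤ) (m n : ℚ) (a b : V) (w : X) : X :=
  iterSum Y l m n a b w - (prodSum Y l m n a b w - (-1 : ℂ) ^ l • prodSum Y l n m b a w)

variable {Y} (H : HasCommutator g Y)

include H

lemma HasCommutator.ev (v : V) (n : ℚ) (w : X) : Ev fun i : ℕ => Y v (n + i) w := by
  obtain ⟨N, hN⟩ := H.trunc v w
  refine ⟨⌈N - n⌉.toNat, fun i hi => hN _ ?_⟩
  have h1 : (⌈N - n⌉ : ℤ) ≤ i := by omega
  have h2 := Int.ceil_le.1 h1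
  push_cast at h2
  linarith

omit H in
lemma md_ev (a b : V) (l : ℤ) : Ev fun i : ℕ => md a (l + i) b := by
  obtain ⟨N, hN⟩ := md_trunc a b
  exact ⟨(N - l).toNat, fun i hi => hN _ (by omega)⟩

omit H in
lemma md_ev_nat (a b : V) : Ev fun i : ℕ => md a i b := md_nat_trunc a b

omit H in
lemma iter_ev (l : ℤ) (k : ℚ) (a b : V) (w : X) : Ev fun i : ℕ => Y (md a (l + i) b) (k - i) w := by
  obtain ⟨N, hN⟩ := md_ev a b l
  exact ⟨N, fun i hi => by simp [hN i hi]⟩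

lemma prod_ev (k n : ℚ) (a b : V) (w : X) : Ev fun i : ℕ => Y a (k - i) (Y b (n + i) w) := by
  obtain ⟨N, hN⟩ := H.ev b n w
  exact ⟨N, fun i hi => by simp only [hN i hi, map_zero]⟩

/-- The defect is the difference of the two sides of the Jacobi identity. -/
lemma defect_eq (l : ℤ) (m n : ℚ) (a b : V) (w : X) : defect Y l m n a b w =
    ∑ᶠ i : ℕ, Ring.choose (m : ℂ) i • Y (md a (l + i) b) (m + n - i) w -
    ∑ᶠ i : ℕ, ((-1 : ℂ) ^ i * Ring.choose (l : ℂ) i) •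
      (Y a (l + m - i) (Y b (n + i) w) - (-1 : ℂ) ^ l • Y b (l + n - i) (Y a (m + i) w)) := by
  rw [defect, iterSum, prodSum, prodSum, smul_finsum]
  have e := fs_sub ((prod_ev H (l + m) n a b w).smul fun i => (-1 : ℂ) ^ i * Ring.choose (l : ℂ) i)
    (((prod_ev H (l + n) m b a w).smul fun i => (-1 : ℂ) ^ i * Ring.choose (l : ℂ) i).smul
      fun _ => (-1 : ℂ) ^ l)
  rw [← e]
  congr 1
  apply finsum_congr
  intro i
  rw [smul_sub, smul_comm]

omit H in
lemma iterSum_succ (l : ℤ) (m n : ℚ) (a b : V) (w : X) : iterSum Y l (m + 1) n a b w =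
    iterSum Y l m (n + 1) a b w + iterSum Y (l + 1) m n a b w := by
  have := fs_pascal (m : ℂ) (iter_ev (Y := Y) l (m + 1 + n) a b w)
  rw [iterSum, iterSum, iterSum]
  push_cast at this ⊢
  rw [this]
  congr 1
  · simp only [add_right_comm m 1 n, ← add_assoc]
  · apply finsum_congr
    intro i
    rw [show l + ((i : ℤ) + 1) = l + 1 + i by ring, show m + 1 + n - ((i : ℚ) + 1) = m + n - i by ring]

lemma prodSum_succ (l : ℤ) (m n : ℚ) (a b : V) (w : X) : prodSum Y (l + 1) m n a b w =
    prodSum Y l (m + 1) n a b w - prodSum Y l m (n + 1) a b w := by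
  have := fs_pascal_alt (l : ℂ) (prod_ev H (l + 1 + m) n a b w)
  rw [prodSum, prodSum, prodSum]
  push_cast at this ⊢
  rw [this]
  congr 1
  · apply finsum_congr
    intro i
    rw [show (l : ℚ) + 1 + m - i = l + (m + 1) - i by ring]
  · apply finsum_congr
    intro i
    rw [show (l : ℚ) + 1 + m - (i + 1) = l + m - i by ring,
      show n + ((i : ℚ) + 1) = n + 1 + i by ring]

/-- Coefficient form of multiplication by `z₀ = z₁ - z₂`; on each side it is Pascal's rule. -/
lemma defect_succ (l : ℤ) (m n : ℚ) (a b : V) (w : X) : defect Y (l + 1) m n a b w =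
    defect Y l (m + 1) n a b w - defect Y l m (n + 1) a b w := by
  rw [defect, defect, defect, iterSum_succ, prodSum_succ H, prodSum_succ H,
    zpow_add_one₀ (by norm_num : (-1 : ℂ) ≠ 0)]
  module

/-- For `l = 0` each product sum has a single term, and the Jacobi identity becomes the commutator
formula. -/
lemma defect_zero {m : ℚ} {a : V} (ha : a ∈ g.eig m) (n : ℚ) (b : V) (w : X) :
    defect Y 0 m n a b w = 0 := by
  have e : ∀ (m n : ℚ) (a b : V), prodSum Y 0 m n a b w = Y a m (Y b n w) := by
    intro m n a b
    rw [prodSum, fs_range (N := 1)]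
    · simp
    · intro i hi
      obtain ⟨j, rfl⟩ : ∃ j, i = j + 1 := ⟨i - 1, by omega⟩
      rw [choose_int_zero, mul_zero, zero_smul]
  rw [defect, e, e, H.comm m a ha, iterSum]
  simp

omit H in
lemma choose_sub_one_mul (α : ℂ) (i : ℕ) :
    (α - i) * Ring.choose α i = α * Ring.choose (α - 1) i := by
  have h := succ_mul_choose (α - 1) i
  rw [sub_add_cancel] at h
  have h2 := Ring.choose_succ_succ (α - 1) i
  rw [sub_add_cancel] at h2
  have h3 := choose_mul α i 1
  rw [Ring.choose_one_right, Nat.choose_succ_self_right] at h3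
  push_cast at h3
  linear_combination h - h3

lemma iterSum_deriv (l : ℤ) (m n : ℚ) (a b : V) (w : X) :
    iterSum Y l m n (md omega 0 a) b w =
      -(l : ℂ) • iterSum Y (l - 1) m n a b w - (m : ℂ) • iterSum Y l (m - 1) n a b w := by
  have h1 := iter_ev (Y := Y) (l - 1) (m + n) a b w
  have h2 := fs_deriv ((m : ℂ) - 1) h1
  rw [sub_add_cancel] at h2
  have h3 : (m : ℂ) • iterSum Y l (m - 1) n a b w = ∑ᶠ i : ℕ, ((i : ℂ) * Ring.choose (m : ℂ) i) •
      Y (md a (l - 1 + i) b) (m + n - i) w := by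
    rw [h2, iterSum]
    congr 1
    apply finsum_congr
    intro i
    push_cast
    rw [show l - 1 + ((i : ℤ) + 1) = l + i by ring,
      show m + n - ((i : ℚ) + 1) = m - 1 + n - i by ring]
  rw [h3, iterSum, iterSum, smul_finsum, ← fs_sub ((h1.smul fun i => _).smul fun _ => _) (h1.smul _)]
  apply finsum_congr
  intro i
  rw [md_deriv, show l + (i : ℤ) - 1 = l - 1 + i by ring]
  simp only [LinearMap.smul_apply, map_smul, Pi.smul_apply]
  push_cast
  module

lemma prodSum_deriv_left (l : ℤ) (m n : ℚ) (a b : V) (w : X) :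
    prodSum Y l m n (md omega 0 a) b w =
      -(l : ℂ) • prodSum Y (l - 1) m n a b w - (m : ℂ) • prodSum Y l (m - 1) n a b w := by
  have h1 := prod_ev H (l - 1 + m) n a b w
  have e : ∀ i : ℕ, (l : ℚ) + (m - 1) - i = l - 1 + m - i := fun i => by ring
  rw [prodSum, prodSum, prodSum]
  push_cast
  simp only [e]
  rw [smul_finsum, smul_finsum, ← fs_sub ((h1.smul fun i => _).smul fun _ => _)
    ((h1.smul fun i => _).smul fun _ => _)]
  apply finsum_congr
  intro i
  rw [H.deriv, show (l : ℚ) + m - i - 1 = l - 1 + m - i by ring]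
  have h := choose_sub_one_mul (l : ℂ) i
  simp only [LinearMap.smul_apply, smul_smul, ← sub_smul]
  congr 1
  push_cast
  linear_combination (-(-1 : ℂ) ^ i) * h

lemma prodSum_deriv_right (l : ℤ) (m n : ℚ) (a b : V) (w : X) :
    prodSum Y l n m b (md omega 0 a) w =
      (l : ℂ) • prodSum Y (l - 1) n m b a w - (m : ℂ) • prodSum Y l n (m - 1) b a w := by
  have h1 := prod_ev H (l + n) (m - 1) b a w
  have h2 := fs_deriv_alt ((l : ℂ) - 1) h1
  rw [sub_add_cancel] at h2
  have h3 : (l : ℂ) • prodSum Y (l - 1) n m b a w = -∑ᶠ i : ℕ, ((-1 : ℂ) ^ i *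
      ((i : ℂ) * Ring.choose (l : ℂ) i)) • Y b (l + n - i) (Y a (m - 1 + i) w) := by
    rw [h2, prodSum, neg_neg]
    congr 1
    push_cast
    apply finsum_congr
    intro i
    rw [show (l : ℚ) - 1 + n - i = l + n - (i + 1) by ring,
      show m - 1 + ((i : ℚ) + 1) = m + i by ring]
  rw [h3, ← finsum_neg_distrib, prodSum, prodSum, smul_finsum,
    ← fs_sub (by simpa only [neg_smul, one_smul] using (h1.smul fun i => _).smul fun _ => -1)
      ((h1.smul fun i => _).smul fun _ => _)]
  apply finsum_congr
  intro i
  rw [H.deriv, show m + (i : ℚ) - 1 = m - 1 + i by ring]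
  simp only [LinearMap.smul_apply, map_smul]
  push_cast
  module

/-- Replacing `a` by `L(-1) a` differentiates the identity. The term in which `l` drops carries the
factor `-l`, so it can be solved for whenever `l ≠ 0`. -/
lemma defect_deriv (l : ℤ) (m n : ℚ) (a b : V) (w : X) : defect Y l m n (md omega 0 a) b w =
    -(l : ℂ) • defect Y (l - 1) m n a b w - (m : ℂ) • defect Y l (m - 1) n a b w := by
  rw [defect, defect, defect, iterSum_deriv H, prodSum_deriv_left H, prodSum_deriv_right H,
    zpow_sub_one₀ (by norm_num : (-1 : ℂ) ≠ 0)]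
  norm_num
  module

/-- The Jacobi identity follows from its case `l = -1`. -/
lemma defect_eq_zero {w : X} (h : ∀ (m : ℚ) (a : V), a ∈ g.eig m → ∀ (n : ℚ) (b : V),
    defect Y (-1) m n a b w = 0) (l : ℤ) : ∀ (m : ℚ) (a : V), a ∈ g.eig m → ∀ (n : ℚ) (b : V),
    defect Y l m n a b w = 0 := by
  have hsucc : ∀ {m : ℚ} {a : V}, a ∈ g.eig m → a ∈ g.eig (m + 1) := by
    intro m a ha
    have := g.eig_add_int m 1
    push_cast at this
    rwa [this]
  have hpred : ∀ {m : ℚ} {a : V}, a ∈ g.eig m → a ∈ g.eig (m - 1) := by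
    intro m a ha
    have := eig_sub_nat (g := g) m 1
    push_cast at this
    rwa [this]
  -- Downwards from `-1` the factor `-l` never vanishes. From `l = 0` this descent would be blocked,
  -- which is why `l = -1` has to be assumed.
  have hneg : ∀ t : ℕ, ∀ (m : ℚ) (a : V), a ∈ g.eig m → ∀ (n : ℚ) (b : V),
      defect Y (-1 - t) m n a b w = 0 := by
    intro t
    induction t with
    | zero => intro m a ha n b; simpa using h m a ha n b
    | succ t ih =>
      intro m a ha n b
      have e := defect_deriv H (-1 - t) m n a b w
      rw [ih m _ (deriv_eig ha), ih _ a (hpred ha), smul_zero, sub_zero] at e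
      have hne : (-((-1 - t : ℤ) : ℂ)) ≠ 0 := by
        rw [neg_ne_zero]
        exact_mod_cast (show (-1 - t : ℤ) ≠ 0 by omega)
      have := (smul_eq_zero.1 e.symm).resolve_left hne
      rwa [show (-1 - (t : ℤ) - 1) = -1 - ((t + 1 : ℕ) : ℤ) by push_cast; ring] at this
  have hpos : ∀ t : ℕ, ∀ (m : ℚ) (a : V), a ∈ g.eig m → ∀ (n : ℚ) (b : V),
      defect Y t m n a b w = 0 := by
    intro t
    induction t with
    | zero => intro m a ha n b; exact defect_zero H ha n b w
    | succ t ih =>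
      intro m a ha n b
      push_cast
      rw [defect_succ H, ih _ a (hsucc ha), ih m a ha, sub_zero]
  rcases le_or_gt 0 l with hl | hl
  · obtain ⟨t, rfl⟩ := Int.eq_ofNat_of_zero_le hl
    exact hpos t
  · obtain ⟨t, ht⟩ := Int.eq_ofNat_of_zero_le (show 0 ≤ -1 - l by omega)
    obtain rfl : l = -1 - t := by omega
    exact hneg t

end Defect

/-! ### The commutator of a mode with the Jacobi defect -/

section DefectComm

open VertexOperatorAlgebra FiniteOrderAut

variable {V : Type u} [AddCommGroup V] [Module ℂ V] [VertexOperatorAlgebra V]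
  {g : FiniteOrderAut V} {X : Type*} [AddCommGroup X] [Module ℂ X]
  {Y : V →ₗ[ℂ] (ℚ → Module.End ℂ X)}

/-- The commutator formula is applied to each factor of each product, and the two summations are
then interchanged. All double sums are finite by truncation. -/
lemma comm_prodSum (H : HasCommutator g Y) {p : ℚ} {c : V} (hc : c ∈ g.eig p) (l : ℤ) (m n : ℚ)
    (a b : V) (w : X) : Y c p (prodSum Y l m n a b w) = prodSum Y l m n a b (Y c p w) +
      ∑ᶠ j : ℕ, Ring.choose (p : ℂ) j • (prodSum Y l (p + m - j) n (md c j a) b w +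
        prodSum Y l m (p + n - j) a (md c j b) w) := by
  have hF : Ev₂ fun i j : ℕ => Y (md c j a) (p + (l + m - i) - j) (Y b (n + i) w) := by
    apply ev₂_of'
    · obtain ⟨N, hN⟩ := md_ev_nat c a
      exact ⟨N, fun i j hj => by simp [hN j hj]⟩
    · intro j
      obtain ⟨N, hN⟩ := H.ev b n w
      exact ⟨N, fun i hi => by simp only [hN i hi, map_zero]⟩
  have hG : Ev₂ fun i j : ℕ => Y a (l + m - i) (Y (md c j b) (p + (n + i) - j) w) := by
    apply ev₂_of'
    · obtain ⟨N, hN⟩ := md_ev_nat c b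
      exact ⟨N, fun i j hj => by simp [hN j hj]⟩
    · intro j
      obtain ⟨N, hN⟩ := H.ev (md c j b) (p + n - j) w
      exact ⟨N, fun i hi => by
        have := hN i hi
        beta_reduce at this
        rw [show p + n - j + (i : ℚ) = p + (n + i) - j by ring] at this
        simp only [this, map_zero]⟩
  let κ : ℕ → ℂ := fun i => (-1 : ℂ) ^ i * Ring.choose (l : ℂ) i
  have e1 : ∀ i : ℕ, Y c p (κ i • Y a (l + m - i) (Y b (n + i) w)) =
      κ i • Y a (l + m - i) (Y b (n + i) (Y c p w)) +
      (κ i • ∑ᶠ j : ℕ, Ring.choose (p : ℂ) j • Y (md c j a) (p + (l + m - i) - j) (Y b (n + i) w) +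
      κ i • ∑ᶠ j : ℕ, Ring.choose (p : ℂ) j • Y a (l + m - i) (Y (md c j b) (p + (n + i) - j) w)) := by
    intro i
    rw [map_smul, H.comm p c hc, H.comm p c hc, map_add, fs_map]
    · simp only [map_smul]
      module
    · obtain ⟨N, hN⟩ := md_ev_nat c b
      exact ⟨N, fun j hj => by simp [hN j hj]⟩
  have h1 := (hF.smul fun i j => κ i * Ring.choose (p : ℂ) j).sum
  have h2 := (hG.smul fun i j => κ i * Ring.choose (p : ℂ) j).sum
  simp only [mul_smul, ← smul_finsum] at h1 h2
  rw [prodSum, fs_map _ ((prod_ev H (l + m) n a b w).smul κ)]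
  rw [finsum_congr e1, fs_add ((prod_ev H (l + m) n a b _).smul κ), fs_add h1 h2,
    hF.smul_comm κ fun j => Ring.choose (p : ℂ) j, hG.smul_comm κ fun j => Ring.choose (p : ℂ) j]
  · have h3 := (hF.flip.smul fun j i => Ring.choose (p : ℂ) j * κ i).sum
    have h4 := (hG.flip.smul fun j i => Ring.choose (p : ℂ) j * κ i).sum
    simp only [mul_smul, ← smul_finsum] at h3 h4
    rw [← fs_add h3 h4]
    congr 1
    apply finsum_congr
    intro j
    rw [smul_add]
    congr 2
    · apply finsum_congr
      intro i
      rw [show p + (l + m - (i : ℚ)) - j = l + (p + m - j) - i by ring]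
    · apply finsum_congr
      intro i
      rw [show p + (n + (i : ℚ)) - j = p + n - j + i by ring]
  · exact h1.add h2

/-- `c_j (a_k b) = a_k (c_j b) + ∑ C(j,t) (c_t a)_{k+j-t} b` -/
lemma md_md_comm (c a b : V) (j : ℕ) (k : ℤ) : md c j (md a k b) = md a k (md c j b) +
    ∑ x ∈ Finset.HasAntidiagonal.antidiagonal j, ((j.choose x.1 : ℕ) : ℂ) •
      md (md c x.1 a) (k + x.2) b := by
  have h := md_comm c a b j k
  rw [sub_eq_iff_eq_add, fs_range (N := j + 1)] at h
  · rw [h, add_comm, Finset.Nat.sum_antidiagonal_eq_sum_range_succ_mk]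
    congr 1
    apply Finset.sum_congr rfl
    intro i hi
    have hi' : i ≤ j := by simpa [Nat.lt_succ_iff] using hi
    rw [Int.cast_natCast, Ring.choose_natCast]
    congr 3
    push_cast [hi']
    ring
  · intro i hi
    rw [Int.cast_natCast, Ring.choose_natCast, Nat.choose_eq_zero_of_lt (by omega)]
    simp

/-- The commutator produces `c_j (a_{l+i} b)`, which `md_md_comm` splits into `a_{l+i} (c_j b)` and
terms `(c_t a)_{l+i+s} b` with `t + s = j`. For the latter, `C(p, t+s) C(t+s, t) = C(p, t) C(p-t,
s)`, and Vandermonde combines `C(m, i) C(p-t, s)` into `C(p+m-t, i+s)`, the coefficients of an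
`iterSum` for `c_t a`. -/
lemma comm_iterSum (H : HasCommutator g Y) {p : ℚ} {c : V} (hc : c ∈ g.eig p) (l : ℤ) (m n : ℚ)
    (a b : V) (w : X) : Y c p (iterSum Y l m n a b w) = iterSum Y l m n a b (Y c p w) +
      ∑ᶠ j : ℕ, Ring.choose (p : ℂ) j • (iterSum Y l (p + m - j) n (md c j a) b w +
        iterSum Y l m (p + n - j) a (md c j b) w) := by
  have hG : Ev₂ fun i j : ℕ => Y (md a (l + i) (md c j b)) (p + (m + n - i) - j) w := by
    apply ev₂_of'
    · obtain ⟨N, hN⟩ := md_ev_nat c b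
      exact ⟨N, fun i j hj => by simp [hN j hj]⟩
    · intro j
      obtain ⟨N, hN⟩ := md_ev a (md c j b) l
      exact ⟨N, fun i hi => by simp [hN i hi]⟩
  have hK : Ev₂ fun t s : ℕ => Y (md (md c t a) (l + s) b) (p + m + n - t - s) w := by
    apply ev₂_of
    · obtain ⟨N, hN⟩ := md_ev_nat c a
      exact ⟨N, fun i j hj => by simp [hN i hj, md_zero]⟩
    · intro t
      obtain ⟨N, hN⟩ := md_ev (md c t a) b l
      exact ⟨N, fun i hi => by simp [hN i hi]⟩
  obtain ⟨N, hN⟩ := hK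
  beta_reduce at hN
  -- the part that comes from `[c_j, a_{l+i}] b`
  let F : ℕ → X := fun i => ∑ᶠ t : ℕ, ∑ᶠ s : ℕ, (Ring.choose (p : ℂ) t * Ring.choose ((p : ℂ) - t) s) •
    Y (md (md c t a) (l + (i + s : ℕ)) b) (p + m + n - t - (i + s : ℕ)) w
  have hF : Ev F := ⟨N, fun i hi => finsum_eq_zero_of_forall_eq_zero fun t =>
    finsum_eq_zero_of_forall_eq_zero fun s => by rw [hN t (i + s) (by omega), smul_zero]⟩
  have e0 : ∀ i : ℕ, ∑ᶠ j : ℕ, Ring.choose (p : ℂ) j • Y (md c j (md a (l + i) b))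
      (p + (m + n - i) - j) w =
      ∑ᶠ j : ℕ, Ring.choose (p : ℂ) j • Y (md a (l + i) (md c j b)) (p + (m + n - i) - j) w + F i := by
    intro i
    have h5 := fs_trinomial (p : ℂ) (G := fun t s : ℕ =>
      Y (md (md c t a) (l + (i + s : ℕ)) b) (p + m + n - t - (i + s : ℕ)) w) (N := N)
      (fun t s hts => hN t (i + s) (by omega))
    have h6 : Ev fun j : ℕ => Ring.choose (p : ℂ) j • ∑ x ∈ Finset.HasAntidiagonal.antidiagonal j,
        ((j.choose x.1 : ℕ) : ℂ) • Y (md (md c x.1 a) (l + (i + x.2 : ℕ)) b)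
          (p + m + n - x.1 - (i + x.2 : ℕ)) w := by
      refine ⟨2 * N, fun j hj => ?_⟩
      beta_reduce
      rw [Finset.sum_eq_zero, smul_zero]
      rintro ⟨t, s⟩ hx
      simp only [Finset.HasAntidiagonal.mem_antidiagonal] at hx
      rw [hN t (i + s) (by omega), smul_zero]
    simp only [F]
    rw [← h5, ← fs_add ((hG.row i).smul _) h6]
    apply finsum_congr
    intro j
    rw [← smul_add, md_md_comm, map_add, Pi.add_apply, LinearMap.add_apply]
    congr 2
    rw [map_sum, Finset.sum_apply, LinearMap.sum_apply]
    apply Finset.sum_congr rfl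
    rintro ⟨t, s⟩ hx
    simp only [Finset.HasAntidiagonal.mem_antidiagonal] at hx
    subst hx
    rw [map_smul, Pi.smul_apply, LinearMap.smul_apply]
    simp only
    rw [show l + (i : ℤ) + s = l + ((i + s : ℕ) : ℤ) by push_cast; ring,
      show p + (m + n - (i : ℚ)) - ((t + s : ℕ) : ℚ) = p + m + n - t - ((i + s : ℕ) : ℚ) by
        push_cast; ring]
  have e1 : ∀ i : ℕ, Y c p (Ring.choose (m : ℂ) i • Y (md a (l + i) b) (m + n - i) w) =
      Ring.choose (m : ℂ) i • Y (md a (l + i) b) (m + n - i) (Y c p w) +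
      (Ring.choose (m : ℂ) i • F i + Ring.choose (m : ℂ) i • ∑ᶠ j : ℕ, Ring.choose (p : ℂ) j •
        Y (md a (l + i) (md c j b)) (p + (m + n - i) - j) w) := by
    intro i
    rw [map_smul, H.comm p c hc, e0]
    module
  -- Vandermonde
  have e2 : ∑ᶠ i : ℕ, Ring.choose (m : ℂ) i • F i =
      ∑ᶠ t : ℕ, Ring.choose (p : ℂ) t • iterSum Y l (p + m - t) n (md c t a) b w := by
    have h7 : ∀ i, F i = ∑ᶠ t : ℕ, Ring.choose (p : ℂ) t • ∑ᶠ s : ℕ, Ring.choose ((p : ℂ) - t) s •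
        Y (md (md c t a) (l + (i + s : ℕ)) b) (p + m + n - t - (i + s : ℕ)) w := by
      intro i
      simp only [F, mul_smul, ← smul_finsum]
    have h8 : Ev₂ fun i t : ℕ => ∑ᶠ s : ℕ, Ring.choose ((p : ℂ) - t) s •
        Y (md (md c t a) (l + (i + s : ℕ)) b) (p + m + n - t - (i + s : ℕ)) w :=
      ⟨N, fun i t hit => finsum_eq_zero_of_forall_eq_zero fun s => by
        rw [hN t (i + s) (by omega), smul_zero]⟩
    simp only [h7]
    rw [h8.smul_comm]
    apply finsum_congr
    intro t
    congr 1
    have h9 := fs_vandermonde (m : ℂ) ((p : ℂ) - t)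
      (f := fun s : ℕ => Y (md (md c t a) (l + s) b) (p + m + n - t - s) w) (N := N)
      (fun s hs => hN t s (by omega))
    simp only [mul_smul, ← smul_finsum] at h9
    rw [← h9, iterSum]
    apply finsum_congr
    intro s
    push_cast
    rw [show (m : ℂ) + (p - t) = p + m - t by ring,
      show p + m + n - (t : ℚ) - s = p + m - t + n - s by ring]
  have h1 := hF.smul fun i => Ring.choose (m : ℂ) i
  have h2 := (hG.smul fun i j => Ring.choose (m : ℂ) i * Ring.choose (p : ℂ) j).sum
  simp only [mul_smul, ← smul_finsum] at h2
  rw [iterSum, fs_map _ ((iter_ev l (m + n) a b w).smul _)]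
  rw [finsum_congr e1, fs_add ((iter_ev l (m + n) a b _).smul _), fs_add h1 h2, e2,
    hG.smul_comm (fun i => Ring.choose (m : ℂ) i) fun j => Ring.choose (p : ℂ) j]
  · have h3 : Ev fun t : ℕ => Ring.choose (p : ℂ) t • iterSum Y l (p + m - t) n (md c t a) b w := by
      obtain ⟨N, hN⟩ := md_ev_nat c a
      exact ⟨N, fun t ht => by simp [hN t ht, iterSum, md_zero]⟩
    have h4 := (hG.flip.smul fun j i => Ring.choose (p : ℂ) j * Ring.choose (m : ℂ) i).sum
    simp only [mul_smul, ← smul_finsum] at h4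
    rw [← fs_add h3 h4]
    congr 1
    apply finsum_congr
    intro j
    rw [smul_add]
    congr 2
    apply finsum_congr
    intro i
    rw [show p + (m + n - (i : ℚ)) - j = m + (p + n - j) - i by ring]
  · exact h1.add h2

lemma iterSum_zero_left (l : ℤ) (m n : ℚ) (b : V) (w : X) : iterSum Y l m n 0 b w = 0 :=
  finsum_eq_zero_of_forall_eq_zero fun i => by simp [md_zero]

lemma iterSum_zero_right (l : ℤ) (m n : ℚ) (a : V) (w : X) : iterSum Y l m n a 0 w = 0 :=
  finsum_eq_zero_of_forall_eq_zero fun i => by simp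

lemma prodSum_zero_left (l : ℤ) (m n : ℚ) (b : V) (w : X) : prodSum Y l m n 0 b w = 0 :=
  finsum_eq_zero_of_forall_eq_zero fun i => by simp

lemma prodSum_zero_right (l : ℤ) (m n : ℚ) (a : V) (w : X) : prodSum Y l m n a 0 w = 0 :=
  finsum_eq_zero_of_forall_eq_zero fun i => by simp

/-- The defect of the Jacobi identity transforms under `c_p` like a product of two fields. -/
lemma comm_defect (H : HasCommutator g Y) {p : ℚ} {c : V} (hc : c ∈ g.eig p) (l : ℤ) (m n : ℚ)
    (a b : V) (w : X) : Y c p (defect Y l m n a b w) = defect Y l m n a b (Y c p w) +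
      ∑ᶠ j : ℕ, Ring.choose (p : ℂ) j • (defect Y l (p + m - j) n (md c j a) b w +
        defect Y l m (p + n - j) a (md c j b) w) := by
  obtain ⟨N, hN⟩ := md_ev_nat c a
  obtain ⟨N', hN'⟩ := md_ev_nat c b
  obtain ⟨M, hM⟩ : ∃ M, M = max N N' := ⟨_, rfl⟩
  have ha : ∀ i, M ≤ i → md c i a = 0 := fun i hi => hN i (by omega)
  have hb : ∀ i, M ≤ i → md c i b = 0 := fun i hi => hN' i (by omega)
  simp only [defect]
  rw [map_sub, map_sub, map_smul, comm_iterSum H hc, comm_prodSum H hc, comm_prodSum H hc]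
  rw [fs_range (N := M), fs_range (N := M), fs_range (N := M), fs_range (N := M)]
  · simp only [smul_add, smul_sub, Finset.sum_add_distrib, Finset.sum_sub_distrib,
      smul_comm _ ((-1 : ℂ) ^ l), ← Finset.smul_sum]
    module
  all_goals
    intro i hi
    rw [ha i hi, hb i hi]
    simp [iterSum_zero_left, iterSum_zero_right, prodSum_zero_left, prodSum_zero_right]

end DefectComm

/-! ### The Jacobi identity for graded `V[g]`-modules -/

section DefectLinear

open VertexOperatorAlgebra FiniteOrderAut

variable {V : Type u} [AddCommGroup V] [Module ℂ V] [VertexOperatorAlgebra V]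
  {g : FiniteOrderAut V} {X : Type*} [AddCommGroup X] [Module ℂ X]
  {Y : V →ₗ[ℂ] (ℚ → Module.End ℂ X)}

lemma iterSum_add_left (l : ℤ) (m n : ℚ) (a a' b : V) (w : X) :
    iterSum Y l m n (a + a') b w = iterSum Y l m n a b w + iterSum Y l m n a' b w := by
  simp only [iterSum]
  rw [← fs_add ((iter_ev l (m + n) a b w).smul _) ((iter_ev l (m + n) a' b w).smul _)]
  refine finsum_congr fun i => ?_
  rw [md_add, LinearMap.add_apply, map_add, Pi.add_apply, LinearMap.add_apply, smul_add]

lemma iterSum_add_right (l : ℤ) (m n : ℚ) (a b b' : V) (w : X) :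
    iterSum Y l m n a (b + b') w = iterSum Y l m n a b w + iterSum Y l m n a b' w := by
  simp only [iterSum]
  rw [← fs_add ((iter_ev l (m + n) a b w).smul _) ((iter_ev l (m + n) a b' w).smul _)]
  refine finsum_congr fun i => ?_
  rw [map_add, map_add, Pi.add_apply, LinearMap.add_apply, smul_add]

lemma iterSum_add (l : ℤ) (m n : ℚ) (a b : V) (w w' : X) :
    iterSum Y l m n a b (w + w') = iterSum Y l m n a b w + iterSum Y l m n a b w' := by
  simp only [iterSum]
  rw [← fs_add ((iter_ev l (m + n) a b w).smul _) ((iter_ev l (m + n) a b w').smul _)]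
  refine finsum_congr fun i => ?_
  rw [map_add, smul_add]

lemma iterSum_smul (l : ℤ) (m n : ℚ) (a b : V) (c : ℂ) (w : X) :
    iterSum Y l m n a b (c • w) = c • iterSum Y l m n a b w := by
  simp only [iterSum]
  rw [smul_finsum]
  refine finsum_congr fun i => ?_
  rw [map_smul, smul_comm]

lemma prodSum_add_left (H : HasCommutator g Y) (l : ℤ) (m n : ℚ) (a a' b : V) (w : X) :
    prodSum Y l m n (a + a') b w = prodSum Y l m n a b w + prodSum Y l m n a' b w := by
  simp only [prodSum]
  rw [← fs_add ((prod_ev H (l + m) n a b w).smul _) ((prod_ev H (l + m) n a' b w).smul _)]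
  refine finsum_congr fun i => ?_
  rw [map_add, Pi.add_apply, LinearMap.add_apply, smul_add]

lemma prodSum_add_right (H : HasCommutator g Y) (l : ℤ) (m n : ℚ) (a b b' : V) (w : X) :
    prodSum Y l m n a (b + b') w = prodSum Y l m n a b w + prodSum Y l m n a b' w := by
  simp only [prodSum]
  rw [← fs_add ((prod_ev H (l + m) n a b w).smul _) ((prod_ev H (l + m) n a b' w).smul _)]
  refine finsum_congr fun i => ?_
  rw [map_add, Pi.add_apply, LinearMap.add_apply, map_add, smul_add]

lemma prodSum_add (H : HasCommutator g Y) (l : ℤ) (m n : ℚ) (a b : V) (w w' : X) :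
    prodSum Y l m n a b (w + w') = prodSum Y l m n a b w + prodSum Y l m n a b w' := by
  simp only [prodSum]
  rw [← fs_add ((prod_ev H (l + m) n a b w).smul _) ((prod_ev H (l + m) n a b w').smul _)]
  refine finsum_congr fun i => ?_
  rw [map_add, map_add, smul_add]

lemma prodSum_smul (l : ℤ) (m n : ℚ) (a b : V) (c : ℂ) (w : X) :
    prodSum Y l m n a b (c • w) = c • prodSum Y l m n a b w := by
  simp only [prodSum]
  rw [smul_finsum]
  refine finsum_congr fun i => ?_
  rw [map_smul, map_smul, smul_comm]

lemma defect_add_left (H : HasCommutator g Y) (l : ℤ) (m n : ℚ) (a a' b : V) (w : X) :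
    defect Y l m n (a + a') b w = defect Y l m n a b w + defect Y l m n a' b w := by
  rw [defect, defect, defect, iterSum_add_left, prodSum_add_left H, prodSum_add_right H]
  module

lemma defect_add_right (H : HasCommutator g Y) (l : ℤ) (m n : ℚ) (a b b' : V) (w : X) :
    defect Y l m n a (b + b') w = defect Y l m n a b w + defect Y l m n a b' w := by
  rw [defect, defect, defect, iterSum_add_right, prodSum_add_left H, prodSum_add_right H]
  module

lemma defect_add (H : HasCommutator g Y) (l : ℤ) (m n : ℚ) (a b : V) (w w' : X) :
    defect Y l m n a b (w + w') = defect Y l m n a b w + defect Y l m n a b w' := by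
  rw [defect, defect, defect, iterSum_add, prodSum_add H, prodSum_add H]
  module

lemma defect_smul (l : ℤ) (m n : ℚ) (a b : V) (c : ℂ) (w : X) :
    defect Y l m n a b (c • w) = c • defect Y l m n a b w := by
  rw [defect, defect, iterSum_smul, prodSum_smul, prodSum_smul]
  module

lemma defect_zero_left (l : ℤ) (m n : ℚ) (b : V) (w : X) : defect Y l m n 0 b w = 0 := by
  simp [defect, iterSum_zero_left, prodSum_zero_left, prodSum_zero_right]

lemma defect_zero_right (l : ℤ) (m n : ℚ) (a : V) (w : X) : defect Y l m n a 0 w = 0 := by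
  simp [defect, iterSum_zero_right, prodSum_zero_left, prodSum_zero_right]

lemma eig_add_one {m : ℚ} {a : V} (ha : a ∈ g.eig m) (z : ℤ) : a ∈ g.eig (m + z) := by
  rwa [g.eig_add_int]

/-- In the case `l = -1` the defect depends on `m + n` only. -/
lemma defect_shift (H : HasCommutator g Y) {m : ℚ} {a : V} (ha : a ∈ g.eig m) (n : ℚ) (b : V) (w : X)
    (z : ℤ) : defect Y (-1) (m + z) (n - z) a b w = defect Y (-1) m n a b w := by
  have key : ∀ (m n : ℚ), a ∈ g.eig m →
      defect Y (-1) (m + 1) n a b w = defect Y (-1) m (n + 1) a b w := by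
    intro m n ha
    have h1 := defect_succ H (-1) m n a b w
    rw [neg_add_cancel, defect_zero H ha] at h1
    exact (sub_eq_zero.1 h1.symm)
  induction z using Int.induction_on with
  | zero => simp
  | succ i ih =>
    rw [← ih]
    have := key (m + i) (n - i - 1) (by simpa using eig_add_one ha i)
    push_cast
    rw [sub_add_cancel] at this
    rw [← this]
    congr 1 <;> ring
  | pred i ih =>
    rw [← ih]
    have := key (m - i - 1) (n + i) (by
      have := eig_add_one ha (-i - 1)
      push_cast at this
      rwa [show m - i - 1 = m + (-i - 1) by ring])
    push_cast
    rw [sub_add_cancel] at this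
    rw [show m + -(i : ℚ) = m - i by ring, show n - -(i : ℚ) = n + i by ring, this]
    congr 1 <;> ring

end DefectLinear

/-! ### Modes of a graded `V[g]`-module and admissibility -/

section Modes

open VertexOperatorAlgebra FiniteOrderAut

variable {V : Type u} [AddCommGroup V] [Module ℂ V] [VertexOperatorAlgebra V]
  {g : FiniteOrderAut V} {X : Type*} [AddCommGroup X] [Module ℂ X]

/-- The modes `v_q = v(q)` on a `V[g]`-module. -/
def modes (φ : g.Vg →ₗ[ℂ] Module.End ℂ X) : V →ₗ[ℂ] (ℚ → Module.End ℂ X) :=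
  LinearMap.pi fun q => φ.comp (g.el q)

lemma modes_apply (φ : g.Vg →ₗ[ℂ] Module.End ℂ X) (v : V) (q : ℚ) : modes φ v q = φ (g.el q v) := rfl

/-- The subspace of degree `0` is a module for `A_g(V)` under `a + O_g(V) ↦ o(a)`. -/
structure ActsThroughA (φ : g.Vg →ₗ[ℂ] Module.End ℂ X) (gr : ℚ → Submodule ℂ X) : Prop where
  vac : ∀ w ∈ gr 0, φ (g.el (-1) vac) w = w
  O : ∀ x ∈ g.O, ∀ w ∈ gr 0, zeroMode (modes φ) x w = 0
  star : ∀ a b : V, ∀ w ∈ gr 0,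
    zeroMode (modes φ) (g.star a b) w = zeroMode (modes φ) a (zeroMode (modes φ) b w)

variable {φ : g.Vg →ₗ[ℂ] Module.End ℂ X} {gr : ℚ → Submodule ℂ X}

namespace IsGrRep

lemma hasCommutator (R : IsGrRep φ gr) : HasCommutator g (modes φ) where
  trunc := R.trunc
  comm := by
    intro p c hc v n w
    simp only [modes_apply]
    obtain ⟨N, hN⟩ := md_nat_trunc c v
    have h := congrArg φ (el_lie hc n v)
    rw [R.lie, map_fs φ (N := N) fun i hi => by rw [hN i hi, map_zero, smul_zero]] at h
    have h2 := LinearMap.congr_fun h w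
    rw [LinearMap.sub_apply, fs_range (N := N) fun i hi => by
      rw [hN i hi, map_zero, smul_zero, map_zero]] at h2
    rw [fs_range (N := N) fun i hi => by simp [hN i hi]]
    simp only [Module.End.mul_apply, LinearMap.sum_apply, map_smul, LinearMap.smul_apply] at h2
    rw [← h2]; abel
  deriv := by
    intro v n
    rw [modes_apply, modes_apply, el_deriv, map_smul]

lemma mode_apply (R : IsGrRep φ gr) {k : ℤ} {v : V} (hv : v ∈ wt V k) (m : ℚ) {n n' : ℚ} {w : X}
    (hw : w ∈ gr n) (h : n + k - m - 1 = n') : modes φ v m w ∈ gr n' := by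
  have := R.mode _ n _ (el_mem_degVg (g := g) hv (q := m) rfl) w hw
  rwa [show n + ((k : ℚ) - m - 1) = n' by linarith] at this

lemma defect_mem (R : IsGrRep φ gr) {j k : ℤ} {a b : V} (ha : a ∈ wt V k) (hb : b ∈ wt V j)
    {m n d d' : ℚ} {w : X} (hw : w ∈ gr d) (h : d + k + j - m - n - 1 = d') :
    defect (modes φ) (-1) m n a b w ∈ gr d' := by
  have hs : ∀ f : ℕ → X, (∀ i, f i ∈ gr d') → ∑ᶠ i, f i ∈ gr d' := fun f hf =>
    finsum_induction (· ∈ gr d') (Submodule.zero_mem _) (fun _ _ => Submodule.add_mem _) hf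
  refine Submodule.sub_mem _ (hs _ fun i => Submodule.smul_mem _ _ ?_)
    (Submodule.sub_mem _ (hs _ fun i => Submodule.smul_mem _ _ ?_)
      (Submodule.smul_mem _ _ (hs _ fun i => Submodule.smul_mem _ _ ?_)))
  · exact R.mode_apply (md_wt ha hb _) _ hw (by push_cast; linarith)
  · exact R.mode_apply ha _ (R.mode_apply hb _ hw rfl) (by push_cast; linarith)
  · exact R.mode_apply hb _ (R.mode_apply ha _ hw rfl) (by push_cast; linarith)

lemma modes_eq_zero (R : IsGrRep φ gr) {k : ℤ} {v : V} (hv : v ∈ wt V k) {m : ℚ} {w : X}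
    (hw : w ∈ gr 0) (h : (k : ℚ) - m - 1 < 0) : modes φ v m w = 0 := by
  have := R.mode_apply hv m hw rfl
  rw [R.neg _ (by linarith)] at this
  exact this

/-- The components of degree `0` of the Jacobi identity on vectors of degree `0`. -/
lemma defect_zero_of_deg (R : IsGrRep φ gr) (hA : ActsThroughA φ gr) {j k : ℤ} {m n : ℚ} {a b : V}
    (ha : a ∈ wt V k) (hm : a ∈ g.eig m) (hb : b ∈ wt V j) {w : X} (hw : w ∈ gr 0)
    (h : (k : ℚ) + j - m - n - 1 = 0) : defect (modes φ) (-1) m n a b w = 0 := by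
  -- Here `q = r/T`. Since for `l = -1` only `m + n` matters, `z` may be replaced by any integer,
  -- chosen below so that as many products as possible kill `w`.
  obtain ⟨q, z, h0, h1, rfl⟩ : ∃ (q : ℚ) (z : ℤ), 0 ≤ q ∧ q < 1 ∧ m = q + z :=
    ⟨Int.fract m, ⌊m⌋, Int.fract_nonneg m, Int.fract_lt_one m, (Int.fract_add_floor m).symm⟩
  rw [g.eig_add_int] at hm
  have H := R.hasCommutator
  have hsh : ∀ z' : ℤ, defect (modes φ) (-1) (q + z) n a b w =
      defect (modes φ) (-1) (q + z') (n + z - z') a b w := by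
    intro z'
    rw [defect_shift H hm (n + z) b w z', ← defect_shift H hm (n + z) b w z, add_sub_cancel_right]
  have hprod : ∀ (j : ℤ) (b a : V) (m n : ℚ), b ∈ wt V j → (j : ℚ) - n - 1 < 0 →
      prodSum (modes φ) (-1) m n a b w = 0 := by
    intro j b a m n hb hn
    refine finsum_eq_zero_of_forall_eq_zero fun i => ?_
    have hi : (0 : ℚ) ≤ i := Nat.cast_nonneg i
    rw [R.modes_eq_zero hb hw (by linarith), map_zero, smul_zero]
  -- For `r = 0` take `m = wt a`: every `a_{m+i}` has negative degree, and so does `b_{n+i}` unless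
  -- `i = 0`. What remains is `o(a * b) w = o(a) o(b) w`.
  rcases h0.eq_or_lt with rfl | h0
  · rw [hsh k, zero_add, show n + z - k = (j : ℚ) - 1 by linarith, defect,
      hprod k a b _ _ ha (by linarith), smul_zero, sub_zero, sub_eq_zero]
    have e := hA.star a b w hw
    rw [FiniteOrderAut.star_apply ha hm, zeroMode_res _ _ ha hb, zeroMode_apply ha,
      zeroMode_apply hb] at e
    have e2 : ∀ s : ℕ, (k : ℚ) + j - ((-1 : ℤ) : ℚ) - 2 - s = (k : ℚ) + (j - 1) - s := by
      intro s; push_cast; ring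
    simp only [e2] at e
    rw [iterSum]
    push_cast
    rw [e, prodSum, fs_range (N := 1)]
    · rw [Finset.sum_range_one]
      simp only [Nat.cast_zero, add_zero, sub_zero, pow_zero, Ring.choose_zero_right, mul_one,
        one_smul]
      rw [show ((-1 : ℤ) : ℚ) + k = k - 1 by push_cast; ring]
    · intro i hi
      have hi' : (1 : ℚ) ≤ i := by exact_mod_cast hi
      rw [R.modes_eq_zero hb hw (by linarith), map_zero, smul_zero]
  · have hd : FiniteOrderAut.del q = 0 := by rw [FiniteOrderAut.del, if_neg h0.ne']
    -- For `0 < r < T` take `m = wt a - 1 + r/T`, hence `n = wt b - r/T`. Then `a_m` and `b_n` have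
    -- the negative degrees `-r/T` and `r/T - 1`, so both product sums vanish and `o(a ∘ b) w` is
    -- left.
    rw [hsh (k - 1), defect, hprod k a b _ _ ha (by push_cast; linarith),
      hprod j b a _ _ hb (by push_cast; linarith), smul_zero, sub_zero, sub_zero]
    have e := hA.O _ (circ_mem h0.le h1 ha hm b) w hw
    rw [FiniteOrderAut.circ, zeroMode_res _ _ ha hb, hd] at e
    rw [← e, iterSum]
    refine finsum_congr fun i => ?_
    rw [show q + ((k - 1 : ℤ) : ℚ) + (n + z - ((k - 1 : ℤ) : ℚ)) - i =
      k + j - ((-1 - 0 : ℤ) : ℚ) - 2 - i by push_cast; linarith]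
    congr 2
    push_cast; ring

/-- The defects of the Jacobi identity on vectors of degree `0`. -/
def defects (φ : g.Vg →ₗ[ℂ] Module.End ℂ X) (gr : ℚ → Submodule ℂ X) : Submodule ℂ X :=
  Submodule.span ℂ {x | ∃ (j k : ℤ) (m n : ℚ) (a b : V) (w : X), a ∈ wt V k ∧ a ∈ g.eig m ∧
    b ∈ wt V j ∧ w ∈ gr 0 ∧ x = defect (modes φ) (-1) m n a b w}

lemma defects_isGr (R : IsGrRep φ gr) : IsGr gr (defects φ gr) := by
  refine isGr_of_le ?_
  conv_lhs => rw [defects]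
  rw [Submodule.span_le]
  rintro x ⟨j, k, m, n, a, b, w, hk, ha, hj, hw, rfl⟩
  exact Submodule.mem_iSup_of_mem _ ⟨Submodule.subset_span ⟨j, k, m, n, a, b, w, hk, ha, hj, hw, rfl⟩,
    R.defect_mem hk hj hw rfl⟩

/-- There are no negative degrees, and in degree `0` the relations of `A_g(V)` make the defect
vanish. -/
lemma defects_le (R : IsGrRep φ gr) (hA : ActsThroughA φ gr) :
    defects φ gr ≤ sumOver gr (0 < ·) := by
  rw [defects, Submodule.span_le]
  rintro x ⟨j, k, m, n, a, b, w, hk, ha, hj, hw, rfl⟩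
  have h := R.defect_mem (φ := φ) (m := m) (n := n) hk hj hw rfl
  rcases lt_trichotomy ((k : ℚ) + j - m - n - 1) 0 with hd | hd | hd
  · rw [R.neg _ (by linarith)] at h
    rw [(Submodule.mem_bot ℂ).1 h]
    exact Submodule.zero_mem _
  · rw [R.defect_zero_of_deg hA hk ha hj hw hd]
    exact Submodule.zero_mem _
  · exact le_sumOver (p := (0 < ·)) (by linarith) h

/-- By `comm_defect`, applying `c_p` yields defects that involve `c_j a` or `c_j b` on the same `w`,
and a defect on `c_p w`. If `c_p` has degree `0` then `c_p w` has degree `0` again; if its degree is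
negative then `c_p w = 0`. -/
lemma defects_stable (R : IsGrRep φ gr) {d : ℚ} (hd : d ≤ 0) {y : g.Vg} (hy : y ∈ g.degVg d) {x : X}
    (hx : x ∈ defects φ gr) : φ y x ∈ defects φ gr := by
  induction hy using Submodule.span_induction with
  | zero => simp
  | add y y' _ _ hy hy' => rw [map_add]; exact Submodule.add_mem _ hy hy'
  | smul c y _ hy => rw [map_smul]; exact Submodule.smul_mem _ _ hy
  | mem y hy =>
  obtain ⟨i, p, c, hi, hp, hdeg, rfl⟩ := hy
  induction hx using Submodule.span_induction with
  | zero => simp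
  | add x x' _ _ hx hx' => rw [map_add]; exact Submodule.add_mem _ hx hx'
  | smul c x _ hx => rw [map_smul]; exact Submodule.smul_mem _ _ hx
  | mem x hx =>
    obtain ⟨j, k, m, n, a, b, w, hk, ha, hj, hw, rfl⟩ := hx
    have e := comm_defect R.hasCommutator hp (-1) m n a b w
    rw [modes_apply] at e
    rw [e]
    refine Submodule.add_mem _ ?_ (finsum_induction (· ∈ defects φ gr) (Submodule.zero_mem _)
      (fun _ _ => Submodule.add_mem _) fun s => Submodule.smul_mem _ _ (Submodule.add_mem _
        (Submodule.subset_span ⟨j, _, _, n, _, b, w, md_wt hi hk s, ?_, hj, hw, rfl⟩)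
        (Submodule.subset_span ⟨_, k, m, _, a, _, w, hk, ha, md_wt hi hj s, hw, rfl⟩)))
    · have hw' := R.mode_apply (φ := φ) hi p hw (n' := d) (by linarith)
      rw [modes_apply] at hw'
      rcases hd.eq_or_lt with rfl | hd
      · exact Submodule.subset_span ⟨j, k, m, n, a, b, _, hk, ha, hj, hw', rfl⟩
      · rw [R.neg _ hd] at hw'
        rw [(Submodule.mem_bot ℂ).1 hw', ← zero_smul ℂ (0 : X), defect_smul, zero_smul]
        exact Submodule.zero_mem _
    · rw [eig_sub_nat]; exact g.md_eig hp ha s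

/-- A graded `V[g]`-module that is generated by an `A_g(V)`-module in degree `0` and has no graded
submodules in positive degree is a weak twisted module. -/
theorem isWeakTwisted (R : IsGrRep φ gr) (ht : IsTight φ gr) (hA : ActsThroughA φ gr) :
    IsWeakTwisted g (modes φ) := by
  have H := R.hasCommutator
  -- The defects generate a graded submodule of positive degree, which is zero by tightness.
  have hbot : defects φ gr = ⊥ := by
    have h1 : gen φ (defects φ gr) = ⊥ := ht.eq_bot _ (gen_stable _)
      (gen_isGr R.mode R.defects_isGr)
      (R.eq_bot_of_le_pos (R.gen_pos (fun n hn y hy w hw => R.defects_stable hn hy hw)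
        (R.defects_le hA)))
    exact eq_bot_iff.2 ((le_gen _).trans h1.le)
  let Q : Submodule ℂ X :=
    { carrier := {w | ∀ (m : ℚ) (a : V), a ∈ g.eig m → ∀ (n : ℚ) (b : V),
        defect (modes φ) (-1) m n a b w = 0}
      add_mem' := fun h h' m a ha n b => by rw [defect_add H, h m a ha, h' m a ha, add_zero]
      zero_mem' := fun m a ha n b => by
        simpa using defect_smul (Y := modes φ) (-1) m n a b 0 0
      smul_mem' := fun c x h m a ha n b => by rw [defect_smul, h m a ha, smul_zero] }
  have hQ0 : gr 0 ≤ Q := by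
    intro w hw m a ha n b
    rw [← g.eigProj_of_mem ha]
    clear ha
    induction a using g.hom_induction with
    | h0 => rw [map_zero, defect_zero_left]
    | hadd u v hu hv => rw [map_add, defect_add_left H, hu, hv, add_zero]
    | h k _ a _ _ hk _ =>
      induction b using g.hom_induction with
      | h0 => rw [defect_zero_right]
      | hadd u v hu hv => rw [defect_add_right H, hu, hv, add_zero]
      | h j _ b _ _ hj _ =>
        have : defect (modes φ) (-1) m n (g.eigProj m a) b w ∈ defects φ gr :=
          Submodule.subset_span ⟨j, k, m, n, _, b, w, g.eigProj_wt m hk, g.eigProj_mem m a, hj, hw, rfl⟩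
        rw [hbot] at this
        exact this
  -- By `comm_defect` the vectors without defects form a submodule, and it contains the generators
  -- of degree `0`.
  have hQ : Q = ⊤ := by
    rw [eq_top_iff, ← ht.gen_zero]
    refine gen_le hQ0 fun y w hw => ?_
    induction y using Vg_induction with
    | zero => simp
    | add x y hx hy => rw [map_add]; exact Submodule.add_mem _ hx hy
    | mem k p c hk hp =>
      intro m a ha n b
      have e := comm_defect H hp (-1) m n a b w
      rw [hw m a ha n b, map_zero] at e
      rw [finsum_eq_zero_of_forall_eq_zero, add_zero] at e
      · exact e.symm
      · intro s
        rw [hw _ _ (by rw [eig_sub_nat]; exact g.md_eig hp ha s), hw m a ha, add_zero, smul_zero]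
  -- The operator `1(-1)` is central and fixes the generators.
  have hvac : φ (g.el (-1) vac) = 1 := by
    have h1 : LinearMap.ker (φ (g.el (-1) vac) - 1) = ⊤ := by
      rw [eq_top_iff, ← ht.gen_zero]
      refine gen_le (fun w hw => ?_) fun y w hw => ?_
      · rw [LinearMap.mem_ker, LinearMap.sub_apply, hA.vac w hw, Module.End.one_apply, sub_self]
      · have e := LinearMap.congr_fun (R.lie (g.el (-1) vac) y) w
        rw [el_vac_lie, map_zero] at e
        simp only [LinearMap.mem_ker, LinearMap.sub_apply, Module.End.one_apply,
          LinearMap.zero_apply, Module.End.mul_apply, sub_eq_zero] at e hw ⊢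
        rw [hw] at e
        exact sub_eq_zero.1 e.symm
    rw [LinearMap.ker_eq_top, sub_eq_zero] at h1
    exact h1
  refine ⟨fun q u hu n hn => ?_, H.trunc, fun n => ?_, fun m u hu v w l n => ?_⟩
  · rw [modes_apply, el_of_ne hu, map_zero]
    rintro ⟨z, rfl⟩
    exact hn ⟨-z, by push_cast; ring⟩
  · rw [modes_apply]
    split_ifs with h
    · rw [h, hvac]
    · rw [el_vac h, map_zero]
  · have hw : w ∈ Q := by rw [hQ]; trivial
    have := defect_eq_zero H hw l m u hu n v
    rw [defect_eq H, sub_eq_zero] at this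
    exact this

/-- Admissibility of a graded `V[g]`-module. -/
theorem isAdmissible (R : IsGrRep φ gr) (ht : IsTight φ gr) (hA : ActsThroughA φ gr)
    (hsupp : ∀ n : ℚ, (¬∃ k : ℤ, n * g.T = k) → gr n = ⊥) : IsAdmissible g (modes φ) gr where
  toIsWeakTwisted := R.isWeakTwisted ht hA
  gr_support := by
    intro q hq
    rcases lt_or_ge q 0 with h | h
    · exact R.neg q h
    · refine hsupp q ?_
      rintro ⟨k, hk⟩
      have hT : (0 : ℚ) < g.T := by exact_mod_cast g.T_pos
      have h0 : (0 : ℤ) ≤ k := by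
        have : (0 : ℚ) ≤ k := by rw [← hk]; positivity
        exact_mod_cast this
      refine hq ⟨k.toNat, ?_⟩
      rw [eq_div_iff hT.ne', hk]
      exact_mod_cast (Int.toNat_of_nonneg h0).symm
  gr_internal := R.internal
  gr_mode := fun _ _ hv m _ _ hw => R.mode_apply hv m hw rfl

end IsGrRep

end Modes

/-! ### The universal enveloping algebra of `V[g]` -/

section Enveloping

open VertexOperatorAlgebra FiniteOrderAut

variable {V : Type u} [AddCommGroup V] [Module ℂ V] [VertexOperatorAlgebra V]
  {g : FiniteOrderAut V}

section Iota

attribute [local instance] LieRing.ofAssociativeRing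

/-- The canonical map `V[g] → U(V[g])`. -/
def iota (g : FiniteOrderAut V) : g.Vg →ₗ[ℂ] UE g :=
  (UniversalEnvelopingAlgebra.ι ℂ : g.Vg →ₗ⁅ℂ⁆ UE g).toLinearMap

lemma iota_lie (x y : g.Vg) : iota g ⁅x, y⁆ = iota g x * iota g y - iota g y * iota g x :=
  LieHom.map_lie (UniversalEnvelopingAlgebra.ι ℂ) x y

end Iota

/-- `[L(0), L(-2)] = 2 L(-2)` is applied to `1`, where `L(0) 1 = 0` and `L(-2) 1 = ω`. -/
lemma omega_wt : (omega : V) ∈ wt V 2 := by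
  rw [mem_wt]
  have hv := virasoro (V := V) 0 (-2) vac
  have h1 : VertexOperator.ncoeff (Y (omega : V)) 1 vac = 0 := creation_nonneg _ _ (by norm_num)
  norm_num [creation, h1] at hv
  exact_mod_cast hv

@[elab_as_elim]
lemma UE_induction {P : UE g → Prop} (scalar : ∀ c : ℂ, P (algebraMap ℂ (UE g) c))
    (iota : ∀ y, P (iota g y)) (mul : ∀ x y, P x → P y → P (x * y))
    (add : ∀ x y, P x → P y → P (x + y)) (x : UE g) : P x := by
  obtain ⟨t, rfl⟩ : ∃ t, UniversalEnvelopingAlgebra.mkAlgHom ℂ g.Vg t = x :=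
    RingCon.mkₐ_surjective _ x
  induction t using TensorAlgebra.induction with
  | algebraMap c => rw [AlgHom.commutes]; exact scalar c
  | ι y => exact iota y
  | mul x y hx hy => rw [map_mul]; exact mul _ _ hx hy
  | add x y hx hy => rw [map_add]; exact add _ _ hx hy

section Lift

variable {X : Type*} [AddCommGroup X] [Module ℂ X]

attribute [local instance] LieRing.ofAssociativeRing

/-- The action of `U(V[g])` on a `V[g]`-module. -/
def liftEnd (φ : g.Vg →ₗ[ℂ] Module.End ℂ X) (h : ∀ x y, φ ⁅x, y⁆ = φ x * φ y - φ y * φ x) :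
    UE g →ₐ[ℂ] Module.End ℂ X :=
  UniversalEnvelopingAlgebra.lift ℂ { φ with map_lie' := fun {x y} => h x y }

lemma liftEnd_iota (φ : g.Vg →ₗ[ℂ] Module.End ℂ X)
    (h : ∀ x y, φ ⁅x, y⁆ = φ x * φ y - φ y * φ x) (y : g.Vg) : liftEnd φ h (iota g y) = φ y :=
  UniversalEnvelopingAlgebra.lift_ι_apply ℂ _ y

end Lift

section Act

variable {X : Type*} [AddCommGroup X] [Module ℂ X] [Module (UE g) X] [IsScalarTower ℂ (UE g) X]

variable (g X) in
/-- The action of `V[g]` on a module for `U(V[g])`. -/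
def act : g.Vg →ₗ[ℂ] Module.End ℂ X := (Algebra.lsmul ℂ ℂ X).toLinearMap.comp (iota g)

lemma act_apply (y : g.Vg) (w : X) : act g X y w = iota g y • w := rfl

lemma act_lie (x y : g.Vg) : act g X ⁅x, y⁆ = act g X x * act g X y - act g X y * act g X x := by
  ext w
  simp only [act_apply, iota_lie, LinearMap.sub_apply, Module.End.mul_apply, sub_smul, mul_smul]

lemma IsStable.smul_mem {N : Submodule ℂ X} (hN : IsStable (act g X) N) (x : UE g) {w : X}
    (hw : w ∈ N) : x • w ∈ N := by
  induction x using UE_induction generalizing w with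
  | scalar c => rw [algebraMap_smul]; exact N.smul_mem c hw
  | iota y => exact hN y w hw
  | mul x y hx hy => rw [mul_smul]; exact hx (hy hw)
  | add x y hx hy => rw [add_smul]; exact N.add_mem (hx hw) (hy hw)

/-- A `V[g]`-submodule as a submodule for `U(V[g])`. -/
def IsStable.toUE {N : Submodule ℂ X} (hN : IsStable (act g X) N) : Submodule (UE g) X :=
  { N with smul_mem' := fun x _ hw => hN.smul_mem x hw }

lemma IsStable.restrictScalars_toUE {N : Submodule ℂ X} (hN : IsStable (act g X) N) :
    hN.toUE.restrictScalars ℂ = N := rfl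

lemma isStable_restrictScalars (N : Submodule (UE g) X) :
    IsStable (act g X) (N.restrictScalars ℂ) := fun y _ hw => N.smul_mem (iota g y) hw

end Act

/-! ### The grading of `U(V[g])` -/

lemma one_mem_degUE : (1 : UE g) ∈ degUE g 0 := Submodule.subset_span ⟨[], by simp⟩

lemma iota_mem_degUE {n : ℚ} {y : g.Vg} (hy : y ∈ g.degVg n) : iota g y ∈ degUE g n :=
  Submodule.subset_span ⟨[(n, y)], by simpa using hy, by simp, by simp only [List.map_cons, List.map_nil, List.prod_singleton]; rfl⟩

lemma mul_mem_degUE {m n : ℚ} {x y : UE g} (hx : x ∈ degUE g m) (hy : y ∈ degUE g n) :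
    x * y ∈ degUE g (m + n) := by
  have h : degUE g m * degUE g n ≤ degUE g (m + n) := by
    rw [degUE, degUE, Submodule.span_mul_span, Submodule.span_le]
    rintro _ ⟨_, ⟨l, hl, rfl, rfl⟩, _, ⟨l', hl', rfl, rfl⟩, rfl⟩
    refine Submodule.subset_span ⟨l ++ l', fun p hp => ?_, by simp, by simp⟩
    rcases List.mem_append.1 hp with hp | hp
    · exact hl p hp
    · exact hl' p hp
  exact h (Submodule.mul_mem_mul hx hy)

lemma iSup_degUE : ⨆ n, degUE g n = ⊤ := by
  rw [eq_top_iff]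
  rintro x -
  induction x using UE_induction with
  | scalar c =>
    rw [Algebra.algebraMap_eq_smul_one]
    exact Submodule.smul_mem _ _ (Submodule.mem_iSup_of_mem 0 one_mem_degUE)
  | iota y =>
    have hy : y ∈ ⨆ n, g.degVg n := by rw [iSup_degVg]; trivial
    have h : ⨆ n, g.degVg n ≤ (⨆ n, degUE g n).comap (iota g) :=
      iSup_le fun n y hy => Submodule.mem_iSup_of_mem n (iota_mem_degUE hy)
    exact h hy
  | mul x y hx hy =>
    have h : (⨆ n, degUE g n) * (⨆ n, degUE g n) ≤ ⨆ n, degUE g n := by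
      rw [Submodule.iSup_mul]
      refine iSup_le fun m => ?_
      rw [Submodule.mul_iSup]
      refine iSup_le fun n => Submodule.mul_le.2 fun x hx y hy => ?_
      exact Submodule.mem_iSup_of_mem (m + n) (mul_mem_degUE hx hy)
    exact h (Submodule.mul_mem_mul hx hy)
  | add x y hx hy => exact Submodule.add_mem _ hx hy

/-- The commutator with `ω(1)` is a derivation, so the degrees of the factors of a product add up.
-/
lemma omega_comm_degUE {n : ℚ} {x : UE g} (hx : x ∈ degUE g n) :
    iota g (g.el 1 omega) * x = x * iota g (g.el 1 omega) + (n : ℂ) • x := by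
  induction hx using Submodule.span_induction with
  | zero => simp
  | add x y _ _ hx hy => rw [mul_add, hx, hy, add_mul, smul_add]; abel
  | smul c x _ hx => rw [mul_smul_comm, hx, smul_add, smul_mul_assoc, smul_comm]
  | mem x hx =>
    obtain ⟨l, hl, rfl, rfl⟩ := hx
    induction l with
    | nil => simp
    | cons p l ih =>
      have ih := ih fun q hq => hl q (List.mem_cons_of_mem _ hq)
      have hp := omega_lie (hl p List.mem_cons_self)
      have e := congrArg (iota g) hp
      rw [iota_lie, map_smul, sub_eq_iff_eq_add] at e
      simp only [List.map_cons, List.prod_cons, List.sum_cons]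
      change iota g (g.el 1 omega) * (iota g p.2 * _) = iota g p.2 * _ * _ + (_ : ℂ) • (iota g p.2 * _)
      rw [← mul_assoc, e, add_mul, mul_assoc, ih, mul_add, smul_mul_assoc, mul_smul_comm, mul_assoc]
      push_cast
      module

lemma degUE_eq_bot {n : ℚ} (h : ¬∃ k : ℤ, n * g.T = k) : degUE g n = ⊥ := by
  rw [eq_bot_iff, degUE, Submodule.span_le]
  rintro x ⟨l, hl, rfl, rfl⟩
  change _ = 0
  by_contra hx
  apply h
  clear h
  induction l with
  | nil => exact ⟨0, by simp⟩
  | cons p l ih =>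
    simp only [List.map_cons, List.prod_cons, List.sum_cons] at hx ⊢
    obtain ⟨k, hk⟩ := ih (fun q hq => hl q (List.mem_cons_of_mem _ hq)) (right_ne_zero_of_mul hx)
    by_cases hp : ∃ k : ℤ, p.1 * g.T = k
    · obtain ⟨j, hj⟩ := hp
      exact ⟨j + k, by rw [add_mul, hj, hk]; push_cast; rfl⟩
    · have := hl p List.mem_cons_self
      rw [degVg_eq_bot hp, Submodule.mem_bot] at this
      rw [this, map_zero, zero_mul] at hx
      exact absurd rfl hx

end Enveloping

/-! ### The induced module `M(U)` -/

section Induced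

open VertexOperatorAlgebra FiniteOrderAut TensorProduct

open scoped ModuleCat

variable {V : Type u} [AddCommGroup V] [Module ℂ V] [VertexOperatorAlgebra V]
  {g : FiniteOrderAut V}

variable (U U' : ModuleCat.{u} g.A)

/-- The map `U → M(U)`. -/
def inM : U →ₗ[ℂ] MU U :=
  ((relM U).mkQ.restrictScalars ℂ).comp (TensorProduct.mk ℂ (UE g) U 1)

lemma inM_apply (u : U) : inM U u = (relM U).mkQ (1 ⊗ₜ u) := rfl

lemma smul_inM (x : UE g) (u : U) : x • inM U u = (relM U).mkQ (x ⊗ₜ u) := by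
  rw [inM_apply, ← map_smul, TensorProduct.smul_tmul', smul_eq_mul, mul_one]

lemma range_inM : LinearMap.range (inM U) = imU U := by
  apply le_antisymm
  · rintro _ ⟨u, rfl⟩
    exact Submodule.subset_span ⟨u, rfl⟩
  · rw [imU, Submodule.span_le]
    rintro _ ⟨u, rfl⟩
    exact ⟨u, rfl⟩

variable {U U'}

@[elab_as_elim]
lemma MU_induction {P : MU U → Prop} (add : ∀ x y, P x → P y → P (x + y))
    (smul : ∀ (x : UE g) (u : U), P (x • inM U u)) (w : MU U) : P w := by
  obtain ⟨w, rfl⟩ := (relM U).mkQ_surjective w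
  induction w with
  | zero => simpa using smul 0 0
  | add x y hx hy => rw [map_add]; exact add _ _ hx hy
  | tmul x u => rw [← smul_inM]; exact smul x u

lemma mapM_inM (f : U ⟶ U') (u : U) : mapM f (inM U u) = inM U' (f.hom u) := rfl

lemma rho_neg {n : ℚ} (hn : n < 0) {y : g.Vg} (hy : y ∈ g.degVg n) (u : U) :
    act g (MU U) y (inM U u) = 0 := by
  rw [act_apply, smul_inM, Submodule.mkQ_apply, Submodule.Quotient.mk_eq_zero]
  exact Submodule.subset_span (Or.inl ⟨n, y, u, hn, hy, rfl⟩)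

lemma act_el_inM {k : ℤ} {a : V} (hk : a ∈ wt V k) (ha : a ∈ g.eig 0) (u : U) :
    act g (MU U) (g.el ((k : ℚ) - 1) a) (inM U u) = inM U (g.toA a • u) := by
  rw [act_apply, smul_inM, inM_apply, ← sub_eq_zero, ← map_sub, Submodule.mkQ_apply,
    Submodule.Quotient.mk_eq_zero]
  exact Submodule.subset_span (Or.inr ⟨k, a, u, hk, ha, rfl⟩)

lemma act_inM_zero {y : g.Vg} (hy : y ∈ g.degVg 0) (u : U) :
    act g (MU U) y (inM U u) = inM U (g.rho y • u) := by
  induction hy using Submodule.span_induction with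
  | zero => simp
  | add y y' _ _ hy hy' => rw [map_add, LinearMap.add_apply, hy, hy', map_add, add_smul, map_add]
  | smul c y _ hy => rw [map_smul, LinearMap.smul_apply, hy, g.rho.map_smul, smul_assoc,
      (inM U).map_smul]
  | mem y hy =>
    obtain ⟨k, q, a, hk, hq, hn, rfl⟩ := hy
    obtain rfl : q = (k : ℚ) - 1 := by linarith
    have ha : a ∈ g.eig 0 := by
      have := eig_int (g := g) (k - 1)
      push_cast at this
      rwa [this] at hq
    rw [act_el_inM hk ha, rho_el hk hq, if_pos rfl]

lemma grM_eq (n : ℚ) : grM U n =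
    Submodule.span ℂ {w | ∃ x ∈ degUE g n, ∃ u : U, w = x • inM U u} := by
  simp only [grM, smul_inM]

lemma smul_inM_mem {n : ℚ} {x : UE g} (hx : x ∈ degUE g n) (u : U) : x • inM U u ∈ grM U n := by
  rw [grM_eq]
  exact Submodule.subset_span ⟨x, hx, u, rfl⟩

lemma grM_mode (m n : ℚ) (y : g.Vg) (hy : y ∈ g.degVg m) (w : MU U) (hw : w ∈ grM U n) :
    act g (MU U) y w ∈ grM U (n + m) := by
  rw [grM_eq] at hw
  induction hw using Submodule.span_induction with
  | zero => simp
  | add w w' _ _ h h' => rw [map_add]; exact Submodule.add_mem _ h h'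
  | smul c w _ h => rw [map_smul]; exact Submodule.smul_mem _ _ h
  | mem w hw =>
    obtain ⟨x, hx, u, rfl⟩ := hw
    rw [act_apply, ← mul_smul, add_comm]
    exact smul_inM_mem (mul_mem_degUE (iota_mem_degUE hy) hx) u

lemma iSup_grM : ⨆ n, grM U n = ⊤ := by
  rw [eq_top_iff]
  rintro w -
  induction w using MU_induction with
  | add x y hx hy => exact Submodule.add_mem _ hx hy
  | smul x u =>
    have hx : x ∈ ⨆ n, degUE g n := by rw [iSup_degUE]; trivial
    induction hx using Submodule.iSup_induction' with
    | mem n x hx => exact Submodule.mem_iSup_of_mem n (smul_inM_mem hx u)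
    | zero => simp
    | add x y _ _ hx hy => rw [add_smul]; exact Submodule.add_mem _ hx hy

/-- The class of `ω` is central in `A_g(V)`. -/
lemma toA_omega_comm (x : g.A) : g.toA omega * x = x * g.toA omega := by
  obtain ⟨b, rfl⟩ := g.toA_surjective x
  induction b using g.hom_induction with
  | h0 => simp
  | hadd u v hu hv => rw [map_add, mul_add, hu, hv, add_mul]
  | h j q b h0 h1 hj hq =>
    rcases h0.eq_or_lt with rfl | h0
    · have e := toA_commutator omega_wt omega_eig hj hq
      rw [← sub_eq_zero, e, fs_range (N := 2)]
      · rw [Finset.sum_range_succ, Finset.sum_range_one]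
        have h2 := (g.toA_eq_zero).2 (deriv_add_mem_O (g := g) hj)
        rw [mem_wt] at hj
        rw [map_add, ← hj, add_comm] at h2
        norm_num
        exact h2
      · intro i hi
        have h0 : Ring.choose (((2 : ℤ) : ℂ) - 1) i = 0 := by
          have := Ring.choose_natCast (R := ℂ) 1 i
          rw [Nat.choose_eq_zero_of_lt (by omega)] at this
          norm_num at this ⊢
          exact this
        rw [h0, zero_smul]
    · rw [(g.toA_eq_zero).2 (eig_le_O h0 h1 hq), mul_zero, zero_mul]

variable (U) in
/-- The action of the central element `ω` as an endomorphism of `U`. -/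
def omegaHom : U ⟶ U :=
  ModuleCat.ofHom
    { toFun := fun u => g.toA omega • u
      map_add' := fun u v => smul_add _ u v
      map_smul' := fun x u => by
        rw [RingHom.id_apply, ← mul_smul, ← mul_smul, toA_omega_comm] }

variable (U) in
/-- The operator that acts on `M(U)(n)` as `n`. -/
def degM : Module.End ℂ (MU U) :=
  act g (MU U) (g.el 1 omega) - (mapM (omegaHom U)).restrictScalars ℂ

/-- For `x` of degree `n`, `ω(1) x u = x ω(1) u + n x u`, and `ω(1) u` is `[ω] u`. Since `[ω]` is
central, `u ↦ [ω] u` is `A_g(V)`-linear and induces `x u ↦ x [ω] u` on `M(U)`; subtracting it leaves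
`n`. -/
lemma degM_apply {n : ℚ} {w : MU U} (hw : w ∈ grM U n) : degM U w = (n : ℂ) • w := by
  rw [grM_eq] at hw
  induction hw using Submodule.span_induction with
  | zero => simp
  | add w w' _ _ h h' => rw [map_add, h, h', smul_add]
  | smul c w _ h => rw [map_smul, h, smul_comm]
  | mem w hw =>
    obtain ⟨x, hx, u, rfl⟩ := hw
    have e := act_el_inM omega_wt omega_eig u
    norm_num at e
    rw [degM, LinearMap.sub_apply, LinearMap.restrictScalars_apply,
      (mapM (omegaHom U)).map_smul, mapM_inM]
    change _ - x • inM U (g.toA omega • u) = _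
    rw [← e, act_apply, act_apply, ← mul_smul, ← mul_smul, omega_comm_degUE hx, add_smul, smul_assoc]
    abel

lemma grM_indep : iSupIndep (grM U) := by
  refine ((Module.End.eigenspaces_iSupIndep (degM U)).comp (f := fun n : ℚ => (n : ℂ))
    Rat.cast_injective).mono fun n y hy => ?_
  exact Module.End.mem_eigenspace_iff.2 (degM_apply hy)

lemma imU_le : imU U ≤ grM U 0 := by
  rw [← range_inM]
  rintro _ ⟨u, rfl⟩
  rw [← one_smul (UE g) (inM U u)]
  exact smul_inM_mem one_mem_degUE u

lemma gen_imU : gen (act g (MU U)) (imU U) = ⊤ := by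
  rw [eq_top_iff]
  refine le_sInf fun N hN w hw => ?_
  clear hw
  induction w using MU_induction with
  | add x y hx hy => exact Submodule.add_mem _ hx hy
  | smul x u => exact hN.2.smul_mem x (hN.1 (by rw [← range_inM]; exact ⟨u, rfl⟩))

/-- `U` generates `M(U)` and is stable under `V[g]_- ⊕ V[g]_0`, so everything else is reached by
positive degrees. -/
lemma imU_sup : imU U ⊔ sumOver (grM U) (0 < ·) = ⊤ := by
  rw [eq_top_iff, ← gen_imU]
  refine gen_le_sup act_lie grM_mode (fun n hn y hy w hw => ?_)
    (imU_le.trans (le_sumOver (p := (0 ≤ ·)) le_rfl))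
  rw [← range_inM] at hw ⊢
  obtain ⟨u, rfl⟩ := hw
  rcases hn.eq_or_lt with rfl | hn
  · exact ⟨_, (act_inM_zero hy u).symm⟩
  · rw [rho_neg hn hy]; exact Submodule.zero_mem _

lemma grM_zero : grM U 0 = imU U := by
  apply le_antisymm _ imU_le
  have h := sumOver_disjoint grM_indep (gr := grM U) (p := (0 < ·)) (q := (· = 0)) fun n hn => hn.ne'
  have h' := (h.mono_right (le_sumOver (gr := grM U) (p := (· = 0)) rfl)).le_bot
  intro w hw
  have hw' : w ∈ imU U ⊔ sumOver (grM U) (0 < ·) := by rw [imU_sup]; trivial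
  obtain ⟨s, hs, t, ht, rfl⟩ := Submodule.mem_sup.1 hw'
  have : t ∈ (⊥ : Submodule ℂ (MU U)) :=
    h' ⟨ht, by simpa using Submodule.sub_mem _ hw (imU_le hs)⟩
  rw [(Submodule.mem_bot ℂ).1 this, add_zero]
  exact hs

/-- The degrees `≥ 0` already span `M(U)`, and the homogeneous subspaces are independent. -/
lemma grM_neg {n : ℚ} (hn : n < 0) : grM U n = ⊥ := by
  have h := sumOver_disjoint grM_indep (gr := grM U) (p := (0 ≤ ·)) (q := (· < 0))
    fun n hn => not_lt.2 hn
  have h1 : sumOver (grM U) (0 ≤ ·) = ⊤ := by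
    rw [eq_top_iff, ← imU_sup]
    exact sup_le (imU_le.trans (le_sumOver (p := (0 ≤ ·)) le_rfl))
      (sumOver_le fun n hn => le_sumOver (p := (0 ≤ ·)) (le_of_lt hn))
  rw [h1] at h
  rw [eq_bot_iff, ← top_disjoint.1 h]
  exact le_sumOver (gr := grM U) (p := (· < 0)) hn

lemma grM_support {n : ℚ} (h : ¬∃ k : ℤ, n * g.T = k) : grM U n = ⊥ := by
  rw [grM_eq, degUE_eq_bot h, eq_bot_iff, Submodule.span_le]
  rintro w ⟨x, hx, u, rfl⟩
  rw [(Submodule.mem_bot ℂ).1 hx, zero_smul]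
  rfl

variable (U) in
lemma isGrRep_MU : IsGrRep (act g (MU U)) (grM U) where
  lie := act_lie
  internal := (DirectSum.isInternal_submodule_iff_iSupIndep_and_iSup_eq_top _).2
    ⟨grM_indep, iSup_grM⟩
  mode := grM_mode
  neg := fun _ hn => grM_neg hn

/-- The action of `U(V[g])` on a `V[g]`-module `W` extends a linear map `U → W` to
`U(V[g]) ⊗ U → W`. -/
def liftTensor {W : Type*} [AddCommGroup W] [Module ℂ W] (F : UE g →ₐ[ℂ] Module.End ℂ W)
    (f : U →ₗ[ℂ] W) : UE g ⊗[ℂ] U →ₗ[ℂ] W :=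
  TensorProduct.lift (F.toLinearMap.compl₂ f)

lemma liftTensor_tmul {W : Type*} [AddCommGroup W] [Module ℂ W] (F : UE g →ₐ[ℂ] Module.End ℂ W)
    (f : U →ₗ[ℂ] W) (x : UE g) (u : U) : liftTensor F f (x ⊗ₜ u) = F x (f u) := rfl

lemma liftTensor_smul {W : Type*} [AddCommGroup W] [Module ℂ W] (F : UE g →ₐ[ℂ] Module.End ℂ W)
    (f : U →ₗ[ℂ] W) (x : UE g) (t : UE g ⊗[ℂ] U) :
    liftTensor F f (x • t) = F x (liftTensor F f t) := by
  induction t with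
  | zero => simp
  | add t t' h h' => rw [smul_add, map_add, map_add, map_add, h, h']
  | tmul y u =>
    rw [TensorProduct.smul_tmul', liftTensor_tmul, liftTensor_tmul, smul_eq_mul, map_mul,
      Module.End.mul_apply]

/-- The universal property of `M(U)`. -/
lemma liftTensor_relM {W : Type*} [AddCommGroup W] [Module ℂ W] {φ : g.Vg →ₗ[ℂ] Module.End ℂ W}
    (hφ : ∀ x y, φ ⁅x, y⁆ = φ x * φ y - φ y * φ x) {f : U →ₗ[ℂ] W}
    (hneg : ∀ n < 0, ∀ y ∈ g.degVg n, ∀ u, φ y (f u) = 0)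
    (hzero : ∀ (k : ℤ) (a : V), a ∈ wt V k → a ∈ g.eig 0 → ∀ u,
      φ (g.el ((k : ℚ) - 1) a) (f u) = f (g.toA a • u)) {t : UE g ⊗[ℂ] U} (ht : t ∈ relM U) :
    liftTensor (liftEnd φ hφ) f t = 0 := by
  induction ht using Submodule.span_induction with
  | zero => simp
  | add t t' _ _ h h' => rw [map_add, h, h', add_zero]
  | smul x t _ h => rw [liftTensor_smul, h, map_zero]
  | mem t ht =>
    rcases ht with ⟨n, y, u, hn, hy, rfl⟩ | ⟨k, a, u, hk, ha, rfl⟩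
    · rw [liftTensor_tmul]
      change liftEnd φ hφ (iota g y) (f u) = 0
      rw [liftEnd_iota, hneg n hn y hy]
    · rw [map_sub, liftTensor_tmul, liftTensor_tmul, map_one, Module.End.one_apply]
      change liftEnd φ hφ (iota g _) (f u) - _ = 0
      rw [liftEnd_iota, hzero k a hk ha, sub_self]

-- To exclude that the relations collapse `U`, it suffices to map `M(U)` to one module in which `U`
-- survives. The module of `exists_induced`, for `V[g]_- ⊕ V[g]_0` acting through `rho`, satisfies
-- all relations and contains `U`.
variable (U) in
lemma inM_injective : Function.Injective (inM U) := by
  let ρ : g.Vg →ₗ[ℂ] Module.End ℂ U := (Algebra.lsmul ℂ ℂ U : g.A →ₐ[ℂ] _).toLinearMap.comp g.rho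
  have hρ : ∀ y u, ρ y u = g.rho y • u := fun _ _ => rfl
  obtain ⟨κ, φ, i, hφ, hi⟩ := exists_induced (isCompl_pos_nonpos (g := g))
    (fun x hx y hy => lie_mem_nonpos hx hy) ρ
    (fun x hx y hy => by
      ext u
      rw [LinearMap.sub_apply, Module.End.mul_apply, Module.End.mul_apply, hρ, hρ, hρ, hρ, hρ,
        rho_lie hx hy, sub_smul, mul_smul, mul_smul])
    (fun x hx => by
      ext u
      rw [hρ, rho_pos hx, zero_smul, LinearMap.zero_apply])
  rw [← LinearMap.ker_eq_bot, LinearMap.ker_eq_bot']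
  intro u hu
  rw [inM_apply, Submodule.mkQ_apply, Submodule.Quotient.mk_eq_zero] at hu
  have h := liftTensor_relM hφ (f := Finsupp.lsingle i) (fun n hn y hy u => ?_)
    (fun k a hk ha u => ?_) hu
  · rw [liftTensor_tmul, map_one, Module.End.one_apply, Finsupp.lsingle_apply,
      Finsupp.single_eq_zero] at h
    exact h
  · rw [Finsupp.lsingle_apply, hi y (le_sumOver (p := (· ≤ 0)) hn.le hy), hρ,
      rho_degVg hn.ne hy, zero_smul, Finsupp.single_zero]
  · have ha' : a ∈ g.eig ((k : ℚ) - 1) := by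
      have := eig_int (g := g) (k - 1)
      push_cast at this
      rwa [this]
    rw [Finsupp.lsingle_apply, Finsupp.lsingle_apply, hi, hρ, rho_el hk ha', if_pos rfl]
    exact le_sumOver (p := (· ≤ 0)) le_rfl (el_mem_degVg hk (by ring))

end Induced

/-! ### The module `L(U)` -/

section LModule

open VertexOperatorAlgebra FiniteOrderAut TensorProduct

open scoped ModuleCat

variable {V : Type u} [AddCommGroup V] [Module ℂ V] [VertexOperatorAlgebra V]
  {g : FiniteOrderAut V}

variable {U U' : ModuleCat.{u} g.A}

lemma le_JU {N : Submodule (UE g) (MU U)} (h : IsGr (grM U) (N.restrictScalars ℂ))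
    (h0 : N.restrictScalars ℂ ⊓ grM U 0 = ⊥) : N ≤ JU U :=
  le_sSup ⟨h, by rwa [grM_zero] at h0⟩

-- A sum of submodules that meet `U` trivially could meet `U`. Here each of them is graded and
-- therefore lies in positive degree, a condition that passes to the sum; hence `J` itself is one of
-- them.
variable (U) in
lemma JU_spec : IsGr (grM U) ((JU U).restrictScalars ℂ) ∧
    (JU U).restrictScalars ℂ ≤ sumOver (grM U) (0 < ·) := by
  let S : Set (Submodule ℂ (MU U)) :=
    {N | IsStable (act g (MU U)) N ∧ IsGr (grM U) N ∧ N ≤ sumOver (grM U) (0 < ·)}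
  have hS : IsStable (act g (MU U)) (sSup S) := isStable_sSup fun N hN => hN.1
  have hG : IsGr (grM U) (sSup S) := isGr_sSup fun N hN => hN.2.1
  have hP : sSup S ≤ sumOver (grM U) (0 < ·) := sSup_le fun N hN => hN.2.2
  have h1 : JU U ≤ hS.toUE := by
    refine sSup_le fun N hN => ?_
    have : N.restrictScalars ℂ ∈ S := ⟨isStable_restrictScalars N, hN.1,
      (isGrRep_MU U).le_pos hN.1 (by rw [grM_zero]; exact hN.2)⟩
    exact fun w hw => le_sSup this hw
  have h2 : hS.toUE ≤ JU U :=
    le_JU (by rwa [IsStable.restrictScalars_toUE]) (by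
      rw [IsStable.restrictScalars_toUE]
      exact (isGrRep_MU U).eq_bot_of_le_pos hP)
  rw [le_antisymm h1 h2, IsStable.restrictScalars_toUE]
  exact ⟨hG, hP⟩

lemma JU_inf : (JU U).restrictScalars ℂ ⊓ grM U 0 = ⊥ :=
  (isGrRep_MU U).eq_bot_of_le_pos (JU_spec U).2

/-- The induced map preserves degrees, so the image of `J` is a graded submodule of positive degree
and lies in the maximal one. -/
lemma map_JU (f : U ⟶ U') : JU U ≤ (JU U').comap (mapM f) := by
  rw [← Submodule.map_le_iff_le_comap]
  have hmap : ((JU U).map (mapM f)).restrictScalars ℂ =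
      ((JU U).restrictScalars ℂ).map ((mapM f).restrictScalars ℂ) := rfl
  apply le_JU
  · rw [hmap]
    exact IsGr.map (fun n w hw => mapM_gr f n hw) (JU_spec U).1
  · rw [hmap]
    refine (isGrRep_MU U').eq_bot_of_le_pos ?_
    rw [Submodule.map_le_iff_le_comap]
    refine (JU_spec U).2.trans (sumOver_le fun n hn w hw => ?_)
    exact le_sumOver (p := (0 < ·)) hn (mapM_gr f n hw)

variable (U) in
/-- The quotient map `M(U) → L(U)`. -/
def toL : MU U →ₗ[ℂ] LU U := (JU U).mkQ.restrictScalars ℂ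

lemma toL_surjective : Function.Surjective (toL U) := (JU U).mkQ_surjective

lemma toL_eq_zero {w : MU U} : toL U w = 0 ↔ w ∈ JU U := Submodule.Quotient.mk_eq_zero _

lemma toL_mem {n : ℚ} {w : MU U} (hw : w ∈ grM U n) : toL U w ∈ Lgr U n := ⟨w, hw, rfl⟩

variable (U) in
/-- The operator that acts on `L(U)(n)` as `n`. -/
def degL : Module.End ℂ (LU U) :=
  act g (LU U) (g.el 1 omega) -
    ((JU U).mapQ (JU U) (mapM (omegaHom U)) (map_JU (omegaHom U))).restrictScalars ℂ

lemma degL_apply {n : ℚ} {w : LU U} (hw : w ∈ Lgr U n) : degL U w = (n : ℂ) • w := by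
  obtain ⟨w, hw, rfl⟩ := hw
  exact congrArg (toL U) (degM_apply hw)

variable (U) in
lemma isGrRep_LU : IsGrRep (act g (LU U)) (Lgr U) where
  lie := act_lie
  internal := by
    refine (DirectSum.isInternal_submodule_iff_iSupIndep_and_iSup_eq_top _).2 ⟨?_, ?_⟩
    · refine ((Module.End.eigenspaces_iSupIndep (degL U)).comp (f := fun n : ℚ => (n : ℂ))
        Rat.cast_injective).mono fun n y hy => ?_
      exact Module.End.mem_eigenspace_iff.2 (degL_apply hy)
    · have : ⨆ n, Lgr U n = (⨆ n, grM U n).map (toL U) := (Submodule.map_iSup _ _).symm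
      rw [this, iSup_grM, Submodule.map_top, LinearMap.range_eq_top]
      exact toL_surjective
  mode := by
    rintro m n y hy _ ⟨w, hw, rfl⟩
    exact toL_mem (grM_mode m n y hy w hw)
  neg := by
    intro n hn
    rw [Lgr, grM_neg hn, Submodule.map_bot]

variable (U) in
/-- The map `U → L(U)`. -/
def inL : U →ₗ[ℂ] LU U := (toL U).comp (inM U)

lemma range_inL : LinearMap.range (inL U) = Lgr U 0 := by
  rw [inL, LinearMap.range_comp, range_inM, ← grM_zero]
  rfl

lemma inL_mem (u : U) : inL U u ∈ Lgr U 0 := by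
  rw [← range_inL]
  exact ⟨u, rfl⟩

variable (U) in
lemma inL_injective : Function.Injective (inL U) := by
  rw [← LinearMap.ker_eq_bot, LinearMap.ker_eq_bot']
  intro u hu
  have h1 : inM U u ∈ JU U := toL_eq_zero.1 hu
  have h2 : inM U u ∈ (JU U).restrictScalars ℂ ⊓ grM U 0 :=
    ⟨h1, by rw [grM_zero, ← range_inM]; exact ⟨u, rfl⟩⟩
  rw [JU_inf, Submodule.mem_bot] at h2
  exact (map_eq_zero_iff _ (inM_injective U)).1 h2

-- Generation is inherited from `M(U)`. If a graded submodule of `L(U)` does not meet degree `0`,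
-- its preimage meets `M(U)(0)` only in `J ∩ M(U)(0) = 0`; so it is contained in `J` by maximality.
variable (U) in
lemma isTight_LU : IsTight (act g (LU U)) (Lgr U) where
  gen_zero := by
    rw [eq_top_iff]
    refine le_sInf fun N hN w _ => ?_
    obtain ⟨w, rfl⟩ := toL_surjective w
    have h : gen (act g (MU U)) (imU U) ≤ N.comap (toL U) := by
      refine gen_le (fun w hw => hN.1 (toL_mem (by rwa [grM_zero]))) fun y w hw => ?_
      exact hN.2 y _ hw
    rw [gen_imU] at h
    exact h trivial
  eq_bot := by
    intro N hN hgr h0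
    have hs : IsStable (act g (MU U)) (N.comap (toL U)) := fun y w hw => hN y _ hw
    have h1 : hs.toUE ≤ JU U := by
      apply le_JU
      · exact hgr.comap (isGrRep_MU U).internal (isGrRep_LU U).internal fun n w hw => toL_mem hw
      · rw [eq_bot_iff, ← JU_inf]
        rintro w ⟨hw, hw0⟩
        have h2 : toL U w ∈ N ⊓ Lgr U 0 := ⟨hw, toL_mem hw0⟩
        rw [h0, Submodule.mem_bot] at h2
        exact ⟨toL_eq_zero.1 h2, hw0⟩
    rw [eq_bot_iff]
    intro w hw
    obtain ⟨w, rfl⟩ := toL_surjective w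
    exact toL_eq_zero.2 (h1 hw)

lemma zeroMode_inL (a : V) (u : U) :
    zeroMode (modes (act g (LU U))) a (inL U u) = inL U (g.toA a • u) := by
  induction a using g.hom_induction with
  | h0 => simp
  | hadd a b ha hb => rw [map_add, LinearMap.add_apply, ha, hb, map_add, add_smul, map_add]
  | h k q a h0 h1 hk hq =>
    rw [zeroMode_apply hk, modes_apply]
    rcases h0.eq_or_lt with rfl | h0
    · exact congrArg (toL U) (act_el_inM hk hq u)
    -- For `r > 0` both sides vanish: `V^r ⊆ O_g(V)`, and the integer exponent `wt a - 1` does not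
    -- occur for `V^r`.
    · rw [(g.toA_eq_zero).2 (eig_le_O h0 h1 hq), zero_smul, map_zero, el_of_ne hq, map_zero,
        LinearMap.zero_apply]
      rintro ⟨z, hz⟩
      have e : q = ((k - 1 + z : ℤ) : ℚ) := by push_cast; linarith
      rw [e] at h0 h1
      have : (0 : ℤ) < k - 1 + z := by exact_mod_cast h0
      have : k - 1 + z < (1 : ℤ) := by exact_mod_cast h1
      omega

variable (U) in
lemma actsThroughA_LU : ActsThroughA (act g (LU U)) (Lgr U) where
  vac := by
    intro w hw
    rw [← range_inL] at hw
    obtain ⟨u, rfl⟩ := hw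
    have h := zeroMode_inL vac u
    rw [zeroMode_apply vac_wt, modes_apply] at h
    norm_num at h
    rw [h]
    exact congrArg _ (one_smul g.A u)
  O := by
    intro x hx w hw
    rw [← range_inL] at hw
    obtain ⟨u, rfl⟩ := hw
    rw [zeroMode_inL, (g.toA_eq_zero).2 hx, zero_smul, map_zero]
  star := by
    intro a b w hw
    rw [← range_inL] at hw
    obtain ⟨u, rfl⟩ := hw
    rw [zeroMode_inL, zeroMode_inL, zeroMode_inL, ← g.toA_mul, mul_smul]

lemma LY_eq : LY U = modes (act g (LU U)) := rfl

variable (g) in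
/-- `L` is a well-defined functor to admissible modules. -/
theorem lWellDefined : LWellDefined g where
  adm U := by
    rw [LY_eq]
    refine (isGrRep_LU U).isAdmissible (isTight_LU U) (actsThroughA_LU U) fun n hn => ?_
    rw [Lgr, grM_support hn, Submodule.map_bot]
  map_J _ _ f := map_JU f

end LModule

/-! ### Admissible modules as graded `V[g]`-modules -/

section Admissible

open VertexOperatorAlgebra FiniteOrderAut

variable {V : Type u} [AddCommGroup V] [Module ℂ V] [VertexOperatorAlgebra V]
  {g : FiniteOrderAut V}

/-- The Jacobi identity with `v = 1`, `l = -2`, `n = 0`. On the right only modes of `1` different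
from `1_{-1}` occur, so it vanishes; the left side is `(u_{-2} 1)_m + m (u_{-1} 1)_{m-1}`, where
`u_{-2} 1 = L(-1) u`. -/
lemma IsWeakTwisted.deriv {M : Type*} [AddCommGroup M] [Module ℂ M]
    {Y : V →ₗ[ℂ] (ℚ → Module.End ℂ M)} (h : IsWeakTwisted g Y) {m : ℚ} {u : V} (hu : u ∈ g.eig m) :
    Y (md omega 0 u) m = -(m : ℂ) • Y u (m - 1) := by
  ext w
  have e := h.jacobi m u hu vac w (-2) 0
  rw [finsum_eq_zero_of_forall_eq_zero (f := fun i : ℕ => ((-1 : ℂ) ^ i * Ring.choose _ i) • _),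
    fs_range (N := 2)] at e
  · have hc : md u (-1) vac = u := creation u
    have h2 : md u (-2) vac = md omega 0 u := by
      have h3 := LinearMap.congr_fun (md_deriv u (-1)) vac
      rw [show md (md omega 0 u) (-1) vac = md omega 0 u from creation _] at h3
      rw [h3]
      simp
    norm_num [Finset.sum_range_succ, hc, h2] at e
    rw [eq_neg_of_add_eq_zero_left e, LinearMap.smul_apply, neg_smul]
  · intro i hi
    have : md u (-2 + i) vac = 0 := creation_nonneg u _ (by omega)
    rw [this]; simp
  · intro i
    have hi : (0 : ℚ) ≤ i := Nat.cast_nonneg i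
    rw [h.vacuum, h.vacuum, if_neg (by linarith), if_neg (by push_cast; linarith)]
    simp

namespace AdmMod

variable (M : AdmMod g)

/-- The action of `ℂ[t^{1/T}, t^{-1/T}] ⊗ V` on `M`. -/
def repF : (ℚ →₀ V) →ₗ[ℂ] Module.End ℂ M.carrier :=
  Finsupp.lsum ℂ fun q : ℚ => (LinearMap.proj q).comp M.Y

lemma repF_single (q : ℚ) (a : V) : M.repF (Finsupp.single q a) = M.Y a q := by
  rw [repF, Finsupp.lsum_single]; rfl

lemma repF_Dop {z : ℚ →₀ V} (hz : z ∈ g.Lg) : M.repF (Dop z) = 0 := by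
  refine Lg_induction (g := g) (P := fun z => M.repF (Dop z) = 0) (by simp)
    (fun x y hx hy => by rw [map_add, map_add, hx, hy, add_zero]) (fun q a ha => ?_) hz
  rw [Dop_single, map_add, map_smul, repF_single, repF_single, M.adm.deriv ha]
  module

/-- The action of `V[g]` on an admissible module. -/
def rep : g.Vg →ₗ[ℂ] Module.End ℂ M.carrier :=
  g.DLg.liftQ (M.repF.comp g.Lg.subtype) (by
    rintro x ⟨z, hz', hz⟩
    change M.repF x.1 = 0
    rw [show x.1 = Dop z from hz.symm, M.repF_Dop hz'])

lemma rep_el (q : ℚ) (a : V) : M.rep (g.el q a) = M.Y a q := by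
  rw [M.adm.Y_eigProj, ← M.repF_single]
  rfl

lemma rep_lie (x y : g.Vg) : M.rep ⁅x, y⁆ = M.rep x * M.rep y - M.rep y * M.rep x := by
  induction x using Vg_induction with
  | zero => simp
  | add x x' hx hx' => simp only [add_lie, map_add, hx, hx', add_mul, mul_add]; abel
  | mem k m a _ ha =>
    induction y using Vg_induction with
    | zero => simp
    | add x x' hx hx' => simp only [lie_add, map_add, hx, hx', add_mul, mul_add]; abel
    | mem j n b _ _ =>
      obtain ⟨N, hN⟩ := md_nat_trunc a b
      ext w
      have e := M.adm.comm ha b w n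
      rw [fs_range (N := N) fun i hi => by simp [hN i hi]] at e
      rw [el_lie ha, fs_range (N := N) fun i hi => by rw [hN i hi, map_zero, smul_zero]]
      simp only [map_sum, map_smul, rep_el, LinearMap.sum_apply, LinearMap.smul_apply,
        LinearMap.sub_apply, Module.End.mul_apply]
      exact e.symm

lemma isGrRep : IsGrRep M.rep M.gr where
  lie := M.rep_lie
  internal := M.adm.gr_internal
  mode := by
    intro m n y hy w hw
    induction hy using Submodule.span_induction with
    | zero => simp
    | add y y' _ _ hy hy' => rw [map_add]; exact Submodule.add_mem _ hy hy'
    | smul c y _ hy => rw [map_smul]; exact Submodule.smul_mem _ _ hy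
    | mem y hy =>
      obtain ⟨k, q, a, hk, _, rfl, rfl⟩ := hy
      rw [rep_el]
      have := M.adm.gr_mode k a hk q n w hw
      rwa [show n + k - q - 1 = n + (k - q - 1) by ring] at this
  neg := by
    intro n hn
    refine M.adm.gr_support n ?_
    rintro ⟨k, rfl⟩
    have : (0 : ℚ) ≤ k / g.T := by positivity
    linarith

lemma omega_eq_lowest : Omega M.Y = lowest M.rep := by
  apply le_antisymm
  · intro w hw n hn y hy
    induction hy using Submodule.span_induction with
    | zero => simp
    | add y y' _ _ hy hy' => rw [map_add, LinearMap.add_apply, hy, hy', add_zero]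
    | smul c y _ hy => rw [map_smul, LinearMap.smul_apply, hy, smul_zero]
    | mem y hy =>
      obtain ⟨k, q, a, hk, _, rfl, rfl⟩ := hy
      rw [rep_el]
      exact hw k a hk q hn
  · intro w hw k v hv m hm
    rw [← rep_el]
    exact hw _ hm _ (el_mem_degVg hv rfl)

lemma isGradedSub_iff {N : Submodule ℂ M.carrier} :
    M.IsGradedSub N ↔ IsStable M.rep N ∧ IsGr M.gr N := by
  constructor
  · rintro ⟨h, h'⟩
    refine ⟨fun y w hw => ?_, h'⟩
    induction y using Vg_induction with
    | zero => simp
    | add x y hx hy => rw [map_add]; exact Submodule.add_mem _ hx hy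
    | mem k q a _ _ => rw [rep_el]; exact h a q w hw
  · rintro ⟨h, h'⟩
    exact ⟨fun v n w hw => by rw [← rep_el]; exact h _ w hw, h'⟩

/-- Modules that are generated in degree `0` and whose nonzero graded submodules meet `M(0)`. -/
def Tight (M : AdmMod g) : Prop := IsTight M.rep M.gr

variable {M}

/-- By the normalization `N` has a nonzero part of degree `0`, and it generates a nonzero graded
submodule of the simple `N`. -/
lemma IsSimpleSub.gen_eq {N : Submodule ℂ M.carrier} (hN : M.IsSimpleSub N) :
    gen M.rep (N ⊓ M.gr 0) = N := by
  have h := M.isGradedSub_iff.1 hN.isGradedSub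
  have hle : gen M.rep (N ⊓ M.gr 0) ≤ N := gen_le inf_le_left h.1
  refine (hN.eq_bot_or_eq _ (M.isGradedSub_iff.2 ⟨gen_stable _, gen_isGr M.isGrRep.mode
    (M.isGrRep.isGr_of_le_zero inf_le_right)⟩) hle).resolve_left fun hb => hN.normalized ?_
  rw [eq_bot_iff, ← hb]
  exact le_gen _

lemma IsSimple.tight (hM : AdmMod.IsSimple M) : M.Tight where
  gen_zero := by simpa using IsSimpleSub.gen_eq hM
  eq_bot := by
    intro N hs hg h0
    refine (hM.eq_bot_or_eq N (M.isGradedSub_iff.2 ⟨hs, hg⟩) le_top).resolve_right fun h => ?_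
    rw [h] at h0
    exact hM.normalized h0

/-- Each simple summand is generated by its degree `0`. If a graded submodule `K` has no vectors of
degree `0`, then its projection to a simple summand `N` is a graded submodule, hence `0` or `N`. It
is not `N`, because the nonzero vectors of degree `0` in `N` would be images of vectors of degree
`0` in `K`. So all projections of `K` vanish. -/
lemma IsCompletelyReducible.tight (hM : AdmMod.IsCompletelyReducible M) : M.Tight := by
  classical
  obtain ⟨S, hS, hS₀⟩ := hM
  have hdir : DirectSum.IsInternal fun N : S => (N : Submodule ℂ M.carrier) := by
    convert hS₀
  refine ⟨?_, fun K hK hgr h0 => ?_⟩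
  · rw [eq_top_iff, ← hdir.submodule_iSup_eq_top]
    refine iSup_le fun N => ?_
    rw [← (hS N.1 N.2).gen_eq]
    exact gen_mono inf_le_right
  · have hst : ∀ N : S, IsStable M.rep N.1 := fun N =>
      (M.isGradedSub_iff.1 (hS N.1 N.2).isGradedSub).1
    have hG : ∀ N : S, IsGr M.gr N.1 := fun N =>
      (M.isGradedSub_iff.1 (hS N.1 N.2).isGradedSub).2
    have hrep : ∀ (N : S) (y : g.Vg) (x : M.carrier),
        homProj hdir N (M.rep y x) = M.rep y (homProj hdir N x) := by
      intro N y x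
      induction x using homogeneous_induction hdir with
      | zero => simp
      | add x y hx hy => simp only [map_add, hx, hy]
      | mem N' x hx =>
        rw [homProj_apply hdir N (hst N' y x hx), homProj_apply hdir N hx]
        split_ifs <;> simp
    have hproj : ∀ (N : S) (n : ℚ) (x : M.carrier),
        homProj hdir N (homProj M.isGrRep.internal n x) =
          homProj M.isGrRep.internal n (homProj hdir N x) := by
      intro N n x
      induction x using homogeneous_induction hdir with
      | zero => simp
      | add x y hx hy => simp only [map_add, hx, hy]
      | mem N' x hx =>
        rw [homProj_apply hdir N ((isGr_iff M.isGrRep.internal).1 (hG N') n x hx),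
          homProj_apply hdir N hx]
        split_ifs <;> simp
    rw [eq_bot_iff]
    refine fun x hx => mem_of_homProj hdir fun N => ?_
    have h1 : M.IsGradedSub (K.map (homProj hdir N)) := by
      refine M.isGradedSub_iff.2 ⟨?_, (isGr_iff M.isGrRep.internal).2 ?_⟩
      · rintro y _ ⟨k, hk, rfl⟩
        exact ⟨_, hK y k hk, hrep N y k⟩
      · rintro n _ ⟨k, hk, rfl⟩
        exact ⟨_, (isGr_iff M.isGrRep.internal).1 hgr n k hk, hproj N n k⟩
    have h2 : K.map (homProj hdir N) ≤ N.1 := by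
      rintro _ ⟨k, _, rfl⟩
      exact homProj_mem hdir N k
    rcases (hS N.1 N.2).eq_bot_or_eq _ h1 h2 with h3 | h3
    · rw [← h3]
      exact ⟨x, hx, rfl⟩
    · exfalso
      refine (hS N.1 N.2).normalized (eq_bot_iff.2 ?_)
      rintro w ⟨hw, hw0⟩
      rw [← h3] at hw
      obtain ⟨k, hk, rfl⟩ := hw
      have h4 : homProj M.isGrRep.internal 0 k ∈ K ⊓ M.gr 0 :=
        ⟨(isGr_iff M.isGrRep.internal).1 hgr 0 k hk, homProj_mem _ _ _⟩
      rw [h0, Submodule.mem_bot] at h4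
      rw [← homProj_self M.isGrRep.internal hw0, ← hproj, h4, map_zero]
      exact Submodule.zero_mem _

lemma Tight.omega_eq (hM : M.Tight) : Omega M.Y = M.gr 0 := by
  rw [omega_eq_lowest, M.isGrRep.lowest_eq hM]

/-! ### Submodules of `M` and of `Ω(M)` -/

/-- The two scalar actions on `Ω(M)`, through `A_g(V)` and as a subspace of `M`, have to be
identified before `A_g(V)`-submodules can be treated as complex subspaces. -/
lemma algebraMap_smul_om (c : ℂ) (w : M.Om) : algebraMap ℂ g.A c • w = c • w := by
  change M.omA (algebraMap ℂ g.A c) w = c • w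
  rw [AlgHom.commutes]
  rfl

lemma omega_smul_mem (W : Submodule g.A M.Om) (c : ℂ) {w : M.Om} (hw : w ∈ W) : c • w ∈ W := by
  rw [← algebraMap_smul_om]
  exact W.smul_mem _ hw

/-- An `A_g(V)`-submodule of `Ω(M)` as a subspace of `M`. -/
def omSub (W : Submodule g.A M.Om) : Submodule ℂ M.carrier where
  carrier := {w | ∃ h : w ∈ Omega M.Y, (⟨w, h⟩ : M.Om) ∈ W}
  add_mem' := fun ⟨h, hw⟩ ⟨h', hw'⟩ => ⟨Submodule.add_mem _ h h', W.add_mem hw hw'⟩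
  zero_mem' := ⟨Submodule.zero_mem _, W.zero_mem⟩
  smul_mem' := fun c _ ⟨h, hw⟩ => ⟨Submodule.smul_mem _ c h, omega_smul_mem W c hw⟩

lemma mem_omSub {W : Submodule g.A M.Om} {w : M.Om} : w.1 ∈ omSub W ↔ w ∈ W :=
  ⟨fun ⟨_, h⟩ => h, fun h => ⟨w.2, h⟩⟩

lemma omSub_le (W : Submodule g.A M.Om) : omSub W ≤ Omega M.Y := fun _ h => h.1

lemma omSub_bot : omSub (⊥ : Submodule g.A M.Om) = ⊥ := by
  rw [eq_bot_iff]
  rintro w ⟨h, hw⟩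
  have h0 := (Submodule.mem_bot (M := M.Om) g.A).1 hw
  exact congrArg (fun x : M.Om => x.1) h0

lemma omSub_top : omSub (⊤ : Submodule g.A M.Om) = Omega M.Y :=
  le_antisymm (omSub_le _) fun _ hw => ⟨hw, trivial⟩

lemma omSub_mono {W W' : Submodule g.A M.Om} (h : W ≤ W') : omSub W ≤ omSub W' :=
  fun _ ⟨h', hw⟩ => ⟨h', h hw⟩

lemma omSub_inf (W W' : Submodule g.A M.Om) : omSub W ⊓ omSub W' = omSub (W ⊓ W') :=
  le_antisymm (fun _ ⟨⟨h, hw⟩, ⟨_, hw'⟩⟩ => ⟨h, hw, hw'⟩)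
    (le_inf (omSub_mono inf_le_left) (omSub_mono inf_le_right))

lemma omSub_stable (W : Submodule g.A M.Om) (y : g.Vg) (hy : y ∈ g.degVg 0) (w : M.carrier)
    (hw : w ∈ omSub W) : M.rep y w ∈ omSub W := by
  induction hy using Submodule.span_induction with
  | zero => simp
  | add y y' _ _ hy hy' => rw [map_add]; exact Submodule.add_mem _ hy hy'
  | smul c y _ hy => rw [map_smul]; exact Submodule.smul_mem _ _ hy
  | mem y hy =>
    obtain ⟨k, q, a, hk, _, h, rfl⟩ := hy
    obtain rfl : q = (k : ℚ) - 1 := by linarith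
    rw [rep_el, ← zeroMode_apply hk]
    obtain ⟨hw, hW⟩ := hw
    exact ⟨M.adm.zeroMode_mem a hw, W.smul_mem (g.toA a) hW⟩

/-- The degree `0` part of a submodule of `M` as an `A_g(V)`-submodule of `Ω(M)`. -/
def toOm {N : Submodule ℂ M.carrier} (hN : IsStable M.rep N) : Submodule g.A M.Om where
  carrier := {w | w.1 ∈ N}
  add_mem' := fun h h' => N.add_mem h h'
  zero_mem' := N.zero_mem
  smul_mem' := by
    intro x w hw
    obtain ⟨a, rfl⟩ := g.toA_surjective x
    change (g.toA a • w).1 ∈ N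
    rw [M.toA_smul]
    induction a using g.hom_induction with
    | h0 => simp
    | hadd a b ha hb => rw [map_add]; exact N.add_mem ha hb
    | h k q a _ _ hk _ =>
      rw [zeroMode_apply hk, ← rep_el]
      exact hN _ _ hw

lemma omSub_toOm {N : Submodule ℂ M.carrier} (hN : IsStable M.rep N) :
    omSub (toOm hN) = N ⊓ Omega M.Y :=
  le_antisymm (fun _ ⟨h, hw⟩ => ⟨hw, h⟩) fun _ ⟨hw, h⟩ => ⟨h, hw⟩

/-! ### Simplicity and complete reducibility of `M` and of `Ω(M)` -/

namespace Tight

variable (hM : M.Tight)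

include hM

/-- `W` is stable under `V[g]_0`, so generation adds nothing in degree `0` and `W` can be recovered
from the submodule it generates. -/
lemma gen_omSub_inf (W : Submodule g.A M.Om) : gen M.rep (omSub W) ⊓ M.gr 0 = omSub W :=
  M.isGrRep.gen_inf_zero (by rw [← hM.omega_eq]; exact omSub_le W) (omSub_stable W)

lemma isGradedSub_gen (W : Submodule g.A M.Om) : M.IsGradedSub (gen M.rep (omSub W)) :=
  M.isGradedSub_iff.2 ⟨gen_stable _, gen_isGr M.isGrRep.mode
    (M.isGrRep.isGr_of_le_zero (by rw [← hM.omega_eq]; exact omSub_le W))⟩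

/-- The degree `0` of a graded submodule `N` of the generated module is a submodule of `W`. If it is
zero then `N = 0` by tightness; if it is `W` then `N` contains the generators. -/
lemma isSimpleSub_gen {W : Submodule g.A M.Om} (hW : IsAtom W) :
    M.IsSimpleSub (gen M.rep (omSub W)) where
  isGradedSub := hM.isGradedSub_gen W
  eq_bot_or_eq := by
    intro N hN hle
    have h := M.isGradedSub_iff.1 hN
    have h1 : N ⊓ M.gr 0 = omSub (toOm h.1) := by rw [omSub_toOm, hM.omega_eq]
    have h2 : toOm h.1 ≤ W := by
      intro w hw
      have : w.1 ∈ gen M.rep (omSub W) ⊓ M.gr 0 :=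
        ⟨hle hw, by rw [← hM.omega_eq]; exact w.2⟩
      rw [hM.gen_omSub_inf] at this
      exact mem_omSub.1 this
    rcases hW.le_iff.1 h2 with h3 | h3
    · left
      refine hM.eq_bot N h.1 h.2 ?_
      rw [h1, h3, omSub_bot]
    · right
      refine le_antisymm hle (gen_le ?_ h.1)
      rw [← h3, omSub_toOm]
      exact inf_le_left
  normalized := by
    rw [hM.gen_omSub_inf]
    intro h
    refine hW.1 (eq_bot_iff.2 fun w hw => ?_)
    have := mem_omSub.2 hw
    rw [h] at this
    exact Subtype.ext this

/-- A proper submodule `W` generates either `0` or `N`; the latter is impossible, since the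
generated module has only `W` in degree `0`. -/
lemma isAtom_toOm {N : Submodule ℂ M.carrier} (hN : M.IsSimpleSub N) (hs : IsStable M.rep N) :
    IsAtom (toOm hs) := by
  constructor
  · intro h
    apply hN.normalized
    rw [← hM.omega_eq, ← omSub_toOm hs, h, omSub_bot]
  · intro W hW
    have h1 : gen M.rep (omSub W) ≤ N := by
      refine gen_le ((omSub_mono hW.le).trans ?_) hs
      rw [omSub_toOm]
      exact inf_le_left
    rcases hN.eq_bot_or_eq _ (hM.isGradedSub_gen W) h1 with h2 | h2
    · rw [eq_bot_iff]
      intro w hw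
      have := le_gen (φ := M.rep) _ (mem_omSub.2 hw)
      rw [h2] at this
      exact Subtype.ext this
    · exfalso
      refine hW.not_ge fun w hw => ?_
      have h3 : w.1 ∈ gen M.rep (omSub W) ⊓ M.gr 0 :=
        ⟨by rw [h2]; exact hw, by rw [← hM.omega_eq]; exact w.2⟩
      rw [hM.gen_omSub_inf] at h3
      exact mem_omSub.1 h3

lemma isSimple_of_om (h : IsSimpleModule g.A M.Om) : AdmMod.IsSimple M := by
  have h1 : IsAtom (⊤ : Submodule g.A M.Om) := by
    rw [← isSimpleModule_iff_isAtom]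
    exact IsSimpleModule.congr Submodule.topEquiv
  have h2 := hM.isSimpleSub_gen h1
  rwa [omSub_top, hM.omega_eq, hM.gen_zero] at h2

lemma om_isSimple (h : AdmMod.IsSimple M) : IsSimpleModule g.A M.Om := by
  have hs : IsStable M.rep ⊤ := fun _ _ _ => trivial
  have h1 := hM.isAtom_toOm h hs
  rw [← isSimpleModule_iff_isAtom] at h1
  have h2 : toOm hs = ⊤ := eq_top_iff.2 fun _ _ => trivial
  rw [h2] at h1
  exact IsSimpleModule.congr Submodule.topEquiv.symm

lemma om_isSemisimple (h : AdmMod.IsCompletelyReducible M) : IsSemisimpleModule g.A M.Om := by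
  classical
  obtain ⟨S, hS, hS₀⟩ := h
  have hdir : DirectSum.IsInternal fun N : S => (N : Submodule ℂ M.carrier) := by
    convert hS₀
  apply IsSemisimpleModule.of_sSup_simples_eq_top
  rw [eq_top_iff]
  rintro w -
  -- The components of a vector along the simple summands need only lie in `M`. The statement is
  -- therefore made for the degree `0` part of an arbitrary vector of `M`.
  suffices h : ∀ x : M.carrier, homProj M.isGrRep.internal 0 x ∈
      omSub (sSup {W : Submodule g.A M.Om | IsSimpleModule g.A W}) by
    have := h w.1
    rw [homProj_self M.isGrRep.internal (by rw [← hM.omega_eq]; exact w.2)] at this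
    exact mem_omSub.1 this
  intro x
  induction x using homogeneous_induction hdir with
  | zero => rw [map_zero]; exact Submodule.zero_mem _
  | add x y hx hy => rw [map_add]; exact Submodule.add_mem _ hx hy
  | mem N x hx =>
    have h := M.isGradedSub_iff.1 (hS N.1 N.2).isGradedSub
    have h1 := hM.isAtom_toOm (hS N.1 N.2) h.1
    rw [← isSimpleModule_iff_isAtom] at h1
    refine omSub_mono (le_sSup (show toOm h.1 ∈ _ from h1)) ?_
    rw [omSub_toOm, hM.omega_eq]
    exact ⟨(isGr_iff M.isGrRep.internal).1 h.2 0 x hx, homProj_mem _ _ _⟩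

/-- The simple summands `W` of `Ω(M)` generate simple submodules of `M`. The intersection of one
with the sum of the others is graded, and in degree `0` it lies in the intersection of `W` with the
other summands, which is `0`; so tightness gives independence. Their sum contains `M(0)`, hence is
`M`. -/
lemma isCompletelyReducible_of_om (h : IsSemisimpleModule g.A M.Om) :
    AdmMod.IsCompletelyReducible M := by
  classical
  obtain ⟨s, hind, hsup, hs⟩ := IsSemisimpleModule.exists_sSupIndep_sSup_simples_eq_top g.A M.Om
  let G : s → Submodule ℂ M.carrier := fun W => gen M.rep (omSub W.1)
  have hle : ∀ t : Set s, (⨆ W ∈ t, G W) ≤ gen M.rep (omSub (⨆ W ∈ t, W.1)) := fun t =>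
    iSup₂_le fun W hW => gen_mono (omSub_mono (le_iSup₂_of_le W hW le_rfl))
  have hst : ∀ t : Set s, IsStable M.rep (⨆ W ∈ t, G W) := by
    intro t
    rw [← sSup_image]
    exact isStable_sSup (by rintro _ ⟨W, _, rfl⟩; exact gen_stable _)
  have hgr : ∀ t : Set s, IsGr M.gr (⨆ W ∈ t, G W) := by
    intro t
    rw [← sSup_image]
    exact isGr_sSup (by
      rintro _ ⟨W, _, rfl⟩
      exact (M.isGradedSub_iff.1 (hM.isGradedSub_gen W.1)).2)
  have hG : iSupIndep G := by
    intro W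
    rw [disjoint_iff]
    refine hM.eq_bot _ ((gen_stable _).inf (hst {W' | W' ≠ W}))
      (IsGr.inf M.isGrRep.internal (M.isGradedSub_iff.1 (hM.isGradedSub_gen W.1)).2
        (hgr {W' | W' ≠ W})) ?_
    have h1 := (sSupIndep_iff s).1 hind W
    rw [disjoint_iff] at h1
    rw [eq_bot_iff, ← omSub_bot, ← h1, ← omSub_inf]
    rintro x ⟨⟨hx1, hx2⟩, hx0⟩
    refine ⟨?_, ?_⟩
    · rw [← hM.gen_omSub_inf]; exact ⟨hx1, hx0⟩
    · rw [← hM.gen_omSub_inf]; exact ⟨hle {W' | W' ≠ W} hx2, hx0⟩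
  refine ⟨Set.range G, ?_, ?_⟩
  · rintro _ ⟨W, rfl⟩
    exact hM.isSimpleSub_gen (isSimpleModule_iff_isAtom.1 (hs W.1 W.2))
  · have hmain : DirectSum.IsInternal fun N : Set.range G => (N : Submodule ℂ M.carrier) := by
      refine (DirectSum.isInternal_submodule_iff_iSupIndep_and_iSup_eq_top _).2
        ⟨(sSupIndep_iff _).1 hG.sSupIndep_range, ?_⟩
      rw [← sSup_eq_iSup', sSup_range, eq_top_iff, ← hM.gen_zero]
      have hst' : IsStable M.rep (⨆ W, G W) := by simpa using hst Set.univ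
      refine gen_le ?_ hst'
      have h1 : sSup s ≤ toOm hst' := by
        refine sSup_le fun W hW w hw => ?_
        exact (le_iSup G ⟨W, hW⟩) (le_gen _ (mem_omSub.2 hw))
      rw [hsup, top_le_iff] at h1
      rw [← hM.omega_eq]
      intro w hw
      have h2 : (⟨w, hw⟩ : M.Om) ∈ toOm hst' := by rw [h1]; trivial
      exact h2
    convert hmain

end Tight

end AdmMod

end Admissible

/-! ### `L` and `Ω` are quasi-inverse -/

section Inverse

open VertexOperatorAlgebra FiniteOrderAut TensorProduct

open scoped ModuleCat

variable {V : Type u} [AddCommGroup V] [Module ℂ V] [VertexOperatorAlgebra V]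
  {g : FiniteOrderAut V}

/-- A complex linear map on a module for `U(V[g])` that vanishes on a submodule, as a map on the
quotient. -/
def liftQC {X W : Type*} [AddCommGroup X] [Module ℂ X] [Module (UE g) X] [IsScalarTower ℂ (UE g) X]
    [AddCommGroup W] [Module ℂ W] (N : Submodule (UE g) X) (f : X →ₗ[ℂ] W) (h : ∀ x ∈ N, f x = 0) :
    X ⧸ N →ₗ[ℂ] W :=
  ((N.restrictScalars ℂ).liftQ f h).comp
    (Submodule.Quotient.restrictScalarsEquiv ℂ N).symm.toLinearMap

namespace AdmMod

/-- A bijective morphism of admissible modules is an isomorphism. -/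
def isoOfBijective {M N : AdmMod g} (f : M ⟶ N) (h : Function.Bijective f.toLin) : M ≅ N where
  hom := f
  inv :=
    { toLin := (LinearEquiv.ofBijective f.toLin h).symm.toLinearMap
      map_Y := fun v n w => by
        obtain ⟨w, rfl⟩ := h.2 w
        rw [← f.map_Y]
        apply h.1
        change f.toLin ((LinearEquiv.ofBijective f.toLin h).symm (LinearEquiv.ofBijective f.toLin h _)) =
          f.toLin (M.Y v n ((LinearEquiv.ofBijective f.toLin h).symm
            (LinearEquiv.ofBijective f.toLin h _)))
        rw [LinearEquiv.symm_apply_apply, LinearEquiv.symm_apply_apply]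
      map_gr := fun n w hw => by
        obtain ⟨w, rfl⟩ := h.2 w
        change (LinearEquiv.ofBijective f.toLin h).symm (LinearEquiv.ofBijective f.toLin h _) ∈ _
        rw [LinearEquiv.symm_apply_apply]
        -- `f` commutes with taking components, so by injectivity a preimage of a homogeneous vector
        -- equals its own component of that degree.
        have e := homProj_map M.isGrRep.internal N.isGrRep.internal (f := f.toLin) (m := 0)
          (fun n x hx => by rw [add_zero]; exact f.map_gr n x hx) n w
        rw [add_zero, homProj_self _ hw] at e
        rw [h.1 e]
        exact homProj_mem _ _ _ }
  hom_inv_id := by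
    apply Hom.ext
    apply LinearMap.ext
    intro w
    exact (LinearEquiv.ofBijective f.toLin h).symm_apply_apply w
  inv_hom_id := by
    apply Hom.ext
    apply LinearMap.ext
    intro w
    exact (LinearEquiv.ofBijective f.toLin h).apply_symm_apply w

lemma rep_L (h : LWellDefined g) (U : ModuleCat.{u} g.A) :
    ((LFunctor h).obj U).rep = act g (LU U) := by
  apply LinearMap.ext
  intro y
  induction y using Vg_induction with
  | zero => exact (map_zero ((LFunctor h).obj U).rep).trans (map_zero (act g (LU U))).symm
  | add x y hx hy =>
    exact (map_add ((LFunctor h).obj U).rep x y).trans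
      ((congrArg₂ (· + ·) hx hy).trans (map_add (act g (LU U)) x y).symm)
  | mem k q a _ _ => exact rep_el _ q a

lemma tight_L (h : LWellDefined g) (U : ModuleCat.{u} g.A) : ((LFunctor h).obj U).Tight := by
  rw [Tight, rep_L]
  exact isTight_LU U

/-- The map `U → Ω(L(U))`. -/
def unitHom (h : LWellDefined g) (U : ModuleCat.{u} g.A) :
    U →ₗ[g.A] ((LFunctor h).obj U).Om where
  toFun u := ⟨inL U u, by
    rw [(tight_L h U).omega_eq]
    exact inL_mem u⟩
  map_add' u v := Subtype.ext (map_add (inL U) u v)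
  map_smul' x u := by
    obtain ⟨a, rfl⟩ := g.toA_surjective x
    exact Subtype.ext (zeroMode_inL a u).symm

/-- By tightness `Ω(L(U))` is `L(U)(0)`, which is the faithful image of `U`. -/
lemma unitHom_bijective (h : LWellDefined g) (U : ModuleCat.{u} g.A) :
    Function.Bijective (unitHom h U) := by
  refine ⟨fun u v huv => inL_injective U (congrArg Subtype.val huv), fun w => ?_⟩
  have hw : w.1 ∈ Lgr U 0 := (tight_L h U).omega_eq.le w.2
  rw [← range_inL] at hw
  obtain ⟨u, hu⟩ := hw
  exact ⟨u, Subtype.ext hu⟩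

/-- `U ≅ Ω(L(U))` -/
def unitEquiv (h : LWellDefined g) (U : ModuleCat.{u} g.A) : U ≃ₗ[g.A] ((LFunctor h).obj U).Om :=
  LinearEquiv.ofBijective (unitHom h U) (unitHom_bijective h U)

/-- The isomorphism `Ω(L(U)) ≅ U`. -/
def unitIso (h : LWellDefined g) (U : ModuleCat.{u} g.A) :
    (OmegaFunctor g).obj ((LFunctor h).obj U) ≅ U :=
  (LinearEquiv.toModuleIso (unitEquiv h U)).symm

lemma unitIso_naturality (h : LWellDefined g) {U U' : ModuleCat.{u} g.A} (f : U ⟶ U') :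
    (OmegaFunctor g).map ((LFunctor h).map f) ≫ (unitIso h U').hom = (unitIso h U).hom ≫ f := by
  -- The inverses of the isomorphisms are the explicit maps `u ↦ inL U u`, for which the square
  -- commutes by definition.
  rw [← Iso.eq_comp_inv, Category.assoc, ← Iso.inv_comp_eq]
  rfl

/-! ### The canonical map `L(Ω(M)) → M` -/

variable (M : AdmMod g)

/-- The inclusion `Ω(M) → M`. -/
def omIncl : ((OmegaFunctor g).obj M : ModuleCat.{u} g.A) →ₗ[ℂ] M.carrier where
  toFun w := Subtype.val (p := (· ∈ Omega M.Y)) w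
  map_add' _ _ := rfl
  map_smul' c w := congrArg (fun x : M.Om => x.1) (algebraMap_smul_om (M := M) c w)

/-- The map `U(V[g]) ⊗ Ω(M) → M`. -/
def counitT : UE g ⊗[ℂ] ((OmegaFunctor g).obj M) →ₗ[ℂ] M.carrier :=
  liftTensor (liftEnd M.rep M.rep_lie) M.omIncl

lemma counitT_relM {t : UE g ⊗[ℂ] ((OmegaFunctor g).obj M)} (ht : t ∈ relM ((OmegaFunctor g).obj M)) :
    M.counitT t = 0 := by
  refine liftTensor_relM M.rep_lie (fun n hn y hy u => ?_) (fun k a hk ha u => ?_) ht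
  · exact M.omega_eq_lowest.le u.2 n hn y hy
  · rw [rep_el, ← zeroMode_apply hk]
    rfl

/-- The map `M(Ω(M)) → M`. -/
def counitM : MU ((OmegaFunctor g).obj M) →ₗ[ℂ] M.carrier :=
  liftQC (relM _) M.counitT fun _ ht => M.counitT_relM ht

lemma counitM_smul (x : UE g) (u : (OmegaFunctor g).obj M) :
    M.counitM (x • inM _ u) = liftEnd M.rep M.rep_lie x (M.omIncl u) := by
  rw [smul_inM]
  rfl

lemma counitM_inM (u : (OmegaFunctor g).obj M) : M.counitM (inM _ u) = M.omIncl u := by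
  rw [← one_smul (UE g) (inM _ u), counitM_smul, map_one]
  rfl

lemma counitM_act (y : g.Vg) (w : MU ((OmegaFunctor g).obj M)) :
    M.counitM (act g _ y w) = M.rep y (M.counitM w) := by
  induction w using MU_induction with
  | add x y hx hy => simp only [map_add, hx, hy]
  | smul x u =>
    rw [act_apply, ← mul_smul, counitM_smul, counitM_smul, map_mul, liftEnd_iota]
    rfl

variable {M}

lemma liftEnd_mem {x : UE g} {n : ℚ} (hx : x ∈ degUE g n) {m : ℚ} {w : M.carrier}
    (hw : w ∈ M.gr m) : liftEnd M.rep M.rep_lie x w ∈ M.gr (m + n) := by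
  induction hx using Submodule.span_induction with
  | zero => simp
  | add x y _ _ hx hy => rw [map_add]; exact Submodule.add_mem _ hx hy
  | smul c x _ hx => rw [map_smul]; exact Submodule.smul_mem _ _ hx
  | mem x hx =>
    obtain ⟨l, hl, rfl, rfl⟩ := hx
    induction l with
    | nil => simpa using hw
    | cons p l ih =>
      have ih := ih fun q hq => hl q (List.mem_cons_of_mem _ hq)
      have hp := M.isGrRep.mode _ _ p.2 (hl p List.mem_cons_self) _ ih
      simp only [List.map_cons, List.prod_cons, List.sum_cons, map_mul, Module.End.mul_apply]
      change liftEnd M.rep M.rep_lie (iota g p.2) _ ∈ _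
      rw [liftEnd_iota]
      rwa [show m + (p.1 + (l.map Prod.fst).sum) = m + (l.map Prod.fst).sum + p.1 by ring]

lemma liftEnd_map {M N : AdmMod g} (f : M ⟶ N) (x : UE g) (w : M.carrier) :
    f.toLin (liftEnd M.rep M.rep_lie x w) = liftEnd N.rep N.rep_lie x (f.toLin w) := by
  induction x using UE_induction generalizing w with
  | scalar c => simp [AlgHom.commutes, Module.algebraMap_end_apply]
  | iota y =>
    rw [liftEnd_iota, liftEnd_iota]
    induction y using Vg_induction with
    | zero => simp
    | add x y hx hy => simp only [map_add, LinearMap.add_apply, hx, hy]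
    | mem k q a _ _ => rw [rep_el, rep_el, f.map_Y]
  | mul x y hx hy => rw [map_mul, map_mul, Module.End.mul_apply, Module.End.mul_apply, hx, hy]
  | add x y hx hy => simp only [map_add, LinearMap.add_apply, hx, hy]

namespace Tight

variable (hM : M.Tight)

include hM

lemma counitM_gr {n : ℚ} {w : MU ((OmegaFunctor g).obj M)} (hw : w ∈ grM _ n) :
    M.counitM w ∈ M.gr n := by
  rw [grM_eq] at hw
  induction hw using Submodule.span_induction with
  | zero => simp
  | add w w' _ _ h h' => rw [map_add]; exact Submodule.add_mem _ h h'
  | smul c w _ h => rw [map_smul]; exact Submodule.smul_mem _ _ h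
  | mem w hw =>
    obtain ⟨x, hx, u, rfl⟩ := hw
    have h0 : M.omIncl u ∈ M.gr 0 := by rw [← hM.omega_eq]; exact u.2
    have := liftEnd_mem hx h0
    rwa [zero_add, ← counitM_smul] at this

/-- The kernel is a graded submodule that meets `Ω(M)` trivially, because the map is the inclusion
there; so it lies in `J`. Conversely the image of `J` is a graded submodule of `M` of positive
degree, which is zero by tightness. -/
lemma counitM_eq_zero {w : MU ((OmegaFunctor g).obj M)} : M.counitM w = 0 ↔ w ∈ JU _ := by
  have R := isGrRep_MU ((OmegaFunctor g).obj M)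
  constructor
  · have hs : IsStable (act g _) (LinearMap.ker M.counitM) := by
      intro y w hw
      rw [LinearMap.mem_ker, counitM_act, LinearMap.mem_ker.1 hw, map_zero]
    have hle : hs.toUE ≤ JU _ := by
      apply le_JU
      · have h0 : IsGr M.gr ⊥ := isGr_of_le bot_le
        have := h0.comap R.internal M.isGrRep.internal (f := M.counitM) fun n w hw =>
          hM.counitM_gr hw
        exact this
      · rw [IsStable.restrictScalars_toUE, eq_bot_iff, grM_zero, ← range_inM]
        rintro _ ⟨hw, ⟨u, rfl⟩⟩
        have h2 : M.counitM (inM _ u) = 0 := hw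
        rw [counitM_inM] at h2
        have h3 : u = 0 := Subtype.ext h2
        rw [h3, map_zero]
        exact Submodule.zero_mem _
    exact fun hw => hle hw
  · intro hw
    have h1 : ((JU ((OmegaFunctor g).obj M)).restrictScalars ℂ).map M.counitM = ⊥ := by
      apply hM.eq_bot
      · rintro y _ ⟨w, hw, rfl⟩
        exact ⟨_, (JU ((OmegaFunctor g).obj M)).smul_mem (iota g y) hw, M.counitM_act y w⟩
      · exact IsGr.map (fun n w hw => hM.counitM_gr hw) (JU_spec _).1
      · refine M.isGrRep.eq_bot_of_le_pos ?_
        rw [Submodule.map_le_iff_le_comap]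
        refine (JU_spec _).2.trans (sumOver_le fun n hn w hw => ?_)
        exact le_sumOver (p := (0 < ·)) hn (hM.counitM_gr hw)
    have h2 : M.counitM w ∈ ((JU ((OmegaFunctor g).obj M)).restrictScalars ℂ).map M.counitM :=
      ⟨w, hw, rfl⟩
    rw [h1] at h2
    exact h2

/-- The map `L(Ω(M)) → M`. -/
def counitL : LU ((OmegaFunctor g).obj M) →ₗ[ℂ] M.carrier :=
  liftQC (JU _) M.counitM fun _ hw => hM.counitM_eq_zero.2 hw

lemma counitL_toL (w : MU ((OmegaFunctor g).obj M)) : hM.counitL (toL _ w) = M.counitM w := rfl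

/-- The morphism `L(Ω(M)) → M`. -/
def counitHom (h : LWellDefined g) : (LFunctor h).obj ((OmegaFunctor g).obj M) ⟶ M where
  toLin := hM.counitL
  map_Y v n w := by
    obtain ⟨w, rfl⟩ := toL_surjective w
    change hM.counitL (toL _ (act g _ (g.el n v) w)) = M.Y v n (hM.counitL (toL _ w))
    rw [counitL_toL, counitL_toL, counitM_act, rep_el]
  map_gr := by
    rintro n _ ⟨w, hw, rfl⟩
    exact hM.counitM_gr hw

/-- The kernel `J` has been divided out, and the image contains `M(0)`, which generates `M`. -/
lemma counitHom_bijective (h : LWellDefined g) : Function.Bijective (hM.counitHom h).toLin := by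
  constructor
  · change Function.Injective hM.counitL
    rw [← LinearMap.ker_eq_bot, LinearMap.ker_eq_bot']
    intro w hw
    obtain ⟨w, rfl⟩ := toL_surjective w
    rw [counitL_toL, hM.counitM_eq_zero] at hw
    exact toL_eq_zero.2 hw
  · change Function.Surjective hM.counitL
    rw [← LinearMap.range_eq_top, eq_top_iff, ← hM.gen_zero]
    refine gen_le (fun w hw => ?_) ?_
    · rw [← hM.omega_eq] at hw
      exact ⟨toL _ (inM _ (⟨w, hw⟩ : M.Om)), M.counitM_inM _⟩
    · rintro y _ ⟨w, rfl⟩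
      obtain ⟨w, rfl⟩ := toL_surjective w
      exact ⟨toL _ (act g _ y w), by rw [counitL_toL, counitL_toL, counitM_act]⟩

/-- The isomorphism `L(Ω(M)) ≅ M`. -/
def counitIso (h : LWellDefined g) : (LFunctor h).obj ((OmegaFunctor g).obj M) ≅ M :=
  isoOfBijective (hM.counitHom h) (hM.counitHom_bijective h)

end Tight

lemma counit_naturality (h : LWellDefined g) {M N : AdmMod g} (hM : M.Tight) (hN : N.Tight)
    (f : M ⟶ N) : (LFunctor h).map ((OmegaFunctor g).map f) ≫ hN.counitHom h =
      hM.counitHom h ≫ f := by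
  apply Hom.ext
  apply LinearMap.ext
  intro w
  obtain ⟨w, rfl⟩ := toL_surjective w
  change N.counitM (mapM ((OmegaFunctor g).map f) w) = f.toLin (M.counitM w)
  induction w using MU_induction with
  | add x y hx hy => simp only [map_add, hx, hy]
  | smul x u =>
    rw [(mapM ((OmegaFunctor g).map f)).map_smul, mapM_inM, counitM_smul, counitM_smul, liftEnd_map]
    rfl

end AdmMod

end Inverse

/-! ### Passage to the full subcategories -/

section Restrictions

variable {V : Type u} [AddCommGroup V] [Module ℂ V] [VertexOperatorAlgebra V]
  {g : FiniteOrderAut V}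

open AdmMod

/-- `Ω ∘ L` restricted to a full subcategory is isomorphic to the identity. -/
def restrictUnit (h : LWellDefined g) {P : ObjectProperty (ModuleCat.{u} g.A)}
    {Q : ObjectProperty (AdmMod g)} (hL : ∀ U, P U → Q ((LFunctor h).obj U))
    (hΩ : ∀ M, Q M → P ((OmegaFunctor g).obj M)) :
    restrictFunctor (LFunctor h) P Q hL ⋙ restrictFunctor (OmegaFunctor g) Q P hΩ ≅
      𝟭 P.FullSubcategory :=
  NatIso.ofComponents (fun U => P.isoMk (unitIso h U.obj)) fun f =>
    P.hom_ext (unitIso_naturality h f.hom)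

/-- `L ∘ Ω` restricted to a full subcategory of tight modules is isomorphic to the identity. -/
def restrictCounit (h : LWellDefined g) {P : ObjectProperty (ModuleCat.{u} g.A)}
    {Q : ObjectProperty (AdmMod g)} (hL : ∀ U, P U → Q ((LFunctor h).obj U))
    (hΩ : ∀ M, Q M → P ((OmegaFunctor g).obj M)) (hQ : ∀ M, Q M → M.Tight) :
    restrictFunctor (OmegaFunctor g) Q P hΩ ⋙ restrictFunctor (LFunctor h) P Q hL ≅
      𝟭 Q.FullSubcategory :=
  NatIso.ofComponents (fun M => Q.isoMk ((hQ M.obj M.property).counitIso h)) fun {M N} f =>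
    Q.hom_ext (counit_naturality h (hQ M.obj M.property) (hQ N.obj N.property) f.hom)

lemma completelyReducible_L (h : LWellDefined g) (U : ModuleCat.{u} g.A)
    (hU : completelyReducibleA g U) : AdmMod.IsCompletelyReducible ((LFunctor h).obj U) :=
  have : IsSemisimpleModule g.A U := hU
  (tight_L h U).isCompletelyReducible_of_om (IsSemisimpleModule.congr (unitEquiv h U).symm)

lemma simple_L (h : LWellDefined g) (U : ModuleCat.{u} g.A) (hU : simpleA g U) :
    AdmMod.IsSimple ((LFunctor h).obj U) :=
  have : IsSimpleModule g.A U := hU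
  (tight_L h U).isSimple_of_om (IsSimpleModule.congr (unitEquiv h U).symm)

lemma completelyReducible_Omega (M : AdmMod g) (hM : AdmMod.IsCompletelyReducible M) :
    completelyReducibleA g ((OmegaFunctor g).obj M) :=
  (IsCompletelyReducible.tight hM).om_isSemisimple hM

lemma simple_Omega (M : AdmMod g) (hM : AdmMod.IsSimple M) : simpleA g ((OmegaFunctor g).obj M) :=
  (IsSimple.tight hM).om_isSimple hM

lemma isoClassMap_leftInverse {C D : Type*} [Category C] [Category D] {F : C ⥤ D} {G : D ⥤ C}
    (e : F ⋙ G ≅ 𝟭 C) : Function.LeftInverse (isoClassMap G) (isoClassMap F) := by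
  intro x
  induction x using Quotient.inductionOn with
  | h X => exact Quotient.sound ⟨e.app X⟩

end Restrictions

end TwistedVOA

end

open TwistedVOA in
theorem theorem7p2 {V : Type u} [AddCommGroup V] [Module ℂ V] [VertexOperatorAlgebra V]
    (g : FiniteOrderAut V) :
    ∃ (h : LWellDefined g)
      (hL : ∀ U, completelyReducibleA g U → AdmMod.IsCompletelyReducible ((LFunctor h).obj U))
      (hΩ : ∀ M, AdmMod.IsCompletelyReducible M → completelyReducibleA g ((OmegaFunctor g).obj M))
      (sL : ∀ U, simpleA g U → AdmMod.IsSimple ((LFunctor h).obj U))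
      (sΩ : ∀ M, AdmMod.IsSimple M → simpleA g ((OmegaFunctor g).obj M)),
      (restrictFunctor (LFunctor h) _ _ hL).IsEquivalence ∧
      (restrictFunctor (OmegaFunctor g) _ _ hΩ).IsEquivalence ∧
      Nonempty (restrictFunctor (LFunctor h) _ _ hL ⋙ restrictFunctor (OmegaFunctor g) _ _ hΩ ≅
        𝟭 (completelyReducibleA g).FullSubcategory) ∧
      Nonempty (restrictFunctor (OmegaFunctor g) _ _ hΩ ⋙ restrictFunctor (LFunctor h) _ _ hL ≅
        𝟭 (AdmMod.IsCompletelyReducible (g := g)).FullSubcategory) ∧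
      Function.LeftInverse (isoClassMap (restrictFunctor (OmegaFunctor g) _ _ sΩ))
        (isoClassMap (restrictFunctor (LFunctor h) _ _ sL)) ∧
      Function.RightInverse (isoClassMap (restrictFunctor (OmegaFunctor g) _ _ sΩ))
        (isoClassMap (restrictFunctor (LFunctor h) _ _ sL)) := by
  have h := lWellDefined g
  let e₁ := restrictUnit h (completelyReducible_L h) completelyReducible_Omega
  let e₂ := restrictCounit h (completelyReducible_L h) completelyReducible_Omega
    fun _ => AdmMod.IsCompletelyReducible.tight
  -- No triangle identity has to be checked: `Equivalence.mk` adjusts the unit.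
  let E := CategoryTheory.Equivalence.mk _ _ e₁.symm e₂
  exact ⟨h, completelyReducible_L h, completelyReducible_Omega, simple_L h, simple_Omega,
    E.isEquivalence_functor, E.isEquivalence_inverse, ⟨e₁⟩, ⟨e₂⟩,
    isoClassMap_leftInverse (restrictUnit h (simple_L h) simple_Omega),
    isoClassMap_leftInverse (restrictCounit h (simple_L h) simple_Omega
      fun _ => AdmMod.IsSimple.tight)⟩
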